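/- **Theorem 1.** Fix an integer $k\ge 3$ and a real $\alpha>0$. For $t\in[0,1]$ let $$\Omega(t,\alpha,k)=t+\alpha\log_2\Bigl(1-\frac{k}{2^k}t^{k-1}+\frac{k-1}{2^k}t^k\Bigr).$$ A random $k$-SAT instance $\mathcal F$ with $N$ variables and $M$ clauses is a uniformly random set of $M$ distinct clauses, where a clause is a disjunction of $k$ distinct literals, no two of them complementary, built from $N$ Boolean variables. Take $M=\lfloor\alpha N\rfloor$. For a partial assignment $A$ let $\mathcal F_A$ be the residual instance: the clauses of $\mathcal F$ with a true literal are removed, and the false literals are removed from the remaining clauses. Procedure #DPLL-UC builds a search tree, starting from $A=\emptyset$, as follows. (1) If $\mathcal F_A$ is empty, the node is a *solution leaf*. (2) Otherwise, if $\mathcal F_A$ contains the empty clause, the node is a *contradiction leaf*. (3) Otherwise, if $\mathcal F_A$ contains a 1-clause, pick any 1-clause $\ell$ (by an arbitrary, possibly randomized, rule depending on $\mathcal F$ and $A$); the node has the single child $A\cup\{\ell\}$. (4) Otherwise pick an unset literal $\ell$ uniformly at random; the node has the two children $A\cup\{\ell\}$ and $A\cup\{\bar\ell\}$, which are then explored with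 independent random choices. Let $L_S(N,\alpha,k)$, $L_C(N,\alpha,k)$ be the expectations, over the instance and the random choices of the procedure, of the numbers of solution and of contradiction leaves. Then, as $N\to\infty$, $$L_S(N,\alpha,k)=2^{N\omega_S(\alpha,k)+o(N)},\qquad \omega_S(\alpha,k)=\Omega(1,\alpha,k),$$ $$L_C(N,\alpha,k)=2^{N\omega_C(\alpha,k)+o(N)},\qquad \omega_C(\alpha,k)=\max_{t\in[0,1]}\Omega(t,\alpha,k),$$ and the expectation $L_S+L_C$ of the total number of leaves is $2^{N\omega_C(\alpha,k)+o(N)}$. -/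

import Mathlib

open Filter Asymptotics
open scoped ENNReal

namespace RandomSAT

/-- A literal over the variables `Fin N`: `(x, true)` is `x` and `(x, false)` is its negation. -/
abbrev Literal (N : ℕ) := Fin N × Bool

/-- The complementary literal. -/
def Literal.neg {N : ℕ} (l : Literal N) : Literal N := (l.1, !l.2)

/-- A clause is the disjunction of a set of literals (the empty clause is false). -/
abbrev Clause (N : ℕ) := Finset (Literal N)

/-- A formula in conjunctive normal form is a set of clauses. -/
abbrev Formula (N : ℕ) := Finset (Clause N)

/-- The disjunctions of `k` distinct literals, no two of them complementary. -/
def kClauses (k N : ℕ) : Finset (Clause N) :=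
  Finset.univ.filter fun c => c.card = k ∧ ∀ l ∈ c, Literal.neg l ∉ c

/-- The `k`-SAT instances with `N` variables and `M` clauses: the sets of `M` such disjunctions. -/
def instances (k N M : ℕ) : Finset (Formula N) :=
  (kClauses k N).powersetCard M

/-- A partial assignment; `none` means that the variable is unset. -/
abbrev Assignment (N : ℕ) := Fin N → Option Bool

/-- The partial assignment `A ∪ l`: the literal `l` is made true. -/
def Assignment.add {N : ℕ} (A : Assignment N) (l : Literal N) : Assignment N :=
  Function.update A l.1 (some l.2)

/-- The number of unset variables. -/
def Assignment.numUnset {N : ℕ} (A : Assignment N) : ℕ :=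
  (Finset.univ.filter fun x => A x = none).card

/-- What is left from `F` given `A`: the clauses with a true literal are removed, and the false
literals are removed from the other clauses. -/
def residualFormula {N : ℕ} (F : Formula N) (A : Assignment N) : Formula N :=
  (F.filter fun c => ∀ l ∈ c, A l.1 ≠ some l.2).image
    fun c => c.filter fun l => A l.1 = none

theorem Assignment.numUnset_add_lt {N : ℕ} (A : Assignment N) (l : Literal N)
    (h : A l.1 = none) : (A.add l).numUnset < A.numUnset := by
  have hval : ∀ x, A.add l x = none ↔ x ≠ l.1 ∧ A x = none := by
    intro x
    by_cases hx : x = l.1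
    · subst hx; simp [Assignment.add]
    · simp [Assignment.add, hx]
  refine Finset.card_lt_card (Finset.ssubset_iff_of_subset ?_ |>.2 ⟨l.1, ?_, ?_⟩)
  · intro x hx
    exact Finset.mem_filter.2 ⟨Finset.mem_univ x, ((hval x).1 (Finset.mem_filter.1 hx).2).2⟩
  · exact Finset.mem_filter.2 ⟨Finset.mem_univ _, h⟩
  · exact fun hx => ((hval l.1).1 (Finset.mem_filter.1 hx).2).1 rfl

theorem unset_of_mem_residualFormula {N : ℕ} {F : Formula N} {A : Assignment N} {c : Clause N}
    (hc : c ∈ residualFormula F A) {l : Literal N} (hl : l ∈ c) : A l.1 = none := by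
  obtain ⟨d, -, rfl⟩ := Finset.mem_image.1 hc
  exact (Finset.mem_filter.1 hl).2

theorem unset_of_unit {N : ℕ} {F : Formula N} {A : Assignment N} {l : Literal N}
    (h : {l} ∈ residualFormula F A) : A l.1 = none :=
  unset_of_mem_residualFormula h (Finset.mem_singleton_self l)

/-- The unset literals. -/
abbrev UnsetLiteral {N : ℕ} (A : Assignment N) := {l : Literal N // A l.1 = none}

theorem nonempty_unsetLiteral {N : ℕ} {F : Formula N} {A : Assignment N}
    (h₁ : residualFormula F A ≠ ∅) (h₂ : ∅ ∉ residualFormula F A) : Nonempty (UnsetLiteral A) := by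
  obtain ⟨c, hc⟩ := Finset.nonempty_iff_ne_empty.2 h₁
  have hne : c ≠ ∅ := fun h => h₂ (h ▸ hc)
  obtain ⟨l, hl⟩ := Finset.nonempty_iff_ne_empty.2 hne
  exact ⟨⟨l, unset_of_mem_residualFormula hc hl⟩⟩

/-- A way to "pick any 1-clause": an arbitrary rule, possibly randomized, that picks one of the
1-clauses of the residual formula whenever there is one. -/
abbrev UnitRule (N : ℕ) :=
  (F : Formula N) → (A : Assignment N) → (∃ l, {l} ∈ residualFormula F A) →
    PMF {l : Literal N // {l} ∈ residualFormula F A}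

/-- Search trees, with marked leaves; an inner node carries the literal it acts on. -/
inductive SearchTree (N : ℕ) : Type
  | solution : SearchTree N
  | contradiction : SearchTree N
  | propagation (l : Literal N) (t : SearchTree N) : SearchTree N
  | split (l : Literal N) (t₁ t₂ : SearchTree N) : SearchTree N

/-- The number of solution leaves. -/
def SearchTree.solutionLeaves {N : ℕ} : SearchTree N → ℕ
  | .solution => 1
  | .contradiction => 0
  | .propagation _ t => t.solutionLeaves
  | .split _ t₁ t₂ => t₁.solutionLeaves + t₂.solutionLeaves

/-- The number of contradiction leaves. -/
def SearchTree.contradictionLeaves {N : ℕ} : SearchTree N → ℕ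
  | .solution => 0
  | .contradiction => 1
  | .propagation _ t => t.contradictionLeaves
  | .split _ t₁ t₂ => t₁.contradictionLeaves + t₂.contradictionLeaves

/-- The number of leaves. -/
def SearchTree.leaves {N : ℕ} (t : SearchTree N) : ℕ :=
  t.solutionLeaves + t.contradictionLeaves

/-- The law of the search tree that the procedure #DPLL-UC builds on the instance `F` from the
partial assignment `A`. The counter of solutions is left out: it does not influence the tree. -/
noncomputable def dpll {N : ℕ} (rule : UnitRule N) (F : Formula N) (A : Assignment N) :
    PMF (SearchTree N) :=
  if h₁ : residualFormula F A = ∅ then PMF.pure .solution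
  else if h₂ : ∅ ∈ residualFormula F A then PMF.pure .contradiction
  else if h₃ : ∃ l, {l} ∈ residualFormula F A then
    (rule F A h₃).bind fun l =>
      (dpll rule F (A.add l.1)).map (.propagation l.1)
  else
    haveI : Nonempty (UnsetLiteral A) := nonempty_unsetLiteral h₁ h₂
    (PMF.uniformOfFintype (UnsetLiteral A)).bind fun l =>
      (dpll rule F (A.add l.1)).bind fun t₁ =>
        (dpll rule F (A.add (Literal.neg l.1))).map fun t₂ => .split l.1 t₁ t₂
termination_by A.numUnset
decreasing_by
  · exact A.numUnset_add_lt _ (unset_of_unit l.2)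
  · exact A.numUnset_add_lt _ l.2
  · exact A.numUnset_add_lt _ l.2

/-- The expectation of a statistic `f` of the #DPLL-UC search tree, called with the empty
assignment on a uniformly random `k`-SAT instance with `N` variables and `M` clauses. -/
noncomputable def expectation (k N M : ℕ) (rule : UnitRule N) (f : SearchTree N → ℕ) : ℝ≥0∞ :=
  (∑ F ∈ instances k N M, ∑' t, dpll rule F (fun _ => none) t * (f t : ℝ≥0∞)) /
    ((instances k N M).card : ℝ≥0∞)

/-- The function `Ω(t, α, k)`. -/
noncomputable def Omega (t α : ℝ) (k : ℕ) : ℝ :=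
  t + α * Real.logb 2 (1 - (k : ℝ) / 2 ^ k * t ^ (k - 1) + ((k : ℝ) - 1) / 2 ^ k * t ^ k)

/-- The exponent `ω_S(α, k)`. -/
noncomputable def omegaS (α : ℝ) (k : ℕ) : ℝ := Omega 1 α k

/-- The exponent `ω_C(α, k)`. -/
noncomputable def omegaC (α : ℝ) (k : ℕ) : ℝ :=
  sSup ((fun t => Omega t α k) '' Set.Icc 0 1)

/-- `L(N) = 2 ^ (N ω + o(N))`. -/
def HasExponent (L : ℕ → ℝ≥0∞) (ω : ℝ) : Prop :=
  ∃ r : ℕ → ℝ, r =o[atTop] (fun N : ℕ => (N : ℝ)) ∧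
    ∀ᶠ N : ℕ in atTop, L N = ENNReal.ofReal ((2 : ℝ) ^ ((N : ℝ) * ω + r N))

end RandomSAT

/-!
The proof follows a full assignment `σ` down the search tree. The node reached is determined by the
set `S` of assigned variables, and `S` grows as follows: while a clause of the instance has all its
variables but one in `S`, all those literals false under `σ` and the last one true (`oneClause`),
the last variable is added, and otherwise a uniformly random one. The clauses that are false under
`σ` (`zeroClause`) do not contribute to this growth, but they stop the walk when all their variables
but at most one are in `S` (`Blocked`). Since forced variables may be added in any order
(`hit_insert`), the law of the sets at which the walk splits does not depend on the rule that picks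
1-clauses.

*Upper bounds.* The number of leaves is one plus the number of splits, and a split at which `T`
variables are set lies on the walks of `2 ^ (N - T)` assignments. So the expected number of leaves
is at most one plus the sum over `T` of `2 ^ T` times the probability that the walk along a given
`σ` splits at a set of size `T` (`value_leaves_le_sum_hit`). The propagating and the blocking
clauses are disjoint families, so given the former that probability is at most the one of avoiding
the `numBlocking k N T` clauses that block a fixed set of size `T` (`sum_hit_le`), which is
`survival k (T / N) ^ (α N)` up to subexponential factors. This gives `2 ^ (N Ω(T / N))`. The
solution leaves are at most as numerous as the solutions, and these give the case `T = N`.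

*Lower bounds.* It remains to see that, apart from being blocked, the walk splits at a set of size
close to `t N` with a probability that is not exponentially small, where `t` is `1` for the solution
leaves and a maximizer of `Ω` for the contradiction leaves. Below such a split there is a solution
leaf if `σ` is a solution, and two additional clauses in the instance produce a contradiction leaf
with probability at least `1 / N` (`le_expectation`, `inv_le_value_contradictionLeaves`).

For `t = 1`, ask for a split at which only two given variables are unset: it suffices to forbid
the clauses that could force one of these, an asymptotically negligible part of all the clauses
(`le_sum_hit_pair`).

At an interior maximizer found by `exists_maximizer`, `Ω` has been nondecreasing up to `t`, which
says exactly enough about the branching number of unit propagation: setting a variable forces fewer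
than `Real.log 2 < 1` other variables on average. The clauses are revealed as the walk needs them
(`exploreCount_le_sum_hit`), and the variables that are forced but not yet set form a queue, which
has to be empty after `T` steps. These steps are grouped in `K + 1` rounds of `r` steps. In each
round but the last, the number of revealed clauses in the instance has its mode below `r`, hence is
at most `r` with probability at least `1 / (M + 1)` (`choose_add_le_mul_binomSum`), and the queue
gets processed in the next round; in the last round no clause is revealed at all, which costs a
factor `2 ^ (-ε N)` with `ε → 0` as `r / N → 0` (`choose_le_mul_exploreCount`).
-/

namespace RandomSAT

/-! ### Expected values below a node of the search tree -/

theorem tsum_bind_mul {β γ : Type*} (p : PMF β) (q : β → PMF γ) (g : γ → ℝ≥0∞) :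
    ∑' b, (p.bind q) b * g b = ∑' a, p a * ∑' b, q a b * g b := by
  simp only [PMF.bind_apply, ← ENNReal.tsum_mul_right, ← ENNReal.tsum_mul_left]
  rw [ENNReal.tsum_comm]
  simp only [mul_assoc]

theorem tsum_map_mul {β γ : Type*} (p : PMF β) (h : β → γ) (g : γ → ℝ≥0∞) :
    ∑' b, (p.map h) b * g b = ∑' a, p a * g (h a) := by
  rw [← PMF.bind_pure_comp, tsum_bind_mul]
  congr 1
  ext a
  congr 1
  rw [tsum_eq_single (h a)]
  · simp
  · intro b hb
    simp [PMF.pure_apply, hb]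

theorem tsum_pure_mul {γ : Type*} (c : γ) (g : γ → ℝ≥0∞) :
    ∑' b, (PMF.pure c) b * g b = g c := by
  rw [tsum_eq_single c]
  · simp
  · intro b hb
    simp [PMF.pure_apply, hb]

/-- The expectation of the statistic `f` of the part of the search tree below the node `A`. -/
noncomputable def value {N : ℕ} (rule : UnitRule N) (f : SearchTree N → ℕ) (F : Formula N)
    (A : Assignment N) : ℝ≥0∞ :=
  ∑' t, dpll rule F A t * (f t : ℝ≥0∞)

/-- The statistics that count leaves: they are additive over the children of a node. -/
structure IsLeafCount {N : ℕ} (f : SearchTree N → ℕ) : Prop where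
  propagation : ∀ l t, f (.propagation l t) = f t
  split : ∀ l t₁ t₂, f (.split l t₁ t₂) = f t₁ + f t₂

theorem isLeafCount_solutionLeaves {N : ℕ} :
    IsLeafCount (SearchTree.solutionLeaves (N := N)) := ⟨fun _ _ => rfl, fun _ _ _ => rfl⟩

theorem isLeafCount_contradictionLeaves {N : ℕ} :
    IsLeafCount (SearchTree.contradictionLeaves (N := N)) := ⟨fun _ _ => rfl, fun _ _ _ => rfl⟩

theorem isLeafCount_leaves {N : ℕ} : IsLeafCount (SearchTree.leaves (N := N)) :=
  ⟨fun _ _ => rfl, fun _ _ _ => by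
    simp only [SearchTree.leaves, SearchTree.solutionLeaves, SearchTree.contradictionLeaves]
    omega⟩

theorem value_leaves {N : ℕ} (rule : UnitRule N) (F : Formula N) (A : Assignment N) :
    value rule SearchTree.leaves F A =
      value rule SearchTree.solutionLeaves F A + value rule SearchTree.contradictionLeaves F A := by
  simp only [value, SearchTree.leaves, Nat.cast_add, mul_add, ENNReal.tsum_add]

section value

variable {N : ℕ} {rule : UnitRule N} {f : SearchTree N → ℕ} {F : Formula N} {A : Assignment N}

theorem value_of_solution (h : residualFormula F A = ∅) :
    value rule f F A = f .solution := by
  rw [value, dpll, dif_pos h, tsum_pure_mul]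

theorem value_of_contradiction (h : ∅ ∈ residualFormula F A) :
    value rule f F A = f .contradiction := by
  have h₁ : residualFormula F A ≠ ∅ := fun h' => by simp [h'] at h
  rw [value, dpll, dif_neg h₁, dif_pos h, tsum_pure_mul]

theorem value_of_unit (hf : IsLeafCount f) (h₂ : ∅ ∉ residualFormula F A)
    (h₃ : ∃ l, {l} ∈ residualFormula F A) :
    value rule f F A = ∑' l, rule F A h₃ l * value rule f F (A.add l.1) := by
  have h₁ : residualFormula F A ≠ ∅ := fun h' => by
    obtain ⟨l, hl⟩ := h₃
    simp [h'] at hl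
  rw [value, dpll, dif_neg h₁, dif_neg h₂, dif_pos h₃, tsum_bind_mul]
  simp only [tsum_map_mul, hf.propagation, value]

theorem value_le_of_unit (hf : IsLeafCount f) (h₂ : ∅ ∉ residualFormula F A)
    (h₃ : ∃ l, {l} ∈ residualFormula F A) {a : ℝ≥0∞}
    (h : ∀ l, {l} ∈ residualFormula F A → value rule f F (A.add l) ≤ a) :
    value rule f F A ≤ a := by
  rw [value_of_unit hf h₂ h₃]
  calc _ ≤ ∑' l, rule F A h₃ l * a := ENNReal.tsum_le_tsum fun l => by gcongr; exact h l.1 l.2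
    _ = a := by rw [ENNReal.tsum_mul_right, PMF.tsum_coe, one_mul]

theorem le_value_of_unit (hf : IsLeafCount f) (h₂ : ∅ ∉ residualFormula F A)
    (h₃ : ∃ l, {l} ∈ residualFormula F A) {a : ℝ≥0∞}
    (h : ∀ l, {l} ∈ residualFormula F A → a ≤ value rule f F (A.add l)) :
    a ≤ value rule f F A := by
  rw [value_of_unit hf h₂ h₃]
  calc a = ∑' l, rule F A h₃ l * a := by rw [ENNReal.tsum_mul_right, PMF.tsum_coe, one_mul]
    _ ≤ _ := ENNReal.tsum_le_tsum fun l => by gcongr; exact h l.1 l.2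

theorem sum_unsetLiteral (A : Assignment N) (g : Literal N → ℝ≥0∞) :
    ∑ l : UnsetLiteral A, g l.1 =
      ∑ x ∈ Finset.univ.filter (fun x => A x = none), (g (x, true) + g (x, false)) := by
  rw [← Finset.sum_subtype (Finset.univ.filter (fun l : Literal N => A l.1 = none))
    (fun l => by simp) g]
  have : Finset.univ.filter (fun l : Literal N => A l.1 = none) =
      (Finset.univ.filter (fun x => A x = none)) ×ˢ (Finset.univ : Finset Bool) := by
    ext l; simp
  rw [this, Finset.sum_product]
  simp

/-- At a split the expected value is the average over the unset variables `x` of the sum of the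
expected values below the two children: choosing the literal `x` or its negation gives the same
two children. -/
theorem value_of_split (hf : IsLeafCount f) (h₁ : residualFormula F A ≠ ∅)
    (h₂ : ∅ ∉ residualFormula F A) (h₃ : ¬ ∃ l, {l} ∈ residualFormula F A) :
    value rule f F A =
      (∑ x ∈ Finset.univ.filter (fun x => A x = none),
        (value rule f F (A.add (x, true)) + value rule f F (A.add (x, false)))) /
          (A.numUnset : ℝ≥0∞) := by
  have : Nonempty (UnsetLiteral A) := nonempty_unsetLiteral h₁ h₂
  have key : value rule f F A = ∑ l : UnsetLiteral A, (Fintype.card (UnsetLiteral A) : ℝ≥0∞)⁻¹ *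
      (value rule f F (A.add l.1) + value rule f F (A.add (Literal.neg l.1))) := by
    rw [value, dpll, dif_neg h₁, dif_neg h₂, dif_neg h₃, tsum_bind_mul, tsum_fintype]
    refine Finset.sum_congr rfl fun l _ => ?_
    rw [PMF.uniformOfFintype_apply, tsum_bind_mul]
    congr 1
    simp only [tsum_map_mul, hf.split, Nat.cast_add, mul_add, ENNReal.tsum_add,
      ENNReal.tsum_mul_right, PMF.tsum_coe, one_mul, value]
  have hcard : (Fintype.card (UnsetLiteral A) : ℝ≥0∞) = 2 * (A.numUnset : ℝ≥0∞) := by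
    have h := sum_unsetLiteral A (fun _ => 1)
    simp only [Finset.sum_const, Finset.card_univ, nsmul_eq_mul, mul_one] at h
    rw [h, Assignment.numUnset, mul_comm]
    norm_num
  rw [key, ← Finset.mul_sum, sum_unsetLiteral A fun l =>
    value rule f F (A.add l) + value rule f F (A.add (Literal.neg l)), hcard]
  have hx : ∀ x : Fin N, value rule f F (A.add (x, true)) +
      value rule f F (A.add (Literal.neg (x, true))) +
      (value rule f F (A.add (x, false)) + value rule f F (A.add (Literal.neg (x, false)))) =
      2 * (value rule f F (A.add (x, true)) + value rule f F (A.add (x, false))) := by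
    intro x
    simp only [Literal.neg, Bool.not_true, Bool.not_false]
    ring
  simp only [hx, ← Finset.mul_sum]
  rw [ENNReal.mul_inv (by simp) (by simp), ENNReal.div_eq_inv_mul]
  rw [mul_mul_mul_comm, ENNReal.inv_mul_cancel (by simp) (by simp), one_mul]

end value

/-! ### Clauses and nodes relative to a full assignment -/

/-- The part of the full assignment `σ` that concerns the variables in `S`. -/
def restrict {N : ℕ} (σ : Fin N → Bool) (S : Finset (Fin N)) : Assignment N :=
  fun v => if v ∈ S then some (σ v) else none

/-- The clause with variables `V` all of whose literals are false under `σ`. -/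
def zeroClause {N : ℕ} (σ : Fin N → Bool) (V : Finset (Fin N)) : Clause N :=
  V.image fun v => (v, !σ v)

/-- The clause whose only literal that is true under `σ` is the one of `z`, and whose false
literals are those of the variables in `V`. -/
def oneClause {N : ℕ} (σ : Fin N → Bool) (z : Fin N) (V : Finset (Fin N)) : Clause N :=
  insert (z, σ z) (zeroClause σ V)

open scoped Classical in
/-- The variables whose value in `σ` is forced by unit propagation, in one step, by the values of
the variables in `S`. -/
noncomputable def forced {N : ℕ} (σ : Fin N → Bool) (F : Formula N) (S : Finset (Fin N)) :
    Finset (Fin N) :=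
  Finset.univ.filter fun z => ∃ V ⊆ S, oneClause σ z V ∈ F

/-- Some clause that is false under `σ` has at most one variable outside `S`. Then the node that
assigns the variables in `S` as `σ` does is not a split: its residual formula contains the empty
clause or a unit clause (`empty_or_unit_of_blocked`). -/
def Blocked {N : ℕ} (σ : Fin N → Bool) (F : Formula N) (S : Finset (Fin N)) : Prop :=
  ∃ V, zeroClause σ V ∈ F ∧ (V \ S).card ≤ 1

section walk

variable {N : ℕ} {σ : Fin N → Bool} {F : Formula N} {S S' : Finset (Fin N)}

theorem restrict_empty : restrict σ ∅ = fun _ => none := by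
  funext v; simp [restrict]

theorem restrict_eq_none {v : Fin N} : restrict σ S v = none ↔ v ∉ S := by
  simp [restrict]

theorem restrict_eq_some {v : Fin N} {b : Bool} :
    restrict σ S v = some b ↔ v ∈ S ∧ b = σ v := by
  simp [restrict, eq_comm]

theorem numUnset_restrict : (restrict σ S).numUnset = Sᶜ.card := by
  simp only [Assignment.numUnset, restrict_eq_none]
  congr 1
  ext; simp

theorem restrict_congr {τ : Fin N → Bool} (h : ∀ v ∈ S, σ v = τ v) :
    restrict σ S = restrict τ S := by
  funext v
  by_cases hv : v ∈ S
  · simp [restrict, hv, h v hv]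
  · simp [restrict, hv]

theorem restrict_add {x : Fin N} {b : Bool} (hx : x ∉ S) :
    (restrict σ S).add (x, b) = restrict (Function.update σ x b) (insert x S) := by
  funext v
  by_cases hv : v = x
  · subst hv; simp [restrict, Assignment.add]
  · simp [restrict, Assignment.add, hv]

theorem mem_zeroClause {V : Finset (Fin N)} {l : Literal N} :
    l ∈ zeroClause σ V ↔ l.1 ∈ V ∧ l.2 = !σ l.1 := by
  simp only [zeroClause, Finset.mem_image]
  constructor
  · rintro ⟨v, hv, rfl⟩; exact ⟨hv, rfl⟩
  · rintro ⟨h, h'⟩; exact ⟨l.1, h, Prod.ext rfl h'.symm⟩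

theorem mem_oneClause {z : Fin N} {V : Finset (Fin N)} {l : Literal N} :
    l ∈ oneClause σ z V ↔ l = (z, σ z) ∨ (l.1 ∈ V ∧ l.2 = !σ l.1) := by
  rw [oneClause, Finset.mem_insert, mem_zeroClause]

theorem mem_forced {z : Fin N} : z ∈ forced σ F S ↔ ∃ V ⊆ S, oneClause σ z V ∈ F := by
  simp [forced]

theorem forced_mono : Monotone (forced σ F) := fun _ _ h _ hz => by
  obtain ⟨V, hV, hc⟩ := mem_forced.1 hz
  exact mem_forced.2 ⟨V, hV.trans h, hc⟩

theorem Blocked.mono (h : Blocked σ F S) (hS : S ⊆ S') : Blocked σ F S' := by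
  obtain ⟨V, hV, hc⟩ := h
  exact ⟨V, hV, (Finset.card_le_card (Finset.sdiff_subset_sdiff le_rfl hS)).trans hc⟩

theorem mem_residualFormula {A : Assignment N} {d : Clause N} :
    d ∈ residualFormula F A ↔
      ∃ c ∈ F, (∀ l ∈ c, A l.1 ≠ some l.2) ∧ c.filter (fun l => A l.1 = none) = d := by
  simp [residualFormula, and_assoc]

theorem residualFormula_eq_empty {A : Assignment N} :
    residualFormula F A = ∅ ↔ ∀ c ∈ F, ∃ l ∈ c, A l.1 = some l.2 := by
  rw [residualFormula, Finset.image_eq_empty, Finset.filter_eq_empty_iff]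
  push Not
  rfl

/-- A clause of the residual formula consists of its false literals, and of literals of unset
variables. -/
theorem exists_of_mem_residualFormula {d : Clause N} (h : d ∈ residualFormula F (restrict σ S)) :
    ∃ V ⊆ S, d ∪ zeroClause σ V ∈ F ∧ ∀ l ∈ d, l.1 ∉ S := by
  obtain ⟨c, hc, htrue, rfl⟩ := mem_residualFormula.1 h
  refine ⟨(c.filter fun l => l.1 ∈ S).image Prod.fst, ?_, ?_, ?_⟩
  · intro v hv
    obtain ⟨l, hl, rfl⟩ := Finset.mem_image.1 hv
    exact (Finset.mem_filter.1 hl).2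
  · convert hc
    ext l
    have hval : ∀ l ∈ c, l.1 ∈ S → l.2 = !σ l.1 := by
      intro l hl hlS
      have := htrue l hl
      rw [Ne, restrict_eq_some] at this
      have h2 : l.2 ≠ σ l.1 := fun h => this ⟨hlS, h⟩
      revert h2
      cases l.2 <;> cases σ l.1 <;> simp
    simp only [Finset.mem_union, Finset.mem_filter, restrict_eq_none, mem_zeroClause,
      Finset.mem_image]
    constructor
    · rintro (h | ⟨⟨l', ⟨hl', hS⟩, h1⟩, h2⟩)
      · exact h.1
      · have : l = l' := Prod.ext h1.symm (by rw [h2, ← h1, hval l' hl' hS])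
        rwa [this]
    · intro hl
      by_cases hS : l.1 ∈ S
      · exact Or.inr ⟨⟨l, ⟨hl, hS⟩, rfl⟩, hval l hl hS⟩
      · exact Or.inl ⟨hl, hS⟩
  · intro l hl
    exact restrict_eq_none.1 (Finset.mem_filter.1 hl).2

theorem mem_residualFormula_of_union {d : Clause N} {V : Finset (Fin N)} (hV : V ⊆ S)
    (hF : d ∪ zeroClause σ V ∈ F) (hd : ∀ l ∈ d, l.1 ∉ S) :
    d ∈ residualFormula F (restrict σ S) := by
  refine mem_residualFormula.2 ⟨_, hF, ?_, ?_⟩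
  · intro l hl h
    rw [restrict_eq_some] at h
    rcases Finset.mem_union.1 hl with hl | hl
    · exact hd l hl h.1
    · have := (mem_zeroClause.1 hl).2
      rw [h.2] at this
      simp at this
  · ext l
    simp only [Finset.mem_filter, Finset.mem_union, restrict_eq_none]
    constructor
    · rintro ⟨h | h, hS⟩
      · exact h
      · exact absurd (hV (mem_zeroClause.1 h).1) hS
    · exact fun h => ⟨Or.inl h, hd l h⟩

theorem blocked_of_empty_mem (h : ∅ ∈ residualFormula F (restrict σ S)) : Blocked σ F S := by
  obtain ⟨V, hV, hF, -⟩ := exists_of_mem_residualFormula h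
  exact ⟨V, by simpa using hF, by simp [Finset.sdiff_eq_empty_iff_subset.2 hV]⟩

theorem zeroClause_insert (z : Fin N) (V : Finset (Fin N)) :
    zeroClause σ (insert z V) = {(z, !σ z)} ∪ zeroClause σ V := by
  rw [zeroClause, Finset.image_insert, zeroClause, Finset.insert_eq]

/-- A unit clause either agrees with `σ`, and then its variable is forced, or it comes from a
clause that is false under `σ`. -/
theorem forced_or_blocked_of_unit {l : Literal N}
    (h : {l} ∈ residualFormula F (restrict σ S)) :
    l.1 ∉ S ∧ (l.1 ∈ forced σ F S ∧ l.2 = σ l.1 ∨ Blocked σ F S) := by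
  obtain ⟨V, hV, hF, hS⟩ := exists_of_mem_residualFormula h
  have hS := hS l (Finset.mem_singleton_self l)
  refine ⟨hS, ?_⟩
  by_cases hl : l.2 = σ l.1
  · refine Or.inl ⟨mem_forced.2 ⟨V, hV, ?_⟩, hl⟩
    have hl' : (l.1, σ l.1) = l := Prod.ext rfl hl.symm
    rwa [oneClause, hl', Finset.insert_eq]
  · refine Or.inr ⟨insert l.1 V, ?_, ?_⟩
    · have hl' : (l.1, !σ l.1) = l := by
        refine Prod.ext rfl ?_
        revert hl
        cases l.2 <;> cases σ l.1 <;> simp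
      rwa [zeroClause_insert, hl']
    · refine Finset.card_le_one.2 fun a ha b hb => ?_
      simp only [Finset.mem_sdiff, Finset.mem_insert] at ha hb
      grind

theorem unit_of_mem_forced {z : Fin N} (h : z ∈ forced σ F S) (hz : z ∉ S) :
    {(z, σ z)} ∈ residualFormula F (restrict σ S) := by
  obtain ⟨V, hV, hF⟩ := mem_forced.1 h
  refine mem_residualFormula_of_union hV (by rwa [oneClause, Finset.insert_eq] at hF) ?_
  intro l hl
  rwa [Finset.mem_singleton.1 hl]

theorem empty_or_unit_of_blocked (h : Blocked σ F S) :
    ∅ ∈ residualFormula F (restrict σ S) ∨ ∃ l, {l} ∈ residualFormula F (restrict σ S) := by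
  obtain ⟨V, hF, hV⟩ := h
  rcases (V \ S).eq_empty_or_nonempty with h0 | ⟨x, hxV⟩
  · left
    exact mem_residualFormula_of_union (Finset.sdiff_eq_empty_iff_subset.1 h0) (by simpa using hF)
      (by simp)
  · right
    refine ⟨(x, !σ x), mem_residualFormula_of_union (V := V.erase x) ?_ ?_ ?_⟩
    · intro v hv
      by_contra hvS
      exact Finset.ne_of_mem_erase hv (Finset.card_le_one.1 hV _
        (Finset.mem_sdiff.2 ⟨Finset.mem_of_mem_erase hv, hvS⟩) _ hxV)
    · rwa [← zeroClause_insert, Finset.insert_erase (Finset.mem_sdiff.1 hxV).1]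
    · intro l hl
      rw [Finset.mem_singleton.1 hl]
      exact (Finset.mem_sdiff.1 hxV).2

theorem residualFormula_eq_empty_mono (hS : S ⊆ S')
    (h : residualFormula F (restrict σ S) = ∅) : residualFormula F (restrict σ S') = ∅ := by
  rw [residualFormula_eq_empty] at h ⊢
  intro c hc
  obtain ⟨l, hl, h'⟩ := h c hc
  rw [restrict_eq_some] at h'
  exact ⟨l, hl, restrict_eq_some.2 ⟨hS h'.1, h'.2⟩⟩

end walk

/-! ### Random exploration with a propagation rule -/

section hit

variable {N : ℕ}

/-- The expected sum of `φ` over the closed sets visited by a growing random set: while the set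
`S` is not closed under the propagation rule `p`, it grows by the first forced element, otherwise
by a uniformly random one. -/
noncomputable def hit (p : Finset (Fin N) → Finset (Fin N)) (φ : Finset (Fin N) → ℝ≥0∞)
    (S : Finset (Fin N)) : ℝ≥0∞ :=
  if h : (p S \ S).Nonempty then hit p φ (insert ((p S \ S).min' h) S)
  else φ S + (∑ x : {x // x ∉ S}, hit p φ (insert x.1 S)) / (Sᶜ.card : ℝ≥0∞)
termination_by Sᶜ.card
decreasing_by
  · refine Finset.card_lt_card (Finset.compl_ssubset_compl.2 (Finset.ssubset_insert ?_))
    exact (Finset.mem_sdiff.1 (Finset.min'_mem _ h)).2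
  · exact Finset.card_lt_card (Finset.compl_ssubset_compl.2 (Finset.ssubset_insert x.2))

variable {p : Finset (Fin N) → Finset (Fin N)} {φ : Finset (Fin N) → ℝ≥0∞} {S : Finset (Fin N)}

theorem card_compl_insert_lt {x : Fin N} (hx : x ∉ S) : (insert x S)ᶜ.card < Sᶜ.card :=
  Finset.card_lt_card (Finset.compl_ssubset_compl.2 (Finset.ssubset_insert hx))

theorem hit_of_closed (h : p S ⊆ S) :
    hit p φ S = φ S + (∑ x ∈ Sᶜ, hit p φ (insert x S)) / (Sᶜ.card : ℝ≥0∞) := by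
  rw [hit, dif_neg (by rw [Finset.sdiff_eq_empty_iff_subset.2 h]; simp)]
  rw [Finset.sum_subtype Sᶜ (p := fun x => x ∉ S) (fun x => by simp) (fun x => hit p φ (insert x S))]

theorem exists_hit_eq (h : ¬ p S ⊆ S) : ∃ x ∈ p S, x ∉ S ∧ hit p φ S = hit p φ (insert x S) := by
  have h' : (p S \ S).Nonempty := by
    rwa [Finset.nonempty_iff_ne_empty, Ne, Finset.sdiff_eq_empty_iff_subset]
  refine ⟨(p S \ S).min' h', ?_, ?_, ?_⟩
  · exact (Finset.mem_sdiff.1 (Finset.min'_mem _ h')).1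
  · exact (Finset.mem_sdiff.1 (Finset.min'_mem _ h')).2
  · rw [hit, dif_pos h']

open scoped Classical in
/-- The least superset of `S` that is closed under the propagation rule `p`. -/
noncomputable def propClosure (p : Finset (Fin N) → Finset (Fin N)) (S : Finset (Fin N)) :
    Finset (Fin N) :=
  Finset.univ.filter fun z => ∀ C, S ⊆ C → p C ⊆ C → z ∈ C

theorem mem_propClosure {z : Fin N} :
    z ∈ propClosure p S ↔ ∀ C, S ⊆ C → p C ⊆ C → z ∈ C := by simp [propClosure]

theorem propClosure_eq_self (h : p S ⊆ S) : propClosure p S = S := by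
  ext z
  rw [mem_propClosure]
  exact ⟨fun hz => hz S le_rfl h, fun hz C hC _ => hC hz⟩

theorem propClosure_insert (hp : Monotone p) {z : Fin N} (hz : z ∈ p S) :
    propClosure p (insert z S) = propClosure p S := by
  ext y
  simp only [mem_propClosure]
  refine ⟨fun h C hC hc => h C ?_ hc, fun h C hC hc => h C ((Finset.subset_insert _ _).trans hC) hc⟩
  exact Finset.insert_subset (hc (hp hC hz)) hC

theorem hit_eq_propClosure (hp : Monotone p) (S : Finset (Fin N)) :
    hit p φ S = φ (propClosure p S) + (∑ x ∈ (propClosure p S)ᶜ,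
      hit p φ (insert x (propClosure p S))) / ((propClosure p S)ᶜ.card : ℝ≥0∞) := by
  induction hn : Sᶜ.card using Nat.strong_induction_on generalizing S with
  | _ n ih =>
    by_cases h : p S ⊆ S
    · rw [propClosure_eq_self h, hit_of_closed h]
    · obtain ⟨x, hx, hxS, he⟩ := exists_hit_eq (φ := φ) h
      rw [he, ih _ (hn ▸ card_compl_insert_lt hxS) _ rfl, propClosure_insert hp hx]

/-- The order in which forced elements are added does not matter. -/
theorem hit_insert (hp : Monotone p) {z : Fin N} (hz : z ∈ p S) :
    hit p φ (insert z S) = hit p φ S := by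
  rw [hit_eq_propClosure hp, hit_eq_propClosure hp S, propClosure_insert hp hz]

theorem hit_eq_zero (h : ∀ C, S ⊆ C → φ C = 0) : hit p φ S = 0 := by
  induction hn : Sᶜ.card using Nat.strong_induction_on generalizing S with
  | _ n ih =>
    by_cases hc : p S ⊆ S
    · rw [hit_of_closed hc, h S le_rfl, Finset.sum_eq_zero]
      · simp
      · intro x hx
        exact ih _ (hn ▸ card_compl_insert_lt (Finset.mem_compl.1 hx))
          (fun C hC => h C ((Finset.subset_insert _ _).trans hC)) rfl
    · obtain ⟨x, hx, hxS, he⟩ := exists_hit_eq (φ := φ) hc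
      rw [he]
      exact ih _ (hn ▸ card_compl_insert_lt hxS)
          (fun C hC => h C ((Finset.subset_insert _ _).trans hC)) rfl

theorem sum_hit {ι : Type*} (s : Finset ι) (φ : ι → Finset (Fin N) → ℝ≥0∞)
    (S : Finset (Fin N)) : ∑ i ∈ s, hit p (φ i) S = hit p (fun C => ∑ i ∈ s, φ i C) S := by
  induction hn : Sᶜ.card using Nat.strong_induction_on generalizing S with
  | _ n ih =>
    by_cases hc : p S ⊆ S
    · simp only [hit_of_closed hc, Finset.sum_add_distrib, ENNReal.div_eq_inv_mul,
        ← Finset.mul_sum]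
      rw [Finset.sum_comm]
      congr 2
      refine Finset.sum_congr rfl fun x hx => ?_
      exact ih _ (hn ▸ card_compl_insert_lt (Finset.mem_compl.1 hx)) _ rfl
    · have h' : (p S \ S).Nonempty := by
        rwa [Finset.nonempty_iff_ne_empty, Ne, Finset.sdiff_eq_empty_iff_subset]
      have hx := (Finset.mem_sdiff.1 (Finset.min'_mem _ h')).2
      have : ∀ φ, hit p φ S = hit p φ (insert ((p S \ S).min' h') S) := fun φ => by
        rw [hit, dif_pos h']
      simp only [this]
      exact ih _ (hn ▸ card_compl_insert_lt hx) _ rfl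

theorem avg_le {ι : Type*} (s : Finset ι) (g : ι → ℝ≥0∞) {a : ℝ≥0∞} (h : ∀ i ∈ s, g i ≤ a) :
    (∑ i ∈ s, g i) / (s.card : ℝ≥0∞) ≤ a := by
  refine ENNReal.div_le_of_le_mul ?_
  rw [mul_comm, ← nsmul_eq_mul]
  exact Finset.sum_le_card_nsmul s g a h

theorem le_avg {ι : Type*} (s : Finset ι) (hs : s.Nonempty) (g : ι → ℝ≥0∞) {a : ℝ≥0∞}
    (h : ∀ i ∈ s, a ≤ g i) : a ≤ (∑ i ∈ s, g i) / (s.card : ℝ≥0∞) := by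
  rw [ENNReal.le_div_iff_mul_le (by left; simpa using hs.ne_empty) (by left; simp),
    mul_comm, ← nsmul_eq_mul]
  exact Finset.card_nsmul_le_sum s g a h

/-- The growing set visits at most one set of each size. -/
theorem hit_le_sum {w : ℕ → ℝ≥0∞} (hφ : ∀ C, φ C ≤ w C.card) (S : Finset (Fin N)) :
    hit p φ S ≤ ∑ T ∈ Finset.Icc S.card N, w T := by
  have hstep : ∀ (S : Finset (Fin N)) x, x ∉ S → ∑ T ∈ Finset.Icc S.card N, w T =
      w S.card + ∑ T ∈ Finset.Icc (insert x S).card N, w T := by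
    intro S x hx
    rw [Finset.card_insert_of_notMem hx, ← Finset.add_sum_Ioc_eq_sum_Icc
      (by simpa using Finset.card_le_univ S)]
    congr 2
    ext a
    simp only [Finset.mem_Ioc, Finset.mem_Icc]
    omega
  induction hn : Sᶜ.card using Nat.strong_induction_on generalizing S with
  | _ n ih =>
    have ih' : ∀ x, x ∉ S → hit p φ (insert x S) ≤ ∑ T ∈ Finset.Icc (insert x S).card N, w T := by
      intro x hx
      exact ih _ (hn ▸ card_compl_insert_lt hx) _ rfl
    by_cases hc : p S ⊆ S
    · rw [hit_of_closed hc]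
      by_cases hS : Sᶜ.Nonempty
      · obtain ⟨x, hx⟩ := hS
        rw [hstep S x (Finset.mem_compl.1 hx)]
        refine add_le_add (hφ S) (avg_le _ _ fun y hy => ?_)
        rw [Finset.card_insert_of_notMem (Finset.mem_compl.1 hx),
          ← Finset.card_insert_of_notMem (Finset.mem_compl.1 hy)]
        exact ih' y (Finset.mem_compl.1 hy)
      · rw [Finset.not_nonempty_iff_eq_empty.1 hS]
        have : S.card = N := by
          rw [Finset.not_nonempty_iff_eq_empty, Finset.compl_eq_empty_iff] at hS
          simp [hS]
        simpa [this] using this ▸ hφ S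
    · obtain ⟨x, hx, hxS, he⟩ := exists_hit_eq (φ := φ) hc
      rw [he]
      refine (ih' x hxS).trans ?_
      rw [hstep S x hxS]
      exact le_add_self

end hit

/-! ### Following full assignments down the search tree -/

/-- The full assignments that agree with `σ₀` on `S`. -/
def agreeing {N : ℕ} (σ₀ : Fin N → Bool) (S : Finset (Fin N)) : Finset (Fin N → Bool) :=
  Finset.univ.filter fun σ => ∀ v ∈ S, σ v = σ₀ v

section follow

variable {N : ℕ} {rule : UnitRule N} {f : SearchTree N → ℕ} {F : Formula N}

theorem mem_agreeing {σ σ₀ : Fin N → Bool} {S : Finset (Fin N)} :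
    σ ∈ agreeing σ₀ S ↔ ∀ v ∈ S, σ v = σ₀ v := by simp [agreeing]

theorem mem_agreeing_update {σ σ₀ : Fin N → Bool} {S : Finset (Fin N)} {x : Fin N} {b : Bool}
    (hx : x ∉ S) :
    σ ∈ agreeing (Function.update σ₀ x b) (insert x S) ↔ σ ∈ agreeing σ₀ S ∧ σ x = b := by
  simp only [mem_agreeing, Finset.forall_mem_insert, Function.update_self]
  rw [and_comm]
  refine and_congr_left fun _ => forall₂_congr fun v hv => ?_
  rw [Function.update_of_ne (ne_of_mem_of_not_mem hv hx)]

theorem sum_agreeing {M : Type*} [AddCommMonoid M] (σ₀ : Fin N → Bool) {S : Finset (Fin N)}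
    {x : Fin N} (hx : x ∉ S) (b : Bool) (h : (Fin N → Bool) → M) :
    ∑ σ ∈ agreeing σ₀ S, h σ =
      ∑ σ ∈ agreeing (Function.update σ₀ x b) (insert x S), h σ +
        ∑ σ ∈ agreeing (Function.update σ₀ x !b) (insert x S), h σ := by
  rw [← Finset.sum_filter_add_sum_filter_not _ (fun σ => σ x = b)]
  congr 2
  · ext σ
    rw [mem_agreeing_update hx, Finset.mem_filter]
  · ext σ
    rw [mem_agreeing_update hx, Finset.mem_filter]
    cases σ x <;> cases b <;> simp

theorem agreeing_univ (σ₀ : Fin N → Bool) : agreeing σ₀ Finset.univ = {σ₀} := by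
  ext σ
  simp [mem_agreeing, funext_iff]

theorem agreeing_empty (σ₀ : Fin N → Bool) : agreeing σ₀ ∅ = Finset.univ := by
  ext σ
  simp [mem_agreeing]

theorem card_agreeing (σ₀ : Fin N → Bool) (S : Finset (Fin N)) :
    (agreeing σ₀ S).card = 2 ^ Sᶜ.card := by
  induction hn : Sᶜ.card generalizing S σ₀ with
  | zero =>
    rw [Finset.card_eq_zero, Finset.compl_eq_empty_iff] at hn
    simp [hn, agreeing_univ]
  | succ n ih =>
    obtain ⟨x, hx⟩ : Sᶜ.Nonempty := Finset.card_pos.1 (by omega)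
    have hx' := Finset.mem_compl.1 hx
    have hc : (insert x S)ᶜ.card = n := by
      rw [Finset.compl_insert, Finset.card_erase_of_mem hx, hn]
      rfl
    have := sum_agreeing σ₀ hx' true fun _ => 1
    simp only [Finset.sum_const, smul_eq_mul, mul_one] at this
    rw [this, ih _ _ hc, ih _ _ hc]
    ring

theorem restrict_of_mem_agreeing {σ σ₀ : Fin N → Bool} {S : Finset (Fin N)}
    (h : σ ∈ agreeing σ₀ S) : restrict σ₀ S = restrict σ S :=
  (restrict_congr (mem_agreeing.1 h)).symm

theorem forced_subset_of_no_unit {σ : Fin N → Bool} {S : Finset (Fin N)}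
    (h : ¬ ∃ l, {l} ∈ residualFormula F (restrict σ S)) : forced σ F S ⊆ S := by
  intro z hz
  by_contra hzS
  exact h ⟨_, unit_of_mem_forced hz hzS⟩

theorem value_restrict_of_split (hf : IsLeafCount f) {σ : Fin N → Bool} {S : Finset (Fin N)}
    (h₁ : residualFormula F (restrict σ S) ≠ ∅) (h₂ : ∅ ∉ residualFormula F (restrict σ S))
    (h₃ : ¬ ∃ l, {l} ∈ residualFormula F (restrict σ S)) :
    value rule f F (restrict σ S) =
      (∑ x ∈ Sᶜ,
        (value rule f F (restrict (Function.update σ x true) (insert x S)) +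
          value rule f F (restrict (Function.update σ x false) (insert x S)))) /
          (Sᶜ.card : ℝ≥0∞) := by
  rw [value_of_split hf h₁ h₂ h₃, numUnset_restrict]
  congr 1
  have : Finset.univ.filter (fun x => restrict σ S x = none) = Sᶜ := by
    ext x
    simp [restrict_eq_none]
  rw [this]
  refine Finset.sum_congr rfl fun x hx => ?_
  rw [restrict_add (Finset.mem_compl.1 hx), restrict_add (Finset.mem_compl.1 hx)]

/-- The statement behind all lower bounds. Let `φ σ` be supported on sets `C` of size `T` such that
the walk along `σ` passes through a split after having assigned the variables in `C`, if it ever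
gets there. If `φ` minorizes the expected statistic below such splits, then the expected total of
`φ` over the walks minorizes the expected statistic. -/
theorem sum_hit_le_value (hf : IsLeafCount f) {T : ℕ}
    {φ : (Fin N → Bool) → Finset (Fin N) → ℝ≥0∞}
    (hφ : ∀ σ C, φ σ C ≠ 0 →
      C.card = T ∧ ¬ Blocked σ F C ∧ residualFormula F (restrict σ C) ≠ ∅)
    (hv : ∀ σ₀ S, S.card = T → residualFormula F (restrict σ₀ S) ≠ ∅ →
      ∅ ∉ residualFormula F (restrict σ₀ S) → (¬ ∃ l, {l} ∈ residualFormula F (restrict σ₀ S)) →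
      ∑ σ ∈ agreeing σ₀ S, φ σ S ≤ value rule f F (restrict σ₀ S))
    (σ₀ : Fin N → Bool) (S : Finset (Fin N)) :
    ∑ σ ∈ agreeing σ₀ S, hit (forced σ F) (φ σ) S ≤ value rule f F (restrict σ₀ S) := by
  have hblocked : ∀ σ S, Blocked σ F S → hit (forced σ F) (φ σ) S = 0 := by
    intro σ S hB
    refine hit_eq_zero fun C hC => ?_
    by_contra hne
    exact (hφ σ C hne).2.1 (hB.mono hC)
  induction hn : Sᶜ.card using Nat.strong_induction_on generalizing S σ₀ with
  | _ n ih =>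
    by_cases h₁ : residualFormula F (restrict σ₀ S) = ∅
    · rw [Finset.sum_eq_zero]
      · exact zero_le
      · intro σ hσ
        refine hit_eq_zero fun C hC => ?_
        by_contra hne
        rw [restrict_of_mem_agreeing hσ] at h₁
        exact (hφ σ C hne).2.2 (residualFormula_eq_empty_mono hC h₁)
    by_cases h₂ : ∅ ∈ residualFormula F (restrict σ₀ S)
    · rw [Finset.sum_eq_zero]
      · exact zero_le
      · intro σ hσ
        rw [restrict_of_mem_agreeing hσ] at h₂
        exact hblocked σ S (blocked_of_empty_mem h₂)
    by_cases h₃ : ∃ l, {l} ∈ residualFormula F (restrict σ₀ S)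
    · refine le_value_of_unit hf h₂ h₃ fun l hl => ?_
      have hlS := (forced_or_blocked_of_unit hl).1
      rw [show l = (l.1, l.2) from rfl, restrict_add hlS]
      refine le_trans ?_ (ih _ (hn ▸ card_compl_insert_lt hlS) _ _ rfl)
      rw [sum_agreeing σ₀ hlS l.2]
      rw [Finset.sum_eq_zero (s := agreeing (Function.update σ₀ l.1 !l.2) _), add_zero]
      · refine Finset.sum_le_sum fun σ hσ => ?_
        rw [mem_agreeing_update hlS] at hσ
        rw [restrict_of_mem_agreeing hσ.1] at hl
        rcases (forced_or_blocked_of_unit hl).2 with h | h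
        · exact (hit_insert forced_mono h.1).ge
        · rw [hblocked σ S h]
          exact zero_le
      · intro σ hσ
        rw [mem_agreeing_update hlS] at hσ
        rw [restrict_of_mem_agreeing hσ.1] at hl
        rcases (forced_or_blocked_of_unit hl).2 with h | h
        · rw [hσ.2] at h
          simp at h
        · exact hblocked σ S h
    · have hclosed : ∀ σ ∈ agreeing σ₀ S, forced σ F S ⊆ S := by
        intro σ hσ
        rw [restrict_of_mem_agreeing hσ] at h₃
        exact forced_subset_of_no_unit h₃
      rw [Finset.sum_congr rfl fun σ hσ => hit_of_closed (hclosed σ hσ), Finset.sum_add_distrib]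
      by_cases hT : S.card = T
      · rw [Finset.sum_eq_zero (f := fun σ => _ / _), add_zero]
        · exact hv σ₀ S hT h₁ h₂ h₃
        · intro σ _
          rw [Finset.sum_eq_zero, ENNReal.zero_div]
          intro x hx
          refine hit_eq_zero fun C hC => ?_
          by_contra hne
          have h1 := Finset.card_le_card hC
          rw [(hφ σ C hne).1, Finset.card_insert_of_notMem (Finset.mem_compl.1 hx)] at h1
          omega
      · rw [Finset.sum_eq_zero (f := fun σ => φ σ S), zero_add]
        · rw [value_restrict_of_split hf h₁ h₂ h₃]
          simp only [ENNReal.div_eq_inv_mul]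
          rw [← Finset.mul_sum, Finset.sum_comm]
          gcongr with x hx
          have hx' := Finset.mem_compl.1 hx
          rw [sum_agreeing σ₀ hx' true]
          exact add_le_add (ih _ (hn ▸ card_compl_insert_lt hx') _ _ rfl)
            (ih _ (hn ▸ card_compl_insert_lt hx') _ _ rfl)
        · intro σ _
          by_contra hne
          exact hT (hφ σ S hne).1

open scoped Classical in
/-- The number of leaves is one plus the number of splits, and a split with `u` unset variables is
shared by the walks along `2 ^ u` full assignments. -/
theorem value_leaves_le_sum_hit (σ₀ : Fin N → Bool) (S : Finset (Fin N)) :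
    value rule SearchTree.leaves F (restrict σ₀ S) ≤ 1 + ∑ σ ∈ agreeing σ₀ S,
      hit (forced σ F) (fun C => if Blocked σ F C then 0 else (2 : ℝ≥0∞)⁻¹ ^ Cᶜ.card) S := by
  set φ : (Fin N → Bool) → Finset (Fin N) → ℝ≥0∞ :=
    fun σ C => if Blocked σ F C then 0 else (2 : ℝ≥0∞)⁻¹ ^ Cᶜ.card with hφ
  have hblocked : ∀ σ S, Blocked σ F S → hit (forced σ F) (φ σ) S = 0 := by
    intro σ S hB
    exact hit_eq_zero fun C hC => if_pos (hB.mono hC)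
  induction hn : Sᶜ.card using Nat.strong_induction_on generalizing S σ₀ with
  | _ n ih =>
    by_cases h₁ : residualFormula F (restrict σ₀ S) = ∅
    · rw [value_of_solution h₁]
      simp [SearchTree.leaves, SearchTree.solutionLeaves, SearchTree.contradictionLeaves]
    by_cases h₂ : ∅ ∈ residualFormula F (restrict σ₀ S)
    · rw [value_of_contradiction h₂]
      simp [SearchTree.leaves, SearchTree.solutionLeaves, SearchTree.contradictionLeaves]
    by_cases h₃ : ∃ l, {l} ∈ residualFormula F (restrict σ₀ S)
    · refine value_le_of_unit isLeafCount_leaves h₂ h₃ fun l hl => ?_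
      have hlS := (forced_or_blocked_of_unit hl).1
      rw [show l = (l.1, l.2) from rfl, restrict_add hlS]
      refine (ih _ (hn ▸ card_compl_insert_lt hlS) _ _ rfl).trans ?_
      rw [sum_agreeing σ₀ hlS l.2]
      gcongr
      refine le_add_right (Finset.sum_le_sum fun σ hσ => ?_)
      rw [mem_agreeing_update hlS] at hσ
      rw [restrict_of_mem_agreeing hσ.1] at hl
      rcases (forced_or_blocked_of_unit hl).2 with h | h
      · exact (hit_insert forced_mono h.1).le
      · rw [hblocked σ _ (h.mono (Finset.subset_insert _ _))]
        exact zero_le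
    · have hclosed : ∀ σ ∈ agreeing σ₀ S, forced σ F S ⊆ S := by
        intro σ hσ
        rw [restrict_of_mem_agreeing hσ] at h₃
        exact forced_subset_of_no_unit h₃
      have hφS : ∑ σ ∈ agreeing σ₀ S, φ σ S = 1 := by
        rw [Finset.sum_congr rfl (g := fun _ => (2 : ℝ≥0∞)⁻¹ ^ Sᶜ.card), Finset.sum_const,
          card_agreeing, nsmul_eq_mul]
        · push_cast
          rw [← mul_pow, ENNReal.mul_inv_cancel (by simp) (by simp), one_pow]
        · intro σ hσ
          rw [restrict_of_mem_agreeing hσ] at h₂ h₃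
          exact if_neg fun hB => (empty_or_unit_of_blocked hB).elim h₂ h₃
      have hne : Sᶜ.Nonempty := by
        rw [Finset.nonempty_iff_ne_empty, Ne, Finset.compl_eq_empty_iff]
        rintro rfl
        obtain ⟨c, hc⟩ := Finset.nonempty_iff_ne_empty.2 h₁
        have : c = ∅ := by
          refine Finset.eq_empty_of_forall_notMem fun l hl => ?_
          exact restrict_eq_none.1 (unset_of_mem_residualFormula hc hl) (Finset.mem_univ _)
        exact h₂ (this ▸ hc)
      rw [Finset.sum_congr rfl fun σ hσ => hit_of_closed (hclosed σ hσ), Finset.sum_add_distrib,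
        hφS, value_restrict_of_split isLeafCount_leaves h₁ h₂ h₃]
      have hone : (1 : ℝ≥0∞) + 1 = (∑ x ∈ Sᶜ, (1 + 1)) / (Sᶜ.card : ℝ≥0∞) := by
        rw [Finset.sum_const, nsmul_eq_mul, ENNReal.mul_div_right_comm, ENNReal.div_self, one_mul]
        · simpa using hne.ne_empty
        · simp
      rw [← add_assoc, hone]
      simp only [ENNReal.div_eq_inv_mul]
      rw [← Finset.mul_sum, ← mul_add, Finset.sum_comm (s := agreeing σ₀ S),
        ← Finset.sum_add_distrib]
      refine mul_le_mul' le_rfl (Finset.sum_le_sum fun x hx => ?_)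
      have hx' := Finset.mem_compl.1 hx
      rw [sum_agreeing σ₀ hx' true, add_add_add_comm]
      exact add_le_add (ih _ (hn ▸ card_compl_insert_lt hx') _ _ rfl)
        (ih _ (hn ▸ card_compl_insert_lt hx') _ _ rfl)

/-- Every solution leaf accounts for at least one solution. -/
theorem value_solutionLeaves_le (σ₀ : Fin N → Bool) (S : Finset (Fin N)) :
    value rule SearchTree.solutionLeaves F (restrict σ₀ S) ≤
      ((agreeing σ₀ S).filter fun σ => ∀ V, zeroClause σ V ∉ F).card := by
  induction hn : Sᶜ.card using Nat.strong_induction_on generalizing S σ₀ with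
  | _ n ih =>
    have hadd : ∀ x ∉ S, ∀ b,
        ((agreeing σ₀ S).filter fun σ => ∀ V, zeroClause σ V ∉ F).card =
        ((agreeing (Function.update σ₀ x b) (insert x S)).filter
          fun σ => ∀ V, zeroClause σ V ∉ F).card +
        ((agreeing (Function.update σ₀ x !b) (insert x S)).filter
          fun σ => ∀ V, zeroClause σ V ∉ F).card := by
      intro x hx b
      simp only [Finset.card_filter]
      exact sum_agreeing σ₀ hx b _
    by_cases h₁ : residualFormula F (restrict σ₀ S) = ∅
    · rw [value_of_solution h₁]
      rw [residualFormula_eq_empty] at h₁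
      have : σ₀ ∈ (agreeing σ₀ S).filter fun σ => ∀ V, zeroClause σ V ∉ F := by
        refine Finset.mem_filter.2 ⟨mem_agreeing.2 fun _ _ => rfl, fun V hV => ?_⟩
        obtain ⟨l, hl, h⟩ := h₁ _ hV
        rw [restrict_eq_some, (mem_zeroClause.1 hl).2] at h
        simp at h
      exact_mod_cast Finset.card_pos.2 ⟨_, this⟩
    by_cases h₂ : ∅ ∈ residualFormula F (restrict σ₀ S)
    · rw [value_of_contradiction h₂]
      simp [SearchTree.solutionLeaves]
    by_cases h₃ : ∃ l, {l} ∈ residualFormula F (restrict σ₀ S)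
    · refine value_le_of_unit isLeafCount_solutionLeaves h₂ h₃ fun l hl => ?_
      have hlS := (forced_or_blocked_of_unit hl).1
      rw [show l = (l.1, l.2) from rfl, restrict_add hlS]
      refine (ih _ (hn ▸ card_compl_insert_lt hlS) _ _ rfl).trans ?_
      rw [hadd l.1 hlS l.2]
      exact_mod_cast Nat.le_add_right _ _
    · rw [value_restrict_of_split isLeafCount_solutionLeaves h₁ h₂ h₃]
      refine avg_le _ _ fun x hx => ?_
      have hx' := Finset.mem_compl.1 hx
      rw [hadd x hx' true]
      push_cast
      exact add_le_add (ih _ (hn ▸ card_compl_insert_lt hx') _ _ rfl)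
        (ih _ (hn ▸ card_compl_insert_lt hx') _ _ rfl)

/-- Below a node that some solution extends, there is a solution leaf. -/
theorem one_le_value_solutionLeaves {σ : Fin N → Bool} (hσ : ∀ V, zeroClause σ V ∉ F)
    (S : Finset (Fin N)) : 1 ≤ value rule SearchTree.solutionLeaves F (restrict σ S) := by
  have hnb : ∀ S, ¬ Blocked σ F S := fun S ⟨V, hV, _⟩ => hσ V hV
  induction hn : Sᶜ.card using Nat.strong_induction_on generalizing S with
  | _ n ih =>
    by_cases h₁ : residualFormula F (restrict σ S) = ∅
    · rw [value_of_solution h₁]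
      simp [SearchTree.solutionLeaves]
    by_cases h₂ : ∅ ∈ residualFormula F (restrict σ S)
    · exact absurd (blocked_of_empty_mem h₂) (hnb S)
    have hadd : ∀ x ∉ S, ∀ b, b = σ x →
        1 ≤ value rule SearchTree.solutionLeaves F
          (restrict (Function.update σ x b) (insert x S)) := by
      rintro x hx b rfl
      rw [Function.update_eq_self]
      exact ih _ (hn ▸ card_compl_insert_lt hx) _ rfl
    by_cases h₃ : ∃ l, {l} ∈ residualFormula F (restrict σ S)
    · refine le_value_of_unit isLeafCount_solutionLeaves h₂ h₃ fun l hl => ?_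
      have h := forced_or_blocked_of_unit hl
      rw [show l = (l.1, l.2) from rfl, restrict_add h.1]
      exact hadd _ h.1 _ ((h.2.resolve_right (hnb S)).2)
    · rw [value_restrict_of_split isLeafCount_solutionLeaves h₁ h₂ h₃]
      have hne : Sᶜ.Nonempty := by
        rw [Finset.nonempty_iff_ne_empty, Ne, Finset.compl_eq_empty_iff]
        rintro rfl
        obtain ⟨c, hc⟩ := Finset.nonempty_iff_ne_empty.2 h₁
        have : c = ∅ := by
          refine Finset.eq_empty_of_forall_notMem fun l hl => ?_
          exact restrict_eq_none.1 (unset_of_mem_residualFormula hc hl) (Finset.mem_univ _)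
        exact h₂ (this ▸ hc)
      refine le_avg _ hne _ fun x hx => ?_
      have hx' := Finset.mem_compl.1 hx
      cases hb : σ x
      · exact le_add_left (hadd x hx' _ hb.symm)
      · exact le_add_right (hadd x hx' _ hb.symm)

/-- Two complementary unit clauses lead to a contradiction leaf, whatever the propagation rule
does in between. -/
theorem one_le_value_contradictionLeaves {A : Assignment N} {y : Fin N}
    (hy : ∀ b, {(y, b)} ∈ residualFormula F A) :
    1 ≤ value rule SearchTree.contradictionLeaves F A := by
  induction hn : A.numUnset using Nat.strong_induction_on generalizing A with
  | _ n ih =>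
    by_cases h₂ : ∅ ∈ residualFormula F A
    · rw [value_of_contradiction h₂]
      simp [SearchTree.contradictionLeaves]
    refine le_value_of_unit isLeafCount_contradictionLeaves h₂ ⟨_, hy true⟩ fun l hl => ?_
    have hlA := unset_of_unit hl
    have hclause : ∀ b, (y, b) ≠ l → ∃ c ∈ F, (∀ l' ∈ c, A.add l l'.1 ≠ some l'.2) ∧
        c.filter (fun l' => A.add l l'.1 = none) = if l.1 = y then ∅ else {(y, b)} := by
      intro b hb
      obtain ⟨c, hc, h, he⟩ := mem_residualFormula.1 (hy b)
      have hmem : ∀ l' ∈ c, A l'.1 = none → l' = (y, b) := fun l' hl' hA =>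
        Finset.mem_singleton.1 (he ▸ Finset.mem_filter.2 ⟨hl', hA⟩)
      have hyc : (y, b) ∈ c ∧ A y = none := Finset.mem_filter.1
        (he.symm ▸ Finset.mem_singleton_self (y, b) : (y, b) ∈ c.filter fun l => A l.1 = none)
      refine ⟨c, hc, ?_, ?_⟩
      · intro l' hl' h'
        by_cases hll : l'.1 = l.1
        · have := hmem l' hl' (hll ▸ hlA)
          subst this
          rw [Assignment.add, hll, Function.update_self, Option.some.injEq] at h'
          exact hb (Prod.ext hll h'.symm)
        · rw [Assignment.add, Function.update_of_ne hll] at h'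
          exact h l' hl' h'
      · ext l'
        rw [Finset.mem_filter]
        split_ifs with hly
        · simp only [Finset.notMem_empty, iff_false, not_and]
          intro hl' h'
          by_cases hll : l'.1 = l.1
          · simp [Assignment.add, hll] at h'
          · rw [Assignment.add, Function.update_of_ne hll] at h'
            rw [hmem l' hl' h'] at hll
            exact hll hly.symm
        · rw [Finset.mem_singleton]
          constructor
          · rintro ⟨hl', h'⟩
            by_cases hll : l'.1 = l.1
            · simp [Assignment.add, hll] at h'
            · rw [Assignment.add, Function.update_of_ne hll] at h'
              exact hmem l' hl' h'
          · rintro rfl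
            refine ⟨hyc.1, ?_⟩
            rw [Assignment.add, Function.update_of_ne (fun h => hly h.symm)]
            exact hyc.2
    by_cases hly : l.1 = y
    · obtain ⟨b, hb⟩ : ∃ b, (y, b) ≠ l := ⟨!l.2, fun h => by
        have := congrArg Prod.snd h
        simp at this⟩
      have := hclause b hb
      rw [if_pos hly, ← mem_residualFormula] at this
      rw [value_of_contradiction this]
      simp [SearchTree.contradictionLeaves]
    · refine ih _ (hn ▸ A.numUnset_add_lt l hlA) (fun b => ?_) rfl
      have := hclause b (fun h => hly (congrArg Prod.fst h).symm)
      rwa [if_neg hly, ← mem_residualFormula] at this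

end follow

/-! ### Counting clauses and formulas -/

section count

variable {N k : ℕ} {σ : Fin N → Bool}

/-- The number of `M`-element subsets of `X` whose trace on `R` is `G`, which contain `E` and avoid
`B`. All probabilities over the random instance are computed from it. -/
theorem card_filter_powersetCard {α : Type*} [DecidableEq α] {X R G E B : Finset α} {M : ℕ}
    (hG : G ⊆ R) (hR : R ⊆ X) (hE : E ⊆ X) (hB : B ⊆ X) (hRE : Disjoint R E)
    (hRB : Disjoint R B) (hEB : Disjoint E B) (hM : G.card + E.card ≤ M) :
    ((X.powersetCard M).filter fun F => F ∩ R = G ∧ E ⊆ F ∧ Disjoint F B).card =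
      (X.card - R.card - E.card - B.card).choose (M - (G.card + E.card)) := by
  have hGE : Disjoint G E := Finset.disjoint_of_subset_left hG hRE
  have hX : (X \ (R ∪ E ∪ B)).card = X.card - R.card - E.card - B.card := by
    rw [Finset.card_sdiff_of_subset (by grind), Finset.card_union_of_disjoint (by
      rw [Finset.disjoint_union_left]; exact ⟨hRB, hEB⟩), Finset.card_union_of_disjoint hRE]
    omega
  rw [← hX, ← Finset.card_powersetCard]
  refine Finset.card_nbij' (fun F => F \ (G ∪ E)) (fun H => H ∪ (G ∪ E)) ?_ ?_ ?_ ?_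
  · intro F hF
    rw [Finset.mem_coe, Finset.mem_filter, Finset.mem_powersetCard] at hF
    obtain ⟨⟨hFX, hFM⟩, hFR, hEF, hFB⟩ := hF
    have hsub : G ∪ E ⊆ F := Finset.union_subset (hFR ▸ Finset.inter_subset_left) hEF
    rw [Finset.mem_coe, Finset.mem_powersetCard]
    refine ⟨?_, ?_⟩
    · intro c hc
      rw [Finset.mem_sdiff, Finset.mem_union, not_or] at hc
      rw [Finset.mem_sdiff, Finset.mem_union, Finset.mem_union]
      refine ⟨hFX hc.1, ?_⟩
      rintro ((h | h) | h)
      · exact hc.2.1 (hFR ▸ Finset.mem_inter.2 ⟨hc.1, h⟩)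
      · exact hc.2.2 h
      · exact Finset.disjoint_left.1 hFB hc.1 h
    · rw [Finset.card_sdiff_of_subset hsub, hFM, Finset.card_union_of_disjoint hGE]
  · intro H hH
    rw [Finset.mem_coe, Finset.mem_powersetCard] at hH
    obtain ⟨hHX, hHM⟩ := hH
    have hd : Disjoint H (G ∪ E) := by
      rw [Finset.disjoint_left]
      intro c hc hc'
      have := (Finset.mem_sdiff.1 (hHX hc)).2
      rw [Finset.mem_union, Finset.mem_union, not_or, not_or] at this
      rcases Finset.mem_union.1 hc' with h | h
      · exact this.1.1 (hG h)
      · exact this.1.2 h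
    rw [Finset.mem_coe, Finset.mem_filter, Finset.mem_powersetCard]
    refine ⟨⟨?_, ?_⟩, ?_, ?_, ?_⟩
    · exact Finset.union_subset (hHX.trans Finset.sdiff_subset)
        (Finset.union_subset (hG.trans hR) hE)
    · rw [Finset.card_union_of_disjoint hd, hHM, Finset.card_union_of_disjoint hGE]
      omega
    · ext c
      have h1 : c ∈ H → c ∉ R := fun h => by
        have := (Finset.mem_sdiff.1 (hHX h)).2
        grind
      have h2 : c ∈ E → c ∉ R := fun h h' => Finset.disjoint_left.1 hRE h' h
      have h3 : c ∈ G → c ∈ R := fun h => hG h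
      grind
    · grind
    · rw [Finset.disjoint_left]
      intro c hc hcB
      have h1 : c ∈ H → c ∉ B := fun h => by
        have := (Finset.mem_sdiff.1 (hHX h)).2
        grind
      have h2 : c ∈ E → c ∉ B := fun h h' => Finset.disjoint_left.1 hEB h h'
      have h3 : c ∈ G → c ∉ B := fun h h' => Finset.disjoint_left.1 hRB (hG h) h'
      grind
  · intro F hF
    rw [Finset.mem_coe, Finset.mem_filter, Finset.mem_powersetCard] at hF
    obtain ⟨⟨hFX, hFM⟩, hFR, hEF, hFB⟩ := hF
    exact Finset.sdiff_union_of_subset (Finset.union_subset (hFR ▸ Finset.inter_subset_left) hEF)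
  · intro H hH
    rw [Finset.mem_coe, Finset.mem_powersetCard] at hH
    refine Finset.union_sdiff_cancel_right ?_
    rw [Finset.disjoint_left]
    intro c hc hc'
    have := (Finset.mem_sdiff.1 (hH.1 hc)).2
    rw [Finset.mem_union, Finset.mem_union, not_or, not_or] at this
    rcases Finset.mem_union.1 hc' with h | h
    · exact this.1.1 (hG h)
    · exact this.1.2 h

/-- A clause is given by its `k` variables and by those of them that occur positively. -/
theorem card_kClauses : (kClauses k N).card = N.choose k * 2 ^ k := by
  have h : (((Finset.univ : Finset (Fin N)).powersetCard k).sigma fun V => V.powerset).card =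
      N.choose k * 2 ^ k := by
    rw [Finset.card_sigma, Finset.sum_congr rfl (g := fun _ => 2 ^ k)]
    · simp
    · intro V hV
      rw [Finset.card_powerset, (Finset.mem_powersetCard.1 hV).2]
  rw [← h]
  symm
  refine Finset.card_bij (fun p _ => p.1.image fun v => (v, decide (v ∈ p.2))) ?_ ?_ ?_
  · rintro ⟨V, P⟩ hp
    simp only [Finset.mem_sigma, Finset.mem_powersetCard, Finset.mem_powerset] at hp
    simp only [kClauses, Finset.mem_filter, Finset.mem_univ, true_and]
    refine ⟨?_, ?_⟩
    · rw [Finset.card_image_of_injective _ fun a b h => congrArg Prod.fst h]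
      exact hp.1.2
    · intro l hl hn
      obtain ⟨v, hv, rfl⟩ := Finset.mem_image.1 hl
      obtain ⟨w, hw, h⟩ := Finset.mem_image.1 hn
      have h1 : w = v := congrArg Prod.fst h
      subst h1
      have h2 := congrArg Prod.snd h
      simp [Literal.neg] at h2
  · rintro ⟨V, P⟩ hp ⟨V', P'⟩ hp' he
    simp only [Finset.mem_sigma, Finset.mem_powersetCard, Finset.mem_powerset] at hp hp'
    have hmem : ∀ v b, (v ∈ V ∧ decide (v ∈ P) = b) ↔ (v ∈ V' ∧ decide (v ∈ P') = b) := by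
      intro v b
      have := Finset.ext_iff.1 he (v, b)
      simpa using this
    have hV : V = V' := by
      ext v
      have h1 := hmem v (decide (v ∈ P))
      have h2 := hmem v (decide (v ∈ P'))
      constructor
      · exact fun h => (h1.1 ⟨h, rfl⟩).1
      · exact fun h => (h2.2 ⟨h, rfl⟩).1
    subst hV
    have hP : P = P' := by
      ext v
      have h1 := hmem v true
      simp only [decide_eq_true_eq] at h1
      constructor
      · exact fun h => (h1.1 ⟨hp.2 h, h⟩).2
      · exact fun h => (h1.2 ⟨hp'.2 h, h⟩).2
    rw [hP]
  · intro c hc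
    simp only [kClauses, Finset.mem_filter, Finset.mem_univ, true_and] at hc
    have hinj : Set.InjOn Prod.fst (c : Set (Literal N)) := by
      intro l hl l' hl' h
      by_contra hne
      have : Literal.neg l = l' := by
        refine Prod.ext h ?_
        have : l.2 ≠ l'.2 := fun h' => hne (Prod.ext h h')
        revert this
        simp only [Literal.neg]
        cases l.2 <;> cases l'.2 <;> simp
      exact hc.2 l hl (this ▸ hl')
    refine ⟨⟨c.image Prod.fst, (c.filter fun l => l.2 = true).image Prod.fst⟩, ?_, ?_⟩
    · simp only [Finset.mem_sigma, Finset.mem_powersetCard, Finset.mem_powerset]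
      exact ⟨⟨Finset.subset_univ _, by rw [Finset.card_image_of_injOn hinj, hc.1]⟩,
        Finset.image_subset_image (Finset.filter_subset _ _)⟩
    · have hdec : ∀ l ∈ c, decide (l.1 ∈ (c.filter fun l => l.2 = true).image Prod.fst) = l.2 := by
        intro l hl
        rw [Bool.eq_iff_iff, decide_eq_true_eq, Finset.mem_image]
        constructor
        · rintro ⟨l', hl', h⟩
          rw [Finset.mem_filter] at hl'
          rw [← hinj hl'.1 hl h]
          exact hl'.2
        · exact fun h => ⟨l, Finset.mem_filter.2 ⟨hl, h⟩, rfl⟩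
      ext l
      simp only [Finset.mem_image (s := c.image Prod.fst)]
      constructor
      · rintro ⟨v, hv, rfl⟩
        obtain ⟨l, hl, rfl⟩ := Finset.mem_image.1 hv
        rw [hdec l hl]
        exact hl
      · intro hl
        exact ⟨l.1, Finset.mem_image_of_mem _ hl, Prod.ext rfl (hdec l hl)⟩

theorem card_instances (M : ℕ) : (instances k N M).card = (N.choose k * 2 ^ k).choose M := by
  rw [instances, Finset.card_powersetCard, card_kClauses]

theorem image_fst_zeroClause (V : Finset (Fin N)) : (zeroClause σ V).image Prod.fst = V := by
  ext v; simp [zeroClause]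

theorem zeroClause_injective : Function.Injective (zeroClause σ) := fun V W h => by
  rw [← image_fst_zeroClause (σ := σ) V, h, image_fst_zeroClause]

theorem card_zeroClause (V : Finset (Fin N)) : (zeroClause σ V).card = V.card :=
  Finset.card_image_of_injective _ fun _ _ h => congrArg Prod.fst h

theorem zeroClause_mem_kClauses {V : Finset (Fin N)} :
    zeroClause σ V ∈ kClauses k N ↔ V.card = k := by
  simp only [kClauses, Finset.mem_filter, Finset.mem_univ, true_and, card_zeroClause]
  refine and_iff_left fun l hl hn => ?_
  have h1 := (mem_zeroClause.1 hl).2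
  have h2 := (mem_zeroClause.1 hn).2
  simp [Literal.neg, h1] at h2

theorem oneClause_mem_kClauses {z : Fin N} {V : Finset (Fin N)} (hz : z ∉ V) :
    oneClause σ z V ∈ kClauses k N ↔ V.card + 1 = k := by
  have hnot : (z, σ z) ∉ zeroClause σ V := fun h => hz (mem_zeroClause.1 h).1
  simp only [kClauses, Finset.mem_filter, Finset.mem_univ, true_and, oneClause,
    Finset.card_insert_of_notMem hnot, card_zeroClause]
  refine and_iff_left fun l hl hn => ?_
  rw [Finset.mem_insert, mem_zeroClause] at hl hn
  rcases hl with rfl | h1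
  · rcases hn with h2 | h2
    · have := congrArg Prod.snd h2
      simp [Literal.neg] at this
    · exact hz h2.1
  · rcases hn with h2 | h2
    · have := congrArg Prod.fst h2
      simp only [Literal.neg] at this
      exact hz (this ▸ h1.1)
    · have := h2.2
      simp [Literal.neg, h1.2] at this

theorem oneClause_ne_zeroClause (z : Fin N) (V W : Finset (Fin N)) :
    oneClause σ z V ≠ zeroClause σ W := fun h => by
  have h1 : (z, σ z) ∈ zeroClause σ W := h ▸ Finset.mem_insert_self _ _
  have := (mem_zeroClause.1 h1).2
  simp at this

theorem oneClause_inj {z z' : Fin N} {V V' : Finset (Fin N)} (hz : z ∉ V) (hz' : z' ∉ V')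
    (h : oneClause σ z V = oneClause σ z' V') : z = z' ∧ V = V' := by
  have h1 : (z, σ z) ∈ oneClause σ z' V' := h ▸ Finset.mem_insert_self _ _
  have hzz : z = z' := by
    rw [oneClause, Finset.mem_insert, mem_zeroClause] at h1
    rcases h1 with h1 | h1
    · exact congrArg Prod.fst h1
    · have := h1.2
      simp at this
  subst hzz
  refine ⟨rfl, ?_⟩
  have h2 := congrArg (Finset.image Prod.fst) h
  rw [oneClause, oneClause, Finset.image_insert, Finset.image_insert, image_fst_zeroClause,
    image_fst_zeroClause] at h2
  rw [← Finset.erase_insert hz, h2, Finset.erase_insert hz']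

/-- The clauses of length `k` that are false under `σ`. -/
def zeroClauses (k : ℕ) (σ : Fin N → Bool) : Finset (Clause N) :=
  (Finset.univ.powersetCard k).image (zeroClause σ)

/-- The clauses of length `k` that block the set `S`. -/
def blockingClauses (k : ℕ) (σ : Fin N → Bool) (S : Finset (Fin N)) : Finset (Clause N) :=
  ((Finset.univ.powersetCard k).filter fun V => (V \ S).card ≤ 1).image (zeroClause σ)

/-- The number of clauses of length `k` that block a set of `T` out of `N` variables: all their
variables belong to the set, or all but one. -/
def numBlocking (k N T : ℕ) : ℕ := T.choose k + (N - T) * T.choose (k - 1)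

theorem zeroClauses_subset : zeroClauses k σ ⊆ kClauses k N := fun c hc => by
  obtain ⟨V, hV, rfl⟩ := Finset.mem_image.1 hc
  exact zeroClause_mem_kClauses.2 (Finset.mem_powersetCard.1 hV).2

theorem blockingClauses_subset (S : Finset (Fin N)) :
    blockingClauses k σ S ⊆ zeroClauses k σ :=
  Finset.image_subset_image (Finset.filter_subset _ _)

theorem card_zeroClauses : (zeroClauses k σ).card = N.choose k := by
  rw [zeroClauses, Finset.card_image_of_injective _ zeroClause_injective]
  simp

theorem card_blockingClauses (hk : 1 ≤ k) (S : Finset (Fin N)) :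
    (blockingClauses k σ S).card = numBlocking k N S.card := by
  rw [blockingClauses, Finset.card_image_of_injective _ zeroClause_injective]
  have hsplit : ((Finset.univ : Finset (Fin N)).powersetCard k).filter
      (fun V => (V \ S).card ≤ 1) = S.powersetCard k ∪
        (Sᶜ ×ˢ S.powersetCard (k - 1)).image (fun p => insert p.1 p.2) := by
    ext V
    simp only [Finset.mem_filter, Finset.mem_powersetCard, Finset.subset_univ, true_and,
      Finset.mem_union, Finset.mem_image, Finset.mem_product, Finset.mem_compl, Prod.exists]
    constructor
    · rintro ⟨hV, hVS⟩
      rcases (V \ S).eq_empty_or_nonempty with h0 | ⟨x, hx⟩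
      · exact Or.inl ⟨Finset.sdiff_eq_empty_iff_subset.1 h0, hV⟩
      · refine Or.inr ⟨x, V.erase x, ⟨(Finset.mem_sdiff.1 hx).2, ?_, ?_⟩, ?_⟩
        · intro v hv
          by_contra hvS
          exact Finset.ne_of_mem_erase hv (Finset.card_le_one.1 hVS _
            (Finset.mem_sdiff.2 ⟨Finset.mem_of_mem_erase hv, hvS⟩) _ hx)
        · rw [Finset.card_erase_of_mem (Finset.mem_sdiff.1 hx).1, hV]
        · exact Finset.insert_erase (Finset.mem_sdiff.1 hx).1
    · rintro (⟨hVS, hV⟩ | ⟨x, W, ⟨hx, hWS, hW⟩, rfl⟩)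
      · exact ⟨hV, by simp [Finset.sdiff_eq_empty_iff_subset.2 hVS]⟩
      · refine ⟨?_, ?_⟩
        · rw [Finset.card_insert_of_notMem (fun h => hx (hWS h)), hW]
          omega
        · refine Finset.card_le_one.2 fun a ha b hb => ?_
          grind
  rw [hsplit, Finset.card_union_of_disjoint, Finset.card_image_of_injOn]
  · simp [numBlocking, Finset.card_compl]
  · rintro ⟨x, W⟩ hp ⟨x', W'⟩ hp' he
    simp only [Finset.coe_product, Set.mem_prod, Finset.mem_coe, Finset.mem_compl,
      Finset.mem_powersetCard] at hp hp' he
    have hxx : x = x' := by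
      have : x ∈ insert x' W' := he ▸ Finset.mem_insert_self _ _
      rcases Finset.mem_insert.1 this with h | h
      · exact h
      · exact absurd (hp'.2.1 h) hp.1
    subst hxx
    have : W = W' := by
      rw [← Finset.erase_insert (fun h => hp.1 (hp.2.1 h)), he,
        Finset.erase_insert (fun h => hp.1 (hp'.2.1 h))]
    rw [this]
  · rw [Finset.disjoint_left]
    intro V hV hV'
    obtain ⟨p, hp, rfl⟩ := Finset.mem_image.1 hV'
    rw [Finset.mem_product, Finset.mem_compl] at hp
    exact hp.1 ((Finset.mem_powersetCard.1 hV).1 (Finset.mem_insert_self _ _))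

theorem blocked_iff {F : Formula N} (hF : F ⊆ kClauses k N) {S : Finset (Fin N)} :
    Blocked σ F S ↔ ¬ Disjoint F (blockingClauses k σ S) := by
  rw [Finset.not_disjoint_iff]
  constructor
  · rintro ⟨V, hV, hS⟩
    refine ⟨_, hV, Finset.mem_image_of_mem _ (Finset.mem_filter.2 ⟨?_, hS⟩)⟩
    exact Finset.mem_powersetCard.2 ⟨Finset.subset_univ _, zeroClause_mem_kClauses.1 (hF hV)⟩
  · rintro ⟨c, hc, h⟩
    obtain ⟨V, hV, rfl⟩ := Finset.mem_image.1 h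
    exact ⟨V, hc, (Finset.mem_filter.1 hV).2⟩

theorem forall_zeroClause_notMem_iff {F : Formula N} (hF : F ⊆ kClauses k N) :
    (∀ V, zeroClause σ V ∉ F) ↔ Disjoint F (zeroClauses k σ) := by
  rw [Finset.disjoint_left]
  constructor
  · intro h c hc hc'
    obtain ⟨V, -, rfl⟩ := Finset.mem_image.1 hc'
    exact h V hc
  · intro h V hV
    exact h hV (Finset.mem_image_of_mem _ (Finset.mem_powersetCard.2
      ⟨Finset.subset_univ _, zeroClause_mem_kClauses.1 (hF hV)⟩))

theorem forced_inter_sdiff {F : Formula N} (hF : F ⊆ kClauses k N) :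
    forced σ (F ∩ (kClauses k N \ zeroClauses k σ)) = forced σ F := by
  funext S
  ext z
  simp only [mem_forced, Finset.mem_inter, Finset.mem_sdiff]
  refine exists_congr fun V => and_congr_right fun _ => and_iff_left_of_imp fun h => ⟨hF h, ?_⟩
  intro h'
  obtain ⟨W, -, h⟩ := Finset.mem_image.1 h'
  exact oneClause_ne_zeroClause z V W h.symm

theorem card_disjoint_instances {B : Finset (Clause N)} (hB : B ⊆ kClauses k N) (M : ℕ) :
    ((instances k N M).filter fun F => Disjoint F B).card =
      (N.choose k * 2 ^ k - B.card).choose M := by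
  have := card_filter_powersetCard (X := kClauses k N) (R := ∅) (G := ∅) (E := ∅) (B := B) (M := M)
    le_rfl (Finset.empty_subset _) (Finset.empty_subset _) hB (by simp) (by simp) (by simp)
    (by simp)
  simpa [card_kClauses, instances] using this

open scoped Classical in
/-- The clauses that are false under `σ` are independent of the clauses that drive unit propagation
along `σ`. So the probability that the walk is not blocked is the one for a fixed set of variables,
and only the number of assigned variables matters. -/
theorem sum_hit_le (hk : 1 ≤ k) (M : ℕ) (σ : Fin N → Bool) :
    ∑ F ∈ instances k N M, hit (forced σ F)
      (fun C => if Blocked σ F C then 0 else (2 : ℝ≥0∞)⁻¹ ^ Cᶜ.card) ∅ ≤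
    ∑ T ∈ Finset.range (N + 1), (2 : ℝ≥0∞)⁻¹ ^ (N - T) *
      ((N.choose k * 2 ^ k - numBlocking k N T).choose M : ℕ) := by
  set X := kClauses k N with hX
  set R := X \ zeroClauses k σ with hR
  set fib : Finset (Clause N) → Finset (Formula N) :=
    fun G => (instances k N M).filter fun F => F ∩ R = G with hfib
  set cnt : Finset (Clause N) → Finset (Fin N) → ℕ :=
    fun G C => ((fib G).filter fun F => Disjoint F (blockingClauses k σ C)).card with hcnt
  have hsub : ∀ F ∈ instances k N M, F ⊆ X := fun F hF => (Finset.mem_powersetCard.1 hF).1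
  -- The number of instances with a prescribed propagating part depends on `C` through its size.
  have hcard : ∀ G ∈ R.powerset, ∀ C C' : Finset (Fin N), C.card = C'.card →
      cnt G C = cnt G C' := by
    intro G hG C C' hCC
    rw [Finset.mem_powerset] at hG
    by_cases hGM : G.card ≤ M
    · have key : ∀ C, cnt G C = (X.card - R.card - (∅ : Finset (Clause N)).card -
          (blockingClauses k σ C).card).choose (M - (G.card + (∅ : Finset (Clause N)).card)) := by
        intro C
        rw [← card_filter_powersetCard (X := X) (R := R) (G := G) (E := ∅)
          (B := blockingClauses k σ C) (M := M) hG Finset.sdiff_subset (Finset.empty_subset _)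
          ((blockingClauses_subset C).trans zeroClauses_subset) (by simp)
          (Finset.disjoint_of_subset_right (blockingClauses_subset C) Finset.sdiff_disjoint)
          (by simp) (by simpa using hGM)]
        simp only [hcnt, hfib, Finset.filter_filter, instances, Finset.empty_subset, true_and, hX]
      rw [key, key, card_blockingClauses hk, card_blockingClauses hk, hCC]
    · have : fib G = ∅ := by
        refine Finset.filter_eq_empty_iff.2 fun F hF h => hGM ?_
        rw [← h, ← (Finset.mem_powersetCard.1 hF).2]
        exact Finset.card_le_card Finset.inter_subset_left
      simp [hcnt, this]
  have hmaps : ∀ F ∈ instances k N M, F ∩ R ∈ R.powerset := fun F _ =>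
    Finset.mem_powerset.2 Finset.inter_subset_right
  have href : ∀ T ∈ Finset.range (N + 1), ∃ C : Finset (Fin N), C.card = T := by
    intro T hT
    obtain ⟨C, -, hC⟩ := Finset.exists_subset_card_eq (s := (Finset.univ : Finset (Fin N)))
      (n := T) (by simpa using Finset.mem_range_succ_iff.1 hT)
    exact ⟨C, hC⟩
  choose! ref href using href
  calc _ = ∑ G ∈ R.powerset, ∑ F ∈ fib G, hit (forced σ F)
        (fun C => if Blocked σ F C then 0 else (2 : ℝ≥0∞)⁻¹ ^ Cᶜ.card) ∅ :=
        (Finset.sum_fiberwise_of_maps_to hmaps _).symm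
    _ = ∑ G ∈ R.powerset, hit (forced σ G) (fun C => ∑ F ∈ fib G,
          if Blocked σ F C then 0 else (2 : ℝ≥0∞)⁻¹ ^ Cᶜ.card) ∅ := by
        refine Finset.sum_congr rfl fun G _ => ?_
        rw [← sum_hit]
        refine Finset.sum_congr rfl fun F hF => ?_
        rw [hfib, Finset.mem_filter] at hF
        rw [← hF.2, hR, forced_inter_sdiff (hsub F hF.1)]
    _ ≤ ∑ G ∈ R.powerset, ∑ T ∈ Finset.range (N + 1),
          (2 : ℝ≥0∞)⁻¹ ^ (N - T) * (cnt G (ref T) : ℕ) := by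
        refine Finset.sum_le_sum fun G hG => ?_
        refine (hit_le_sum (w := fun T => (2 : ℝ≥0∞)⁻¹ ^ (N - T) * (cnt G (ref T) : ℕ)) ?_ _).trans
          ?_
        · intro C
          have hCN : C.card ∈ Finset.range (N + 1) := by
            have := Finset.card_le_univ C
            rw [Fintype.card_fin] at this
            exact Finset.mem_range_succ_iff.2 this
          rw [hcard G hG (ref C.card) C (href _ hCN)]
          simp only [hcnt]
          rw [Finset.card_filter, Nat.cast_sum, Finset.mul_sum]
          refine Finset.sum_le_sum fun F hF => ?_
          rw [blocked_iff (hsub F (Finset.mem_filter.1 hF).1), Finset.card_compl,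
            Fintype.card_fin]
          by_cases h : Disjoint F (blockingClauses k σ C) <;> simp [h]
        · rw [Finset.card_empty]
          refine Finset.sum_le_sum_of_subset fun T hT => ?_
          rw [Finset.mem_Icc] at hT
          exact Finset.mem_range_succ_iff.2 hT.2
    _ = _ := by
        rw [Finset.sum_comm]
        refine Finset.sum_congr rfl fun T hT => ?_
        rw [← Finset.mul_sum, ← Nat.cast_sum]
        congr 2
        rw [← href T hT, ← card_blockingClauses (σ := σ) hk, href T hT,
          ← card_disjoint_instances ((blockingClauses_subset _).trans zeroClauses_subset),
          Finset.card_eq_sum_card_fiberwise (f := fun F => F ∩ R) (t := R.powerset)]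
        · refine Finset.sum_congr rfl fun G _ => ?_
          simp only [hcnt, hfib, Finset.filter_filter, and_comm]
        · intro F _
          exact Finset.mem_powerset.2 Finset.inter_subset_right

end count

/-! ### Expectations over the random instance -/

section expectation

variable {N k M : ℕ} {rule : UnitRule N} {f : SearchTree N → ℕ}

theorem expectation_eq (σ₀ : Fin N → Bool) :
    expectation k N M rule f =
      (∑ F ∈ instances k N M, value rule f F (restrict σ₀ ∅)) /
        ((N.choose k * 2 ^ k).choose M : ℕ) := by
  rw [expectation, card_instances, restrict_empty]
  rfl

theorem expectation_leaves_le (hk : 1 ≤ k) (hM : M ≤ N.choose k * 2 ^ k) :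
    expectation k N M rule SearchTree.leaves ≤
      1 + ∑ T ∈ Finset.range (N + 1), (2 : ℝ≥0∞) ^ T *
        ((N.choose k * 2 ^ k - numBlocking k N T).choose M : ℕ) /
          ((N.choose k * 2 ^ k).choose M : ℕ) := by
  classical
  have hpos : ((N.choose k * 2 ^ k).choose M : ℝ≥0∞) ≠ 0 := by
    exact_mod_cast (Nat.choose_pos hM).ne'
  rw [expectation_eq fun _ => true]
  refine ENNReal.div_le_of_le_mul ?_
  calc _ ≤ ∑ F ∈ instances k N M, (1 + ∑ σ : Fin N → Bool, hit (forced σ F)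
          (fun C => if Blocked σ F C then 0 else (2 : ℝ≥0∞)⁻¹ ^ Cᶜ.card) ∅) := by
        refine Finset.sum_le_sum fun F _ => ?_
        rw [← agreeing_empty fun _ => true]
        exact value_leaves_le_sum_hit _ _
    _ ≤ ((N.choose k * 2 ^ k).choose M : ℕ) + ∑ σ : Fin N → Bool,
          ∑ T ∈ Finset.range (N + 1), (2 : ℝ≥0∞)⁻¹ ^ (N - T) *
            ((N.choose k * 2 ^ k - numBlocking k N T).choose M : ℕ) := by
        rw [Finset.sum_add_distrib, Finset.sum_comm, Finset.sum_const, card_instances,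
          nsmul_eq_mul, mul_one]
        exact add_le_add le_rfl (Finset.sum_le_sum fun σ _ => sum_hit_le hk M σ)
    _ = _ := by
        rw [Finset.sum_const, Finset.card_univ, Fintype.card_fun, Fintype.card_bool,
          Fintype.card_fin, add_mul, one_mul, nsmul_eq_mul, Finset.mul_sum, Finset.sum_mul]
        congr 1
        refine Finset.sum_congr rfl fun T hT => ?_
        rw [ENNReal.div_mul_cancel hpos (by simp), ← mul_assoc]
        congr 1
        have hT' : T + (N - T) = N := by
          have := Finset.mem_range_succ_iff.1 hT
          omega
        push_cast
        nth_rw 1 [← hT']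
        rw [pow_add, mul_assoc, ← mul_pow, ENNReal.mul_inv_cancel (by simp) (by simp), one_pow,
          mul_one]

theorem expectation_solutionLeaves_le :
    expectation k N M rule SearchTree.solutionLeaves ≤
      (2 : ℝ≥0∞) ^ N * ((N.choose k * 2 ^ k - N.choose k).choose M : ℕ) /
          ((N.choose k * 2 ^ k).choose M : ℕ) := by
  classical
  rw [expectation_eq fun _ => true]
  refine ENNReal.div_le_div_right ?_ _
  calc _ ≤ ∑ F ∈ instances k N M, ((Finset.univ.filter
          fun σ : Fin N → Bool => ∀ V, zeroClause σ V ∉ F).card : ℝ≥0∞) := by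
        refine Finset.sum_le_sum fun F _ => ?_
        rw [← agreeing_empty fun _ => true]
        exact value_solutionLeaves_le _ _
    _ = ∑ σ : Fin N → Bool, (((instances k N M).filter
          fun F => Disjoint F (zeroClauses k σ)).card : ℝ≥0∞) := by
        simp only [← Nat.cast_sum, Finset.card_filter]
        rw [Finset.sum_comm]
        congr 1
        refine Finset.sum_congr rfl fun σ _ => Finset.sum_congr rfl fun F hF => ?_
        exact if_congr (forall_zeroClause_notMem_iff (Finset.mem_powersetCard.1 hF).1) rfl rfl
    _ = _ := by
        simp only [card_disjoint_instances zeroClauses_subset, card_zeroClauses]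
        rw [Finset.sum_const, Finset.card_univ, Fintype.card_fun, Fintype.card_bool,
          Fintype.card_fin, nsmul_eq_mul]
        push_cast
        rfl

theorem hit_mul {p : Finset (Fin N) → Finset (Fin N)} {φ : Finset (Fin N) → ℝ≥0∞} (c : ℝ≥0∞)
    (S : Finset (Fin N)) : hit p (fun C => c * φ C) S = c * hit p φ S := by
  induction hn : Sᶜ.card using Nat.strong_induction_on generalizing S with
  | _ n ih =>
    by_cases hc : p S ⊆ S
    · rw [hit_of_closed hc, hit_of_closed hc, mul_add, ← mul_div_assoc, Finset.mul_sum]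
      congr 2
      exact Finset.sum_congr rfl fun x hx =>
        ih _ (hn ▸ card_compl_insert_lt (Finset.mem_compl.1 hx)) _ rfl
    · have h' : (p S \ S).Nonempty := by
        rwa [Finset.nonempty_iff_ne_empty, Ne, Finset.sdiff_eq_empty_iff_subset]
      rw [hit, dif_pos h']
      conv_rhs => rw [hit, dif_pos h']
      exact ih _ (hn ▸ card_compl_insert_lt (Finset.mem_sdiff.1 (Finset.min'_mem _ h')).2) _ rfl

open scoped Classical in
/-- A lower bound for an expected number of leaves: it suffices to exhibit, for every full
assignment, a probable event `Q` that makes its walk pass through a split at depth `T` below which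
the expected number of leaves is at least `a`. -/
theorem le_expectation (hf : IsLeafCount f) {T : ℕ} (hTN : T ≤ N) {a w : ℝ≥0∞}
    (Q : (Fin N → Bool) → Finset (Fin N) → Formula N → Prop)
    (hQ : ∀ σ C F, Q σ C F → C.card = T ∧ ¬ Blocked σ F C ∧
      residualFormula F (restrict σ C) ≠ ∅)
    (hv : ∀ σ S F, Q σ S F → ∅ ∉ residualFormula F (restrict σ S) →
      (¬ ∃ l, {l} ∈ residualFormula F (restrict σ S)) → a ≤ value rule f F (restrict σ S))
    (hw : ∀ σ, w ≤ ∑ F ∈ instances k N M,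
      hit (forced σ F) (fun C => if Q σ C F then 1 else 0) ∅) :
    (2 : ℝ≥0∞) ^ T * a * w / ((N.choose k * 2 ^ k).choose M : ℕ) ≤
      expectation k N M rule f := by
  rw [expectation_eq fun _ => true]
  refine ENNReal.div_le_div_right ?_ _
  set c : ℝ≥0∞ := (2 : ℝ≥0∞)⁻¹ ^ (N - T) * a with hc
  calc (2 : ℝ≥0∞) ^ T * a * w = ∑ σ : Fin N → Bool, c * w := by
        rw [Finset.sum_const, Finset.card_univ, Fintype.card_fun, Fintype.card_bool,
          Fintype.card_fin, nsmul_eq_mul]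
        push_cast
        have hT' : T + (N - T) = N := by omega
        conv_rhs => rw [← hT']
        rw [hc, pow_add]
        calc _ = (2 ^ T * (1 : ℝ≥0∞) ^ (N - T)) * a * w := by rw [one_pow, mul_one]
          _ = (2 ^ T * (2 * 2⁻¹ : ℝ≥0∞) ^ (N - T)) * a * w := by
            rw [ENNReal.mul_inv_cancel (by simp) (by simp)]
          _ = _ := by rw [mul_pow]; ring
    _ ≤ ∑ σ : Fin N → Bool, c * ∑ F ∈ instances k N M,
          hit (forced σ F) (fun C => if Q σ C F then 1 else 0) ∅ := by
        gcongr with σ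
        exact hw σ
    _ = ∑ F ∈ instances k N M, ∑ σ : Fin N → Bool,
          hit (forced σ F) (fun C => c * if Q σ C F then 1 else 0) ∅ := by
        rw [Finset.sum_comm]
        refine Finset.sum_congr rfl fun σ _ => ?_
        rw [Finset.mul_sum]
        exact Finset.sum_congr rfl fun F _ => (hit_mul _ _).symm
    _ ≤ _ := by
        refine Finset.sum_le_sum fun F _ => ?_
        rw [← agreeing_empty fun _ => true]
        refine sum_hit_le_value (φ := fun σ C => c * if Q σ C F then 1 else 0) hf (T := T) ?_ ?_ _ _
        · intro σ C hne
          by_cases h : Q σ C F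
          · exact hQ σ C F h
          · simp [h] at hne
        · intro σ₀ S hS h₁ h₂ h₃
          have hle : ∀ σ ∈ agreeing σ₀ S, c * (if Q σ S F then 1 else 0) ≤
              (2 : ℝ≥0∞)⁻¹ ^ (N - T) * value rule f F (restrict σ₀ S) := by
            intro σ hσ
            split_ifs with h
            · rw [mul_one, hc]
              rw [restrict_of_mem_agreeing hσ] at h₂ h₃ ⊢
              gcongr
              exact hv σ S F h h₂ h₃
            · simp
          refine (Finset.sum_le_card_nsmul _ _ _ hle).trans ?_
          rw [card_agreeing, nsmul_eq_mul, Finset.card_compl, Fintype.card_fin, hS, ← mul_assoc]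
          push_cast
          rw [← mul_pow, ENNReal.mul_inv_cancel (by simp) (by simp), one_pow, one_mul]

/-- At a split with `x` and `y` unset, suppose that two clauses force `y` to opposite values once
`x` is set as in `σ`. Then the split, if it is on `x`, has a contradiction leaf below it. -/
theorem inv_le_value_contradictionLeaves {F : Formula N} {σ : Fin N → Bool} {S V : Finset (Fin N)}
    {x y : Fin N} (hx : x ∉ S) (hy : y ∉ S) (hxy : x ≠ y) (hV : V ⊆ S)
    (h1 : oneClause σ y (insert x V) ∈ F) (h0 : zeroClause σ (insert y (insert x V)) ∈ F)
    (h₂ : ∅ ∉ residualFormula F (restrict σ S))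
    (h₃ : ¬ ∃ l, {l} ∈ residualFormula F (restrict σ S)) :
    (N : ℝ≥0∞)⁻¹ ≤ value rule SearchTree.contradictionLeaves F (restrict σ S) := by
  have h₁ : residualFormula F (restrict σ S) ≠ ∅ := by
    intro h
    rw [residualFormula_eq_empty] at h
    obtain ⟨l, hl, h'⟩ := h _ h0
    rw [restrict_eq_some, (mem_zeroClause.1 hl).2] at h'
    simp at h'
  rw [value_restrict_of_split isLeafCount_contradictionLeaves h₁ h₂ h₃]
  have hle : (1 : ℝ≥0∞) ≤ value rule SearchTree.contradictionLeaves F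
      (restrict (Function.update σ x (σ x)) (insert x S)) := by
    rw [Function.update_eq_self]
    refine one_le_value_contradictionLeaves (y := y) fun b => ?_
    have hyS : y ∉ insert x S := by
      rw [Finset.mem_insert, not_or]
      exact ⟨hxy.symm, hy⟩
    have hVS := Finset.insert_subset_insert x hV
    by_cases hb : b = σ y
    · rw [hb]
      exact unit_of_mem_forced (mem_forced.2 ⟨_, hVS, h1⟩) hyS
    · have hb' : b = !σ y := by
        revert hb
        cases b <;> cases σ y <;> simp
      rw [hb']
      refine mem_residualFormula_of_union hVS (by rwa [← zeroClause_insert]) ?_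
      intro l hl
      rwa [Finset.mem_singleton.1 hl]
  have hsum : (1 : ℝ≥0∞) ≤ ∑ x ∈ Sᶜ,
      (value rule SearchTree.contradictionLeaves F
          (restrict (Function.update σ x true) (insert x S)) +
        value rule SearchTree.contradictionLeaves F
          (restrict (Function.update σ x false) (insert x S))) := by
    refine le_trans ?_ (Finset.single_le_sum (fun _ _ => zero_le) (Finset.mem_compl.2 hx))
    cases hσ : σ x
    · rw [hσ] at hle
      exact le_add_left hle
    · rw [hσ] at hle
      exact le_add_right hle
  rw [← one_div]
  refine ENNReal.div_le_div hsum ?_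
  have := Finset.card_le_univ Sᶜ
  rw [Fintype.card_fin] at this
  exact_mod_cast this

/-! ### Walks on which two given variables are left -/

/-- If propagation never forces `x` or `y`, then these are the last two elements with the
probability that a uniformly random ordering would give. -/
theorem le_hit_compl_pair {p : Finset (Fin N) → Finset (Fin N)} {φ : Finset (Fin N) → ℝ≥0∞}
    {x y : Fin N} (hxy : x ≠ y)
    (hp : ∀ S ⊆ ({x, y} : Finset (Fin N))ᶜ, p S ⊆ ({x, y} : Finset (Fin N))ᶜ)
    {S : Finset (Fin N)} (hS : S ⊆ ({x, y} : Finset (Fin N))ᶜ) :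
    φ ({x, y} : Finset (Fin N))ᶜ * ((Sᶜ.card.choose 2 : ℕ) : ℝ≥0∞)⁻¹ ≤ hit p φ S := by
  have hpair : ({x, y} : Finset (Fin N)).card = 2 := Finset.card_pair hxy
  induction hn : Sᶜ.card using Nat.strong_induction_on generalizing S with
  | _ n ih =>
    have hins : ∀ z ∈ ({x, y} : Finset (Fin N))ᶜ, z ∉ S → n = (insert z S)ᶜ.card + 1 := by
      intro z _ hzS
      rw [← hn, Finset.compl_insert, Finset.card_erase_add_one (Finset.mem_compl.2 hzS)]
    have ih' : ∀ z ∈ ({x, y} : Finset (Fin N))ᶜ, z ∉ S →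
        φ ({x, y} : Finset (Fin N))ᶜ * (((n - 1).choose 2 : ℕ) : ℝ≥0∞)⁻¹ ≤
          hit p φ (insert z S) := by
      intro z hz hzS
      have h1 := hins z hz hzS
      rw [show n - 1 = (insert z S)ᶜ.card by omega]
      exact ih _ (by omega) (Finset.insert_subset hz hS) rfl
    by_cases hc : p S ⊆ S
    · by_cases hS' : S = ({x, y} : Finset (Fin N))ᶜ
      · rw [hit_of_closed hc]
        have : n = 2 := by rw [← hn, hS', compl_compl, hpair]
        rw [this, ← hS']
        refine le_add_right ?_
        simp
      · rw [hit_of_closed hc]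
        refine le_add_left ?_
        have hsub : ({x, y} : Finset (Fin N)) ⊆ Sᶜ := by
          rw [← Finset.compl_subset_compl, compl_compl]
          exact hS
        have hcard : (Sᶜ \ {x, y}).card = n - 2 := by
          rw [Finset.card_sdiff_of_subset hsub, hn, hpair]
        have hn2 : 2 < n := by
          have h1 : 0 < (Sᶜ \ {x, y}).card := by
            rw [Finset.card_pos, Finset.nonempty_iff_ne_empty, Ne,
              Finset.sdiff_eq_empty_iff_subset]
            intro h
            apply hS'
            rw [← Finset.Subset.antisymm h hsub, compl_compl]
          omega
        have hsum : ((n - 2 : ℕ) : ℝ≥0∞) *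
            (φ ({x, y} : Finset (Fin N))ᶜ * (((n - 1).choose 2 : ℕ) : ℝ≥0∞)⁻¹) ≤
            ∑ z ∈ Sᶜ, hit p φ (insert z S) := by
          rw [← hcard, ← nsmul_eq_mul]
          refine (Finset.card_nsmul_le_sum _ (fun z => hit p φ (insert z S)) _ ?_).trans
            (Finset.sum_le_sum_of_subset Finset.sdiff_subset)
          intro z hz
          rw [Finset.mem_sdiff] at hz
          exact ih' z (Finset.mem_compl.2 hz.2) (Finset.mem_compl.1 hz.1)
        rw [hn, ENNReal.le_div_iff_mul_le (by left; simp; omega) (by left; simp)]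
        refine le_trans (le_of_eq ?_) hsum
        obtain ⟨m, rfl⟩ : ∃ m, n = m + 1 := ⟨n - 1, by omega⟩
        have h := Nat.choose_mul_succ_eq m 2
        have h1 : ((m.choose 2 : ℕ) : ℝ≥0∞) ≠ 0 := by
          exact_mod_cast (Nat.choose_pos (by omega)).ne'
        have h2 : (((m + 1).choose 2 : ℕ) : ℝ≥0∞) ≠ 0 := by
          exact_mod_cast (Nat.choose_pos (by omega)).ne'
        have h' : ((m.choose 2 : ℕ) : ℝ≥0∞) * ((m + 1 : ℕ) : ℝ≥0∞) =
            (((m + 1).choose 2 : ℕ) : ℝ≥0∞) * ((m + 1 - 2 : ℕ) : ℝ≥0∞) := by exact_mod_cast h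
        have h'' : (((m + 1).choose 2 : ℕ) : ℝ≥0∞)⁻¹ * ((m + 1 : ℕ) : ℝ≥0∞) =
            ((m + 1 - 2 : ℕ) : ℝ≥0∞) * ((m.choose 2 : ℕ) : ℝ≥0∞)⁻¹ := by
          rw [← ENNReal.div_eq_inv_mul, ← div_eq_mul_inv,
            ENNReal.div_eq_div_iff h1 (by simp) h2 (by simp)]
          rw [mul_comm] at h'
          rw [mul_comm, h', mul_comm]
        rw [Nat.add_sub_cancel, mul_assoc, h'', mul_left_comm]
    · obtain ⟨z, hz, hzS, he⟩ := exists_hit_eq (φ := φ) hc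
      rw [he]
      refine le_trans ?_ (ih' z (hp S hS hz) hzS)
      gcongr
      omega

/-- The clauses that can force `x` or `y` while both are unset. -/
def pairClauses (k : ℕ) (σ : Fin N → Bool) (x y : Fin N) : Finset (Clause N) :=
  (({x, y} : Finset (Fin N)) ×ˢ ({x, y} : Finset (Fin N))ᶜ.powersetCard (k - 1)).image
    fun q => oneClause σ q.1 q.2

theorem pairClauses_subset (hk : 1 ≤ k) (σ : Fin N → Bool) (x y : Fin N) :
    pairClauses k σ x y ⊆ kClauses k N := fun c hc => by
  obtain ⟨⟨z, V⟩, hq, rfl⟩ := Finset.mem_image.1 hc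
  rw [Finset.mem_product, Finset.mem_powersetCard] at hq
  rw [oneClause_mem_kClauses fun h => Finset.mem_compl.1 (hq.2.1 h) hq.1, hq.2.2]
  omega

theorem card_pairClauses_le (σ : Fin N → Bool) {x y : Fin N} (hxy : x ≠ y) :
    (pairClauses k σ x y).card ≤ 2 * (N - 2).choose (k - 1) := by
  refine Finset.card_image_le.trans ?_
  rw [Finset.card_product, Finset.card_powersetCard, Finset.card_compl, Finset.card_pair hxy,
    Fintype.card_fin]

theorem forced_subset_of_disjoint_pairClauses {F : Formula N} (hF : F ⊆ kClauses k N)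
    {σ : Fin N → Bool} {x y : Fin N} (h : Disjoint F (pairClauses k σ x y)) :
    ∀ S ⊆ ({x, y} : Finset (Fin N))ᶜ, forced σ F S ⊆ ({x, y} : Finset (Fin N))ᶜ := by
  intro S hS z hz
  rw [Finset.mem_compl]
  intro hzxy
  obtain ⟨V, hV, hc⟩ := mem_forced.1 hz
  have hzV : z ∉ V := fun h => Finset.mem_compl.1 (hS (hV h)) hzxy
  have hcard := (oneClause_mem_kClauses hzV).1 (hF hc)
  refine Finset.disjoint_left.1 h hc (Finset.mem_image.2 ⟨(z, V), ?_, rfl⟩)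
  rw [Finset.mem_product, Finset.mem_powersetCard]
  exact ⟨hzxy, hV.trans hS, by simp only; omega⟩

open scoped Classical in
/-- If the instance avoids the clauses that can force `x` or `y`, then the growing set visits the
complement of `{x, y}` with probability at least `1 / N.choose 2`, as if all the variables were drawn
at random. The instance is moreover required to contain `E` and to avoid `B`. -/
theorem le_sum_hit_pair (hk : 1 ≤ k) {σ : Fin N → Bool} {x y : Fin N} (hxy : x ≠ y)
    {E B : Finset (Clause N)} (hE : E ⊆ kClauses k N) (hB : B ⊆ kClauses k N)
    (hEB : Disjoint E B) (hEP : Disjoint E (pairClauses k σ x y)) (hEM : E.card ≤ M) :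
    (((N.choose k * 2 ^ k - E.card - (B.card + 2 * (N - 2).choose (k - 1))).choose (M - E.card) :
        ℕ) : ℝ≥0∞) * ((N.choose 2 : ℕ) : ℝ≥0∞)⁻¹ ≤
      ∑ F ∈ instances k N M, hit (forced σ F)
        (fun C => if C = ({x, y} : Finset (Fin N))ᶜ ∧ E ⊆ F ∧ Disjoint F B then 1 else 0) ∅ := by
  have hcount := card_filter_powersetCard (X := kClauses k N) (R := ∅) (G := ∅) (E := E)
    (B := B ∪ pairClauses k σ x y) (M := M) le_rfl (Finset.empty_subset _) hE
    (Finset.union_subset hB (pairClauses_subset hk σ x y)) (by simp) (by simp)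
    (Finset.disjoint_union_right.2 ⟨hEB, hEP⟩) (by simpa using hEM)
  have hle : (N.choose k * 2 ^ k - E.card - (B.card + 2 * (N - 2).choose (k - 1))).choose
      (M - E.card) ≤ ((instances k N M).filter
        fun F => E ⊆ F ∧ Disjoint F (B ∪ pairClauses k σ x y)).card := by
    simp only [Finset.inter_empty, true_and, Finset.card_empty, zero_add, Nat.sub_zero,
      card_kClauses] at hcount
    rw [instances, hcount]
    refine Nat.choose_le_choose _ ?_
    have h1 := Finset.card_union_le B (pairClauses k σ x y)
    have h2 := card_pairClauses_le (k := k) σ hxy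
    omega
  calc _ ≤ (((instances k N M).filter
        fun F => E ⊆ F ∧ Disjoint F (B ∪ pairClauses k σ x y)).card : ℝ≥0∞) *
          ((N.choose 2 : ℕ) : ℝ≥0∞)⁻¹ := by
        gcongr
    _ = ∑ F ∈ (instances k N M).filter
        fun F => E ⊆ F ∧ Disjoint F (B ∪ pairClauses k σ x y),
          ((N.choose 2 : ℕ) : ℝ≥0∞)⁻¹ := by
        rw [Finset.sum_const, nsmul_eq_mul]
    _ ≤ ∑ F ∈ (instances k N M).filter
        fun F => E ⊆ F ∧ Disjoint F (B ∪ pairClauses k σ x y), hit (forced σ F)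
        (fun C => if C = ({x, y} : Finset (Fin N))ᶜ ∧ E ⊆ F ∧ Disjoint F B then 1 else 0) ∅ := by
        refine Finset.sum_le_sum fun F hF => ?_
        rw [Finset.mem_filter, Finset.disjoint_union_right] at hF
        refine le_trans (le_of_eq ?_) (le_hit_compl_pair hxy
          (forced_subset_of_disjoint_pairClauses (Finset.mem_powersetCard.1 hF.1).1 hF.2.2.2)
          (Finset.empty_subset _))
        rw [if_pos ⟨rfl, hF.2.1, hF.2.2.1⟩]
        simp
    _ ≤ _ := Finset.sum_le_sum_of_subset (Finset.filter_subset _ _)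

/-- Positions for two unset variables and `k - 2` set ones. -/
theorem exists_unset_pair {T : ℕ} (hT : T + 2 ≤ N) (hk : k ≤ T + 2) {C : Finset (Fin N)}
    (hC : C.card = T) :
    ∃ x y : Fin N, ∃ V ⊆ C, x ≠ y ∧ x ∉ C ∧ y ∉ C ∧ V.card = k - 2 := by
  obtain ⟨x, hx, y, hy, hxy⟩ := Finset.one_lt_card.1
    (show 1 < Cᶜ.card by rw [Finset.card_compl, Fintype.card_fin]; omega)
  obtain ⟨V, hV, hVc⟩ := Finset.exists_subset_card_eq (s := C) (n := k - 2) (by omega)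
  exact ⟨x, y, V, hV, hxy, Finset.mem_compl.1 hx, Finset.mem_compl.1 hy, hVc⟩

theorem le_expectation_solutionLeaves (hk : 3 ≤ k) (hkN : k ≤ N) (hM : 1 ≤ M) :
    (2 : ℝ≥0∞) ^ (N - 2) * 1 *
      (((N.choose k * 2 ^ k - 1 - (N.choose k + 2 * (N - 2).choose (k - 1))).choose (M - 1) :
        ℕ) * ((N.choose 2 : ℕ) : ℝ≥0∞)⁻¹) / ((N.choose k * 2 ^ k).choose M : ℕ) ≤
      expectation k N M rule SearchTree.solutionLeaves := by
  classical
  obtain ⟨C, -, hC⟩ := Finset.exists_subset_card_eq (s := (Finset.univ : Finset (Fin N)))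
    (n := N - 2) (by simp)
  obtain ⟨x, y, V, hV, hxy, hx, hy, hVc⟩ := exists_unset_pair (k := k) (by omega) (by omega) hC
  have hCxy : C = ({x, y} : Finset (Fin N))ᶜ := by
    refine Finset.eq_of_subset_of_card_le (fun v hv => ?_) ?_
    · rw [Finset.mem_compl, Finset.mem_insert, Finset.mem_singleton]
      rintro (rfl | rfl)
      · exact hx hv
      · exact hy hv
    · rw [Finset.card_compl, Finset.card_pair hxy, hC, Fintype.card_fin]
  have hyV : y ∉ insert x V := by
    rw [Finset.mem_insert, not_or]
    exact ⟨hxy.symm, fun h => hy (hV h)⟩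
  have hmem : ∀ σ : Fin N → Bool, oneClause σ y (insert x V) ∈ kClauses k N := fun σ => by
    rw [oneClause_mem_kClauses hyV, Finset.card_insert_of_notMem (fun h => hx (hV h)), hVc]
    omega
  refine le_expectation isLeafCount_solutionLeaves (T := N - 2) (by omega)
    (fun σ S F => F ⊆ kClauses k N ∧ S = ({x, y} : Finset (Fin N))ᶜ ∧
      {oneClause σ y (insert x V)} ⊆ F ∧ Disjoint F (zeroClauses k σ)) ?_ ?_ ?_
  · rintro σ S F ⟨hF, rfl, hE, hB⟩
    rw [← hCxy]
    refine ⟨hC, fun ⟨W, hW, _⟩ => (forall_zeroClause_notMem_iff hF).2 hB W hW, fun h => ?_⟩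
    rw [residualFormula_eq_empty] at h
    obtain ⟨l, hl, h'⟩ := h _ (Finset.singleton_subset_iff.1 hE)
    rw [restrict_eq_some] at h'
    rcases mem_oneClause.1 hl with rfl | h1
    · exact hy h'.1
    · rw [h1.2] at h'
      simp at h'
  · rintro σ S F ⟨hF, -, -, hB⟩ - -
    exact one_le_value_solutionLeaves ((forall_zeroClause_notMem_iff hF).2 hB) S
  · intro σ
    have := le_sum_hit_pair (k := k) (M := M) (by omega) (σ := σ) hxy
      (E := {oneClause σ y (insert x V)}) (B := zeroClauses k σ)
      (Finset.singleton_subset_iff.2 (hmem σ)) zeroClauses_subset ?_ ?_ (by simpa using hM)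
    · rw [card_zeroClauses, Finset.card_singleton] at this
      refine this.trans (le_of_eq (Finset.sum_congr rfl fun F hF => ?_))
      simp only [(Finset.mem_powersetCard.1 hF).1, true_and]
    · rw [Finset.disjoint_singleton_left]
      intro h
      obtain ⟨W, -, h⟩ := Finset.mem_image.1 h
      exact oneClause_ne_zeroClause _ _ _ h.symm
    · rw [Finset.disjoint_singleton_left]
      intro h
      obtain ⟨⟨z, W⟩, hq, h⟩ := Finset.mem_image.1 h
      rw [Finset.mem_product, Finset.mem_powersetCard] at hq
      have := (oneClause_inj (fun h => Finset.mem_compl.1 (hq.2.1 h) hq.1) hyV h).2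
      have hxW : x ∈ W := by
        simp only at this
        rw [this]
        exact Finset.mem_insert_self _ _
      exact Finset.mem_compl.1 (hq.2.1 hxW) (Finset.mem_insert_self _ _)

/-- The two clauses that produce a contradiction after the variable `x` is set. -/
def contradictingPair (σ : Fin N → Bool) (x y : Fin N) (V : Finset (Fin N)) : Finset (Clause N) :=
  {oneClause σ y (insert x V), zeroClause σ (insert y (insert x V))}

section pair

variable {σ : Fin N → Bool} {x y : Fin N} {V C : Finset (Fin N)}

theorem card_contradictingPair : (contradictingPair σ x y V).card = 2 :=
  Finset.card_pair (oneClause_ne_zeroClause _ _ _)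

theorem contradictingPair_subset (hk : 2 ≤ k) (hxy : x ≠ y) (hx : x ∉ V) (hy : y ∉ V)
    (hV : V.card = k - 2) : contradictingPair σ x y V ⊆ kClauses k N := by
  have hyV : y ∉ insert x V := by
    rw [Finset.mem_insert, not_or]
    exact ⟨hxy.symm, hy⟩
  rw [contradictingPair, Finset.insert_subset_iff, Finset.singleton_subset_iff,
    oneClause_mem_kClauses hyV, zeroClause_mem_kClauses, Finset.card_insert_of_notMem hyV,
    Finset.card_insert_of_notMem hx, hV]
  omega

theorem disjoint_contradictingPair_blockingClauses (hxy : x ≠ y) (hx : x ∉ C) (hy : y ∉ C) :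
    Disjoint (contradictingPair σ x y V) (blockingClauses k σ C) := by
  rw [contradictingPair, Finset.disjoint_insert_left, Finset.disjoint_singleton_left]
  refine ⟨fun h => ?_, fun h => ?_⟩
  · obtain ⟨W, -, h⟩ := Finset.mem_image.1 h
    exact oneClause_ne_zeroClause _ _ _ h.symm
  · obtain ⟨W, hW, h⟩ := Finset.mem_image.1 h
    rw [zeroClause_injective h, Finset.mem_filter, Finset.card_le_one] at hW
    exact hxy (hW.2 x (by simp [hx]) y (by simp [hy]))

end pair

theorem le_expectation_contradictionLeaves (hk : 3 ≤ k) (hkN : k ≤ N) (hM : 2 ≤ M) :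
    (2 : ℝ≥0∞) ^ (N - 2) * (N : ℝ≥0∞)⁻¹ *
      (((N.choose k * 2 ^ k - 2 - (numBlocking k N (N - 2) +
        2 * (N - 2).choose (k - 1))).choose (M - 2) : ℕ) * ((N.choose 2 : ℕ) : ℝ≥0∞)⁻¹) /
          ((N.choose k * 2 ^ k).choose M : ℕ) ≤
      expectation k N M rule SearchTree.contradictionLeaves := by
  classical
  obtain ⟨C, -, hC⟩ := Finset.exists_subset_card_eq (s := (Finset.univ : Finset (Fin N)))
    (n := N - 2) (by simp)
  obtain ⟨x, y, V, hV, hxy, hx, hy, hVc⟩ := exists_unset_pair (k := k) (by omega) (by omega) hC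
  have hCxy : C = ({x, y} : Finset (Fin N))ᶜ := by
    refine Finset.eq_of_subset_of_card_le (fun v hv => ?_) ?_
    · rw [Finset.mem_compl, Finset.mem_insert, Finset.mem_singleton]
      rintro (rfl | rfl)
      · exact hx hv
      · exact hy hv
    · rw [Finset.card_compl, Finset.card_pair hxy, hC, Fintype.card_fin]
  have hyV : y ∉ insert x V := by
    rw [Finset.mem_insert, not_or]
    exact ⟨hxy.symm, fun h => hy (hV h)⟩
  refine le_expectation isLeafCount_contradictionLeaves (T := N - 2) (by omega)
    (fun σ S F => F ⊆ kClauses k N ∧ S = ({x, y} : Finset (Fin N))ᶜ ∧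
      contradictingPair σ x y V ⊆ F ∧ Disjoint F (blockingClauses k σ C)) ?_ ?_ ?_
  · rintro σ S F ⟨hF, rfl, hE, hB⟩
    rw [← hCxy]
    refine ⟨hC, fun h => (blocked_iff hF).1 h hB, fun h => ?_⟩
    rw [residualFormula_eq_empty] at h
    obtain ⟨l, hl, h'⟩ := h _ (hE (by simp [contradictingPair] :
      zeroClause σ (insert y (insert x V)) ∈ _))
    rw [restrict_eq_some, (mem_zeroClause.1 hl).2] at h'
    simp at h'
  · rintro σ S F ⟨hF, rfl, hE, -⟩ h₂ h₃
    rw [← hCxy] at h₂ h₃ ⊢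
    exact inv_le_value_contradictionLeaves hx hy hxy hV (hE (by simp [contradictingPair]))
      (hE (by simp [contradictingPair])) h₂ h₃
  · intro σ
    have := le_sum_hit_pair (k := k) (M := M) (by omega) (σ := σ) hxy
      (E := contradictingPair σ x y V) (B := blockingClauses k σ C)
      (contradictingPair_subset (by omega) hxy (fun h => hx (hV h)) (fun h => hy (hV h)) hVc)
      ((blockingClauses_subset C).trans zeroClauses_subset)
      (disjoint_contradictingPair_blockingClauses hxy hx hy) ?_
      (by rwa [card_contradictingPair])
    · rw [card_blockingClauses (by omega), card_contradictingPair, hC] at this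
      refine this.trans (le_of_eq (Finset.sum_congr rfl fun F hF => ?_))
      simp only [(Finset.mem_powersetCard.1 hF).1, true_and]
    · rw [contradictingPair, Finset.disjoint_insert_left, Finset.disjoint_singleton_left]
      refine ⟨fun h => ?_, fun h => ?_⟩
      · obtain ⟨⟨z, W⟩, hq, h⟩ := Finset.mem_image.1 h
        rw [Finset.mem_product, Finset.mem_powersetCard] at hq
        have := (oneClause_inj (fun h => Finset.mem_compl.1 (hq.2.1 h) hq.1) hyV h).2
        have hxW : x ∈ W := by
          simp only at this
          rw [this]
          exact Finset.mem_insert_self _ _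
        exact Finset.mem_compl.1 (hq.2.1 hxW) (Finset.mem_insert_self _ _)
      · obtain ⟨⟨z, W⟩, hq, h⟩ := Finset.mem_image.1 h
        exact oneClause_ne_zeroClause _ _ _ h

end expectation

/-! ### Binomial sums -/

/-- The sum of `f` over the sizes of the subsets of a set with `c` elements. -/
def binomSum (c : ℕ) (f : ℕ → ℕ) : ℕ := ∑ n ∈ Finset.range (c + 1), c.choose n * f n

theorem binomSum_zero (f : ℕ → ℕ) : binomSum 0 f = f 0 := by simp [binomSum]

theorem binomSum_succ (c : ℕ) (f : ℕ → ℕ) :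
    binomSum (c + 1) f = binomSum c f + binomSum c fun n => f (n + 1) := by
  have h : binomSum c f = f 0 + ∑ n ∈ Finset.range (c + 1), c.choose (n + 1) * f (n + 1) := by
    rw [binomSum, Finset.sum_range_succ', Finset.sum_range_succ (fun n => c.choose (n + 1) * _)]
    simp [add_comm]
  rw [h, binomSum, Finset.sum_range_succ']
  simp only [Nat.choose_succ_succ, add_mul, Finset.sum_add_distrib, binomSum, Nat.choose_zero_right,
    one_mul]
  ring

theorem binomSum_mono {c : ℕ} {f g : ℕ → ℕ} (h : ∀ n ≤ c, f n ≤ g n) :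
    binomSum c f ≤ binomSum c g :=
  Finset.sum_le_sum fun n hn => Nat.mul_le_mul_left _ (h n (Finset.mem_range_succ_iff.1 hn))

theorem mul_binomSum (a c : ℕ) (f : ℕ → ℕ) : (binomSum c fun n => a * f n) = a * binomSum c f := by
  simp only [binomSum, Finset.mul_sum]
  exact Finset.sum_congr rfl fun n _ => Nat.mul_left_comm _ _ _

/-- Vandermonde's identity. -/
theorem binomSum_add (c d : ℕ) (f : ℕ → ℕ) :
    binomSum (c + d) f = binomSum c fun i => binomSum d fun j => f (i + j) := by
  induction c generalizing f with
  | zero => simp [binomSum_zero]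
  | succ c ih =>
    rw [show c + 1 + d = c + d + 1 by ring, binomSum_succ, binomSum_succ, ih, ih]
    congr 2
    funext i
    congr 1
    funext j
    rw [add_right_comm]

/-- A set of `m` elements, `d` of which are marked, out of `d + Y`: the number of marked elements is
at most `r` with probability at least `1 / (m + 1)` if its mode is at most `r`. -/
theorem choose_add_le_mul_binomSum {d Y m r : ℕ} (hY : m ≤ Y) (h : d * m ≤ r * (Y - m)) :
    (d + Y).choose m ≤
      (m + 1) * binomSum d fun n => if n ≤ r ∧ n ≤ m then Y.choose (m - n) else 0 := by
  set t : ℕ → ℕ := fun n => d.choose n * Y.choose (m - n) with ht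
  -- Beyond `r` the terms of Vandermonde's sum decrease.
  have hstep : ∀ n, r ≤ n → n < m → t (n + 1) ≤ t n := by
    intro n hrn hnm
    obtain ⟨p, hp⟩ : ∃ p, m - n = p + 1 := ⟨m - n - 1, by omega⟩
    have hp' : m - (n + 1) = p := by omega
    simp only [ht, hp, hp']
    have h1 : d.choose (n + 1) * (n + 1) = d.choose n * (d - n) := Nat.choose_succ_right_eq d n
    have h2 : Y.choose (p + 1) * (p + 1) = Y.choose p * (Y - p) := Nat.choose_succ_right_eq Y p
    have h3 : (d - n) * (p + 1) ≤ (n + 1) * (Y - p) := by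
      calc (d - n) * (p + 1) ≤ d * m := Nat.mul_le_mul (by omega) (by omega)
        _ ≤ r * (Y - m) := h
        _ ≤ (n + 1) * (Y - p) := Nat.mul_le_mul (by omega) (by omega)
    have h4 : 0 < (n + 1) * (Y - p) := Nat.mul_pos (by omega) (by omega)
    refine Nat.le_of_mul_le_mul_right ?_ h4
    calc d.choose (n + 1) * Y.choose p * ((n + 1) * (Y - p))
        = (d.choose (n + 1) * (n + 1)) * (Y.choose p * (Y - p)) := by ring
      _ = d.choose n * Y.choose (p + 1) * ((d - n) * (p + 1)) := by rw [h1, ← h2]; ring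
      _ ≤ _ := Nat.mul_le_mul_left _ h3
  set s : ℕ := binomSum d fun n => if n ≤ r ∧ n ≤ m then Y.choose (m - n) else 0 with hs
  have hsmall : ∀ n, n ≤ r → n ≤ m → t n ≤ s := by
    intro n hn hm
    by_cases hnd : n ≤ d
    · rw [hs, binomSum]
      refine le_trans (le_of_eq ?_) (Finset.single_le_sum
        (f := fun n => d.choose n * if n ≤ r ∧ n ≤ m then Y.choose (m - n) else 0)
        (fun _ _ => Nat.zero_le _) (Finset.mem_range_succ_iff.2 hnd))
      simp [ht, hn, hm]
    · simp [ht, Nat.choose_eq_zero_of_lt (not_le.1 hnd)]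
  have hall : ∀ n ≤ m, t n ≤ s := by
    intro n hn
    by_cases hnr : n ≤ r
    · exact hsmall n hnr hn
    · have : ∀ j, r + j ≤ m → t (r + j) ≤ t r := by
        intro j
        induction j with
        | zero => exact fun _ => le_rfl
        | succ j ih => exact fun hj => (hstep (r + j) (by omega) (by omega)).trans (ih (by omega))
      have h1 := this (n - r) (by omega)
      rw [show r + (n - r) = n by omega] at h1
      exact h1.trans (hsmall r le_rfl (by omega))
  rw [Nat.add_choose_eq, Finset.Nat.sum_antidiagonal_eq_sum_range_succ_mk]
  refine (Finset.sum_le_card_nsmul _ _ s fun n hn => hall n (Finset.mem_range_succ_iff.1 hn)).trans ?_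
  simp

/-- `exploreCount c W m a q g` is the number of ways to explore a set of `m` elements in `a` more
steps, after which a queue has to be empty. At present `g` elements of the set are known and the
queue has length `q`. The step that leaves `i` steps to do reveals which elements of a class of
size `c i` belong to the set; if there are `n`, the queue loses one element (if it has any) and
receives `n`. In the end the set is completed out of the remaining `W` elements. -/
def exploreCount (c : ℕ → ℕ) (W m : ℕ) : ℕ → ℕ → ℕ → ℕ
  | 0, q, g => if q = 0 ∧ g ≤ m then W.choose (m - g) else 0
  | a + 1, q, g => binomSum (c a) fun n => exploreCount c W m a (q - 1 + n) (g + n)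

section explore

variable {c : ℕ → ℕ} {W m : ℕ}

theorem exploreCount_anti {a q q' g : ℕ} (h : q ≤ q') :
    exploreCount c W m a q' g ≤ exploreCount c W m a q g := by
  induction a generalizing q q' g with
  | zero =>
    simp only [exploreCount]
    split_ifs <;> omega
  | succ a ih => exact binomSum_mono fun n _ => ih (by omega)

/-- After `a` steps, a queue that had at most `a` elements holds at most those that arrived. -/
theorem binomSum_le_exploreCount (a b q g : ℕ) :
    (binomSum (∑ i ∈ Finset.range a, c (b + i)) fun n =>
      exploreCount c W m b (q - a + n) (g + n)) ≤ exploreCount c W m (a + b) q g := by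
  induction a generalizing q g with
  | zero => simp [binomSum_zero]
  | succ a ih =>
    rw [show a + 1 + b = (a + b) + 1 by ring, exploreCount, Finset.sum_range_succ,
      add_comm _ (c (b + a)), add_comm a b, binomSum_add]
    refine binomSum_mono fun n _ => ?_
    rw [add_comm b a]
    refine le_trans (binomSum_mono fun n' _ => ?_) (ih (q - 1 + n) (g + n))
    rw [add_assoc g]
    exact exploreCount_anti (by omega)

/-- Exploration by blocks of `r` steps: in each block but the last one at most `r` elements are
revealed, and in the last block none. -/
theorem choose_le_mul_exploreCount {r : ℕ} (hW : m ≤ W) {K : ℕ}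
    (hc : ∀ i < (K + 1) * r, c i * m ≤ W - m) {q g : ℕ} (hq : q ≤ r) (hg : g ≤ m) :
    (∑ i ∈ Finset.range (K * r), c (r + i) + W).choose (m - g) ≤
      (m + 1) ^ K * exploreCount c W m ((K + 1) * r) q g := by
  induction K generalizing q g with
  | zero =>
    have h := binomSum_le_exploreCount (c := c) (W := W) (m := m) r 0 q g
    rw [add_zero] at h
    simp only [zero_mul, Finset.range_zero, Finset.sum_empty, zero_add, pow_zero, one_mul]
    refine le_trans ?_ h
    rw [binomSum, Finset.sum_range_succ']
    refine le_trans ?_ (Nat.le_add_left _ _)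
    simp [exploreCount, hg, Nat.sub_eq_zero_of_le hq]
  | succ K ih =>
    have ih' := fun {q g : ℕ} hq hg => ih (fun i hi => hc i (hi.trans_le (by gcongr; omega)))
      (q := q) (g := g) hq hg
    set Y := ∑ i ∈ Finset.range (K * r), c (r + i) + W with hY
    set d := ∑ i ∈ Finset.range r, c ((K + 1) * r + i) with hd
    have hsum : ∑ i ∈ Finset.range ((K + 1) * r), c (r + i) + W = d + Y := by
      rw [hY, hd, add_mul, one_mul, Finset.sum_range_add]
      have : ∀ i, r + (K * r + i) = K * r + r + i := fun i => by ring
      simp only [this]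
      ring
    rw [hsum]
    have hdm : d * (m - g) ≤ r * (Y - (m - g)) := by
      calc d * (m - g) ≤ d * m := Nat.mul_le_mul_left _ (Nat.sub_le _ _)
        _ = ∑ i ∈ Finset.range r, c ((K + 1) * r + i) * m := by rw [hd, Finset.sum_mul]
        _ ≤ ∑ i ∈ Finset.range r, (W - m) := by
            refine Finset.sum_le_sum fun i hi => hc _ ?_
            rw [Finset.mem_range] at hi
            rw [add_mul (K + 1), one_mul]
            omega
        _ = r * (W - m) := by simp
        _ ≤ _ := Nat.mul_le_mul_left _ (by omega)
    refine (choose_add_le_mul_binomSum (by omega) hdm).trans ?_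
    have h1 := binomSum_le_exploreCount (c := c) (W := W) (m := m) r ((K + 1) * r) q g
    rw [show r + (K + 1) * r = (K + 1 + 1) * r by ring, ← hd, Nat.sub_eq_zero_of_le hq] at h1
    calc _ ≤ (m + 1) * binomSum d fun n => (m + 1) ^ K *
          exploreCount c W m ((K + 1) * r) (0 + n) (g + n) := by
          refine Nat.mul_le_mul (by omega) (binomSum_mono fun n _ => ?_)
          split_ifs with h
          · rw [Nat.sub_sub, zero_add]
            exact ih' h.1 (by omega)
          · exact Nat.zero_le _
      _ ≤ _ := by
          rw [mul_binomSum, pow_succ' (m + 1) K, mul_assoc]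
          gcongr

end explore

/-! ### Exploring the propagating clauses along a walk -/

/-- The clauses that start to force a variable outside `S ∪ {y}` when `y` is added to `S`. -/
def stepClauses {N : ℕ} (k : ℕ) (σ : Fin N → Bool) (S : Finset (Fin N)) (y : Fin N) :
    Finset (Clause N) :=
  ((insert y S)ᶜ ×ˢ S.powersetCard (k - 2)).image fun q => oneClause σ q.1 (insert y q.2)

/-- The number of clauses that are explored in the step after `j` variables have been set: such a
clause forces one of the other `N - (j + 1)` variables, and its false literals are those of the new
variable and of `k - 2` of the `j` old ones. -/
def stepCount (k N j : ℕ) : ℕ := (N - (j + 1)) * j.choose (k - 2)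

section adaptive

variable {N k M : ℕ} {σ : Fin N → Bool}

theorem card_stepClauses {S : Finset (Fin N)} {y : Fin N} (hy : y ∉ S) :
    (stepClauses k σ S y).card = stepCount k N S.card := by
  rw [stepClauses, Finset.card_image_of_injOn]
  · rw [Finset.card_product, Finset.card_powersetCard, Finset.card_compl, Fintype.card_fin,
      Finset.card_insert_of_notMem hy, stepCount]
  · rintro ⟨z, V⟩ hq ⟨z', V'⟩ hq' h
    rw [Finset.mem_coe, Finset.mem_product, Finset.mem_compl, Finset.mem_powersetCard] at hq hq'
    have hz : z ∉ insert y V := fun h => hq.1 (Finset.insert_subset_insert y hq.2.1 h)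
    have hz' : z' ∉ insert y V' := fun h => hq'.1 (Finset.insert_subset_insert y hq'.2.1 h)
    obtain ⟨h1, h2⟩ := oneClause_inj hz hz' h
    have hyV : y ∉ V := fun h => hy (hq.2.1 h)
    have hyV' : y ∉ V' := fun h => hy (hq'.2.1 h)
    rw [h1, ← Finset.erase_insert hyV, h2, Finset.erase_insert hyV']

/-- What is known about the exploration when the variables in `S` are set: `R` is the set of
clauses that have been examined. -/
structure Explored (k : ℕ) (σ : Fin N → Bool) (S : Finset (Fin N)) (R : Finset (Clause N)) :
    Prop where
  subset : R ⊆ kClauses k N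
  form : ∀ c ∈ R, ∃ z, ∃ V ⊆ S, z ∉ V ∧ c = oneClause σ z V
  complete : ∀ z ∉ S, ∀ V ⊆ S, oneClause σ z V ∈ kClauses k N → oneClause σ z V ∈ R
  card : R.card = ∑ j ∈ Finset.range S.card, stepCount k N j

theorem explored_empty (hk : 2 ≤ k) : Explored k σ ∅ ∅ where
  subset := Finset.empty_subset _
  form := by simp
  complete := by
    intro z _ V hV h
    rw [Finset.subset_empty.1 hV, oneClause_mem_kClauses (Finset.notMem_empty z)] at h
    simp at h
    omega
  card := by simp

variable {S : Finset (Fin N)} {R : Finset (Clause N)}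

theorem Explored.disjoint_stepClauses (h : Explored k σ S R) {y : Fin N} (hy : y ∉ S) :
    Disjoint R (stepClauses k σ S y) := by
  rw [Finset.disjoint_left]
  intro c hc hc'
  obtain ⟨z, V, hV, hz, rfl⟩ := h.form c hc
  obtain ⟨⟨z', V'⟩, hq, he⟩ := Finset.mem_image.1 hc'
  rw [Finset.mem_product, Finset.mem_compl, Finset.mem_powersetCard] at hq
  have hz' : z' ∉ insert y V' := fun h => hq.1 (Finset.insert_subset_insert y hq.2.1 h)
  have h2 := (oneClause_inj hz' hz he).2
  exact hy (hV (h2 ▸ Finset.mem_insert_self _ _))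

theorem stepClauses_subset (hk : 2 ≤ k) {y : Fin N} (hy : y ∉ S) :
    stepClauses k σ S y ⊆ kClauses k N := by
  intro c hc
  obtain ⟨⟨z', V'⟩, hq, rfl⟩ := Finset.mem_image.1 hc
  rw [Finset.mem_product, Finset.mem_compl, Finset.mem_powersetCard] at hq
  have hz' : z' ∉ insert y V' := fun h => hq.1 (Finset.insert_subset_insert y hq.2.1 h)
  rw [oneClause_mem_kClauses hz', Finset.card_insert_of_notMem (fun h => hy (hq.2.1 h)), hq.2.2]
  omega

theorem Explored.add_step (hk : 2 ≤ k) (h : Explored k σ S R) {y : Fin N} (hy : y ∉ S) :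
    Explored k σ (insert y S) (R ∪ stepClauses k σ S y) where
  subset := Finset.union_subset h.subset (stepClauses_subset hk hy)
  form := by
    intro c hc
    rcases Finset.mem_union.1 hc with hc | hc
    · obtain ⟨z, V, hV, hz, he⟩ := h.form c hc
      exact ⟨z, V, hV.trans (Finset.subset_insert _ _), hz, he⟩
    · obtain ⟨⟨z', V'⟩, hq, rfl⟩ := Finset.mem_image.1 hc
      rw [Finset.mem_product, Finset.mem_compl, Finset.mem_powersetCard] at hq
      exact ⟨z', insert y V', Finset.insert_subset_insert y hq.2.1,
        fun h => hq.1 (Finset.insert_subset_insert y hq.2.1 h), rfl⟩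
  complete := by
    intro z hz V hV hc
    rw [Finset.mem_union]
    by_cases hyV : y ∈ V
    · right
      have hVS : V.erase y ⊆ S := by
        rw [← Finset.subset_insert_iff]
        exact hV
      have hcard := (oneClause_mem_kClauses fun h => hz (hV h)).1 hc
      refine Finset.mem_image.2 ⟨(z, V.erase y), ?_, ?_⟩
      · rw [Finset.mem_product, Finset.mem_compl, Finset.mem_powersetCard]
        refine ⟨hz, hVS, ?_⟩
        rw [Finset.card_erase_of_mem hyV]
        omega
      · simp only [Finset.insert_erase hyV]
    · left
      refine h.complete z (fun h => hz (Finset.mem_insert_of_mem h)) V ?_ hc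
      exact (Finset.subset_insert_iff_of_notMem hyV).1 hV
  card := by
    rw [Finset.card_union_of_disjoint (h.disjoint_stepClauses hy), h.card, card_stepClauses hy,
      Finset.card_insert_of_notMem hy, Finset.sum_range_succ]

theorem Explored.forced_sdiff (h : Explored k σ S R) {F : Formula N} (hF : F ⊆ kClauses k N) :
    forced σ F S \ S = forced σ (F ∩ R) S \ S := by
  ext z
  simp only [Finset.mem_sdiff, mem_forced, Finset.mem_inter]
  refine and_congr_left fun hz => exists_congr fun V => and_congr_right fun hV => ?_
  exact ⟨fun hc => ⟨hc, h.complete z hz V hV (hF hc)⟩, fun hc => hc.1⟩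

theorem Explored.card_forced_insert_le (h : Explored k σ S R) {G H : Finset (Clause N)}
    (hG : G ⊆ R) {y : Fin N} {q : ℕ} (hq : (forced σ G S \ S).card ≤ q)
    (hy : y ∈ forced σ G S \ S ∨ forced σ G S \ S = ∅) :
    (forced σ (G ∪ H) (insert y S) \ insert y S).card ≤ q - 1 + H.card := by
  classical
  set P := (forced σ (G ∪ H) (insert y S) \ insert y S) with hP
  have hsub : P ⊆ (forced σ G S \ S).erase y ∪
      P.filter fun z => ∃ V ⊆ insert y S, oneClause σ z V ∈ H := by
    intro z hz
    have hz' := hz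
    rw [hP, Finset.mem_sdiff, mem_forced] at hz'
    obtain ⟨⟨V, hV, hc⟩, hzS⟩ := hz'
    rw [Finset.mem_union, Finset.mem_filter]
    rcases Finset.mem_union.1 hc with hc | hc
    · left
      obtain ⟨z', V', hV', hzV', he⟩ := h.form _ (hG hc)
      obtain ⟨rfl, rfl⟩ := oneClause_inj (fun h => hzS (hV h)) hzV' he
      rw [Finset.mem_insert, not_or] at hzS
      exact Finset.mem_erase.2 ⟨hzS.1, Finset.mem_sdiff.2 ⟨mem_forced.2 ⟨V, hV', hc⟩, hzS.2⟩⟩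
    · exact Or.inr ⟨hz, V, hV, hc⟩
  have hnew : (P.filter fun z => ∃ V ⊆ insert y S, oneClause σ z V ∈ H).card ≤ H.card := by
    have hex : ∀ z ∈ P.filter fun z => ∃ V ⊆ insert y S, oneClause σ z V ∈ H,
        ∃ V, V ⊆ insert y S ∧ oneClause σ z V ∈ H := fun z hz => (Finset.mem_filter.1 hz).2
    choose! V hV hVH using hex
    refine Finset.card_le_card_of_injOn (fun z => oneClause σ z (V z)) hVH ?_
    intro z hz z' hz' he
    have hnot : ∀ z ∈ P.filter fun z => ∃ V ⊆ insert y S, oneClause σ z V ∈ H, z ∉ V z := by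
      intro z hz hzV
      exact (Finset.mem_sdiff.1 (Finset.mem_filter.1 hz).1).2 (hV z hz hzV)
    exact (oneClause_inj (hnot z hz) (hnot z' hz') he).1
  have hold : ((forced σ G S \ S).erase y).card ≤ q - 1 := by
    rcases hy with hy | hy
    · rw [Finset.card_erase_of_mem hy]
      omega
    · simp [hy]
  exact (Finset.card_le_card hsub).trans ((Finset.card_union_le _ _).trans (add_le_add hold hnew))

theorem hit_eq_min {p : Finset (Fin N) → Finset (Fin N)} {φ : Finset (Fin N) → ℝ≥0∞}
    {Q : Finset (Fin N)} (hQ : p S \ S = Q) (h : Q.Nonempty) :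
    hit p φ S = hit p φ (insert (Q.min' h) S) := by
  subst hQ
  rw [hit, dif_pos h]

open scoped Classical in
/-- Deferred decisions: each step of the walk reveals which clauses of a class of known size belong
to the instance, and nothing else about the clauses that have not been examined. So the number of
instances with a favourable walk is at least what it would be if the classes were fixed. -/
theorem exploreCount_le_sum_hit (hk : 2 ≤ k) {T : ℕ} (hT : T ≤ N) (hM : 2 ≤ M) {W : ℕ}
    (hW : W + ∑ j ∈ Finset.range T, stepCount k N j + 2 + numBlocking k N T = N.choose k * 2 ^ k)
    (E : Finset (Fin N) → Finset (Clause N)) (hE : ∀ C, C.card = T → E C ⊆ kClauses k N)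
    (hE2 : ∀ C, C.card = T → (E C).card = 2)
    (hEB : ∀ C, C.card = T → Disjoint (E C) (blockingClauses k σ C))
    (hER : ∀ C, C.card = T → ∀ z, ∀ V ⊆ C, z ∉ V → oneClause σ z V ∉ E C)
    {a : ℕ} (ha : S.card + a = T) (hS : Explored k σ S R) {G : Finset (Clause N)} (hG : G ⊆ R)
    {q : ℕ} (hq : (forced σ G S \ S).card ≤ q) :
    (exploreCount (fun i => stepCount k N (T - (i + 1))) W (M - 2) a q G.card : ℝ≥0∞) ≤
      ∑ F ∈ (instances k N M).filter fun F => F ∩ R = G, hit (forced σ F)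
        (fun C => if C.card = T ∧ E C ⊆ F ∧ Disjoint F (blockingClauses k σ C) then 1 else 0) S := by
  induction a generalizing S R G q with
  | zero =>
    rw [exploreCount]
    rw [add_zero] at ha
    split_ifs with hqg
    · obtain ⟨rfl, hg⟩ := hqg
      have hcount := card_filter_powersetCard (X := kClauses k N) (R := R) (G := G) (E := E S)
        (B := blockingClauses k σ S) (M := M) hG hS.subset (hE S ha)
        ((blockingClauses_subset S).trans zeroClauses_subset) ?_ ?_ (hEB S ha)
        (by rw [hE2 S ha]; omega)
      · rw [card_kClauses, hS.card, hE2 S ha, card_blockingClauses (by omega), ha, ← hW] at hcount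
        have h1 : W + ∑ j ∈ Finset.range T, stepCount k N j + 2 + numBlocking k N T -
          ∑ j ∈ Finset.range T, stepCount k N j - 2 - numBlocking k N T = W := by omega
        rw [h1, show M - (G.card + 2) = M - 2 - G.card by omega] at hcount
        rw [← hcount, Finset.card_eq_sum_ones, Nat.cast_sum]
        have hfil : ((kClauses k N).powersetCard M).filter
            (fun F => F ∩ R = G ∧ E S ⊆ F ∧ Disjoint F (blockingClauses k σ S)) =
            ((instances k N M).filter fun F => F ∩ R = G).filter
              fun F => E S ⊆ F ∧ Disjoint F (blockingClauses k σ S) := by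
          rw [Finset.filter_filter, instances]
        rw [hfil, Finset.sum_filter]
        refine Finset.sum_le_sum fun F hF => ?_
        rw [Finset.mem_filter] at hF
        have hclosed : forced σ F S ⊆ S := by
          rw [← Finset.sdiff_eq_empty_iff_subset,
            hS.forced_sdiff (Finset.mem_powersetCard.1 hF.1).1, hF.2]
          exact Finset.card_eq_zero.1 (Nat.le_zero.1 hq)
        rw [hit_of_closed hclosed]
        refine le_add_right ?_
        by_cases hE : E S ⊆ F ∧ Disjoint F (blockingClauses k σ S) <;> simp [hE, ha]
      · rw [Finset.disjoint_left]
        intro c hc hcE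
        obtain ⟨z, V, hV, hz, rfl⟩ := hS.form c hc
        exact hER S ha z V hV hz hcE
      · rw [Finset.disjoint_left]
        intro c hc hcB
        obtain ⟨z, V, hV, hz, rfl⟩ := hS.form c hc
        obtain ⟨V', -, h⟩ := Finset.mem_image.1 hcB
        exact oneClause_ne_zeroClause _ _ _ h.symm
    · simp
  | succ a ih =>
    set c : ℕ → ℕ := fun i => stepCount k N (T - (i + 1)) with hc
    -- One step, which adds the variable `y`.
    have hstep : ∀ y ∉ S, (y ∈ forced σ G S \ S ∨ forced σ G S \ S = ∅) →
        (exploreCount c W (M - 2) (a + 1) q G.card : ℝ≥0∞) ≤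
        ∑ F ∈ (instances k N M).filter fun F => F ∩ R = G, hit (forced σ F)
        (fun C => if C.card = T ∧ E C ⊆ F ∧ Disjoint F (blockingClauses k σ C) then 1 else 0)
          (insert y S) := by
      intro y hy hyf
      have hdisj := hS.disjoint_stepClauses hy
      have hcard : (stepClauses k σ S y).card = c a := by
        rw [card_stepClauses hy, hc]
        congr 1
        omega
      rw [← Finset.sum_fiberwise_of_maps_to (t := (stepClauses k σ S y).powerset)
        (g := fun F => F ∩ stepClauses k σ S y)
        (fun F _ => Finset.mem_powerset.2 Finset.inter_subset_right)]
      have hB : exploreCount c W (M - 2) (a + 1) q G.card =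
          ∑ H ∈ (stepClauses k σ S y).powerset,
            exploreCount c W (M - 2) a (q - 1 + H.card) (G.card + H.card) := by
        rw [Finset.sum_powerset_apply_card
          (fun n => exploreCount c W (M - 2) a (q - 1 + n) (G.card + n)), hcard]
        simp only [exploreCount, binomSum, smul_eq_mul]
      rw [hB, Nat.cast_sum]
      refine Finset.sum_le_sum fun H hH => ?_
      rw [Finset.mem_powerset] at hH
      have hGH : Disjoint G H := Finset.disjoint_of_subset_left hG
        (Finset.disjoint_of_subset_right hH hdisj)
      have hfil : ((instances k N M).filter fun F => F ∩ R = G).filter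
          (fun F => F ∩ stepClauses k σ S y = H) =
          (instances k N M).filter fun F => F ∩ (R ∪ stepClauses k σ S y) = G ∪ H := by
        rw [Finset.filter_filter]
        refine Finset.filter_congr fun F _ => ?_
        rw [Finset.inter_union_distrib_left]
        constructor
        · rintro ⟨h1, h2⟩
          rw [h1, h2]
        · intro h
          have hdl := Finset.disjoint_left.1 hdisj
          constructor
          · ext x
            have := Finset.ext_iff.1 h x
            simp only [Finset.mem_union, Finset.mem_inter] at this ⊢
            have h1 := @hdl x
            have h2 := @hG x
            have h3 := @hH x
            grind
          · ext x
            have := Finset.ext_iff.1 h x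
            simp only [Finset.mem_union, Finset.mem_inter] at this ⊢
            have h1 := @hdl x
            have h2 := @hG x
            have h3 := @hH x
            grind
      rw [hfil, ← Finset.card_union_of_disjoint hGH]
      refine ih ?_ (hS.add_step hk hy) (Finset.union_subset_union hG hH)
        (hS.card_forced_insert_le hG hq hyf)
      rw [Finset.card_insert_of_notMem hy]
      omega
    have hforced : ∀ F ∈ (instances k N M).filter fun F => F ∩ R = G,
        forced σ F S \ S = forced σ G S \ S := by
      intro F hF
      rw [Finset.mem_filter] at hF
      rw [hS.forced_sdiff (Finset.mem_powersetCard.1 hF.1).1, hF.2]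
    rcases (forced σ G S \ S).eq_empty_or_nonempty with h0 | hne
    · have hclosed : ∀ F ∈ (instances k N M).filter fun F => F ∩ R = G, forced σ F S ⊆ S := by
        intro F hF
        rw [← Finset.sdiff_eq_empty_iff_subset, hforced F hF, h0]
      rw [Finset.sum_congr rfl fun F hF => hit_of_closed (hclosed F hF), Finset.sum_add_distrib]
      refine le_add_left ?_
      simp only [ENNReal.div_eq_inv_mul]
      rw [← Finset.mul_sum, Finset.sum_comm, ← ENNReal.div_eq_inv_mul]
      refine le_avg _ ?_ _ fun y hy => hstep y (Finset.mem_compl.1 hy) (Or.inr h0)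
      rw [← Finset.card_pos, Finset.card_compl, Fintype.card_fin]
      omega
    · rw [Finset.sum_congr rfl fun F hF => hit_eq_min (hforced F hF) hne]
      have hmem := Finset.min'_mem _ hne
      exact hstep _ (Finset.mem_sdiff.1 hmem).2 (Or.inl hmem)

/-- The clauses explored during a walk are at most as numerous as the sets of `k` variables: in a
linear order, `j` is the second largest element. -/
theorem sum_stepCount_le (hk : 2 ≤ k) {T : ℕ} (hT : T ≤ N) :
    ∑ j ∈ Finset.range T, stepCount k N j ≤ N.choose k := by
  obtain ⟨l, rfl⟩ : ∃ l, k = l + 2 := ⟨k - 2, by omega⟩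
  refine (Finset.sum_le_sum_of_subset (Finset.range_subset_range.2 hT)).trans (le_of_eq ?_)
  clear hT
  have h1 : ∀ N : ℕ, ∑ j ∈ Finset.range N, j.choose l = N.choose (l + 1) := by
    intro N
    induction N with
    | zero => simp
    | succ N ih => rw [Finset.sum_range_succ, ih, Nat.choose_succ_succ, add_comm]
  induction N with
  | zero => simp
  | succ N ih =>
    rw [Finset.sum_range_succ, Nat.choose_succ_succ' N (l + 1), ← ih, ← h1 N,
      ← Finset.sum_add_distrib]
    simp only [stepCount, Nat.add_sub_cancel, Nat.sub_self, zero_mul, add_zero]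
    refine Finset.sum_congr rfl fun j hj => ?_
    rw [Finset.mem_range] at hj
    rw [show N + 1 - (j + 1) = 1 + (N - (j + 1)) by omega, add_mul, one_mul]

/-- A lower bound for the expected number of contradiction leaves, from the walks that pass through
a split after `(K + 1) * r` steps. -/
theorem le_expectation_contradictionLeaves_of_step {rule : UnitRule N} (hk : 3 ≤ k)
    {K r W : ℕ} (hT : (K + 1) * r + 2 ≤ N) (hkT : k ≤ (K + 1) * r + 2) (hM : 2 ≤ M)
    (hW : W + ∑ j ∈ Finset.range ((K + 1) * r), stepCount k N j + 2 +
      numBlocking k N ((K + 1) * r) = N.choose k * 2 ^ k)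
    (hstep : ∀ j < (K + 1) * r, stepCount k N j * M + M ≤ W) :
    (2 : ℝ≥0∞) ^ ((K + 1) * r) * (N : ℝ≥0∞)⁻¹ *
      (((N.choose k * 2 ^ k - 2 - (numBlocking k N ((K + 1) * r) +
          ∑ i ∈ Finset.range r, stepCount k N (K * r + i))).choose (M - 2) : ℕ) *
        (((M + 1) ^ K : ℕ) : ℝ≥0∞)⁻¹) / ((N.choose k * 2 ^ k).choose M : ℕ) ≤
      expectation k N M rule SearchTree.contradictionLeaves := by
  classical
  set T := (K + 1) * r with hTdef
  have hex : ∀ C : Finset (Fin N), C.card = T →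
      ∃ x y : Fin N, ∃ V ⊆ C, x ≠ y ∧ x ∉ C ∧ y ∉ C ∧ V.card = k - 2 := fun C hC =>
    exists_unset_pair hT hkT hC
  have : Nonempty (Fin N) := ⟨⟨0, by omega⟩⟩
  choose! x y V hV hxy hx hy hVc using hex
  refine le_expectation isLeafCount_contradictionLeaves (T := T) (by omega)
    (fun σ C F => F ⊆ kClauses k N ∧ C.card = T ∧ contradictingPair σ (x C) (y C) (V C) ⊆ F ∧
      Disjoint F (blockingClauses k σ C)) ?_ ?_ ?_
  · rintro σ C F ⟨hF, hC, hE, hB⟩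
    refine ⟨hC, fun h => (blocked_iff hF).1 h hB, fun h => ?_⟩
    rw [residualFormula_eq_empty] at h
    obtain ⟨l, hl, h'⟩ := h _ (hE (by simp [contradictingPair] :
      zeroClause σ (insert (y C) (insert (x C) (V C))) ∈ _))
    rw [restrict_eq_some, (mem_zeroClause.1 hl).2] at h'
    simp at h'
  · rintro σ C F ⟨hF, hC, hE, -⟩ h₂ h₃
    exact inv_le_value_contradictionLeaves (hx C hC) (hy C hC) (hxy C hC) (hV C hC)
      (hE (by simp [contradictingPair])) (hE (by simp [contradictingPair])) h₂ h₃
  · intro σ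
    have hyV : ∀ C, C.card = T → y C ∉ insert (x C) (V C) := fun C hC => by
      rw [Finset.mem_insert, not_or]
      exact ⟨(hxy C hC).symm, fun h => hy C hC (hV C hC h)⟩
    have hsum := exploreCount_le_sum_hit (σ := σ) (k := k) (M := M) (by omega) (T := T) (by omega)
      hM hW (fun C => contradictingPair σ (x C) (y C) (V C))
      (fun C hC => contradictingPair_subset (by omega) (hxy C hC) (fun h => hx C hC (hV C hC h))
        (fun h => hy C hC (hV C hC h)) (hVc C hC))
      (fun C hC => card_contradictingPair)
      (fun C hC => disjoint_contradictingPair_blockingClauses (hxy C hC) (hx C hC) (hy C hC))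
      ?_ (S := ∅) (a := T) (by simp) (explored_empty (by omega)) (G := ∅) le_rfl (q := 0)
      (by
        have : forced σ (∅ : Formula N) ∅ = ∅ := by
          ext z
          simp [mem_forced]
        simp [this])
    · rw [Finset.card_empty] at hsum
      have hfil : (instances k N M).filter (fun F => F ∩ ∅ = ∅) = instances k N M :=
        Finset.filter_true_of_mem fun F _ => Finset.inter_empty F
      rw [hfil] at hsum
      refine le_trans ?_ (hsum.trans (le_of_eq (Finset.sum_congr rfl fun F hF => ?_)))
      · have hM2 : M - 2 ≤ M := Nat.sub_le _ _
        have hr : 0 < r := by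
          rcases Nat.eq_zero_or_pos r with h | h
          · rw [hTdef, h] at hkT
            omega
          · exact h
        have hTpos : 0 < T := by
          rw [hTdef]
          positivity
        have h1 := choose_le_mul_exploreCount (c := fun i => stepCount k N (T - (i + 1))) (W := W)
          (m := M - 2) (r := r) (K := K) (by have := hstep 0 hTpos; omega) ?_
          (q := 0) (g := 0) (Nat.zero_le _) (Nat.zero_le _)
        · have h2 : N.choose k * 2 ^ k - 2 - (numBlocking k N T +
              ∑ i ∈ Finset.range r, stepCount k N (K * r + i)) =
              ∑ i ∈ Finset.range (K * r), stepCount k N (T - (r + i + 1)) + W := by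
            have h3 : ∑ i ∈ Finset.range (K * r), stepCount k N (T - (r + i + 1)) =
                ∑ i ∈ Finset.range (K * r), stepCount k N i := by
              rw [← Finset.sum_range_reflect]
              refine Finset.sum_congr rfl fun i hi => ?_
              rw [Finset.mem_range] at hi
              congr 1
              rw [hTdef, add_mul, one_mul]
              omega
            have h4 : ∑ j ∈ Finset.range T, stepCount k N j =
                ∑ i ∈ Finset.range (K * r), stepCount k N i +
                  ∑ i ∈ Finset.range r, stepCount k N (K * r + i) := by
              rw [hTdef, add_mul, one_mul, Finset.sum_range_add]
            omega
          rw [h2]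
          refine ENNReal.div_le_of_le_mul ?_
          refine le_trans ?_ (Nat.cast_le (α := ℝ≥0∞).2 (h1.trans (Nat.mul_le_mul_right _
            (Nat.pow_le_pow_left (by omega : M - 2 + 1 ≤ M + 1) K)))) |>.trans
            (le_of_eq ((Nat.cast_mul _ _).trans (mul_comm _ _)))
          rw [Nat.sub_zero]
        · intro i hi
          have h5 := hstep (T - (i + 1)) (by omega)
          have h6 : stepCount k N (T - (i + 1)) * (M - 2) ≤ stepCount k N (T - (i + 1)) * M :=
            Nat.mul_le_mul_left _ hM2
          omega
      · simp only [(Finset.mem_powersetCard.1 hF).1, true_and]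
    · intro C hC z W' hW' hz h
      rw [contradictingPair, Finset.mem_insert, Finset.mem_singleton] at h
      rcases h with h | h
      · have := (oneClause_inj hz (hyV C hC) h).2
        exact hx C hC (hW' (this ▸ Finset.mem_insert_self _ _))
      · exact oneClause_ne_zeroClause _ _ _ h

end adaptive

/-! ### The exponent as a function of the depth -/

/-- The probability that a clause with `k` literals does not block a set that contains the
proportion `t` of the variables. -/
noncomputable def survival (k : ℕ) (t : ℝ) : ℝ :=
  1 - (k : ℝ) / 2 ^ k * t ^ (k - 1) + ((k : ℝ) - 1) / 2 ^ k * t ^ k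

theorem Omega_eq (t α : ℝ) (k : ℕ) : Omega t α k = t + α * Real.logb 2 (survival k t) := rfl

section calculus

variable {k : ℕ}

theorem hasDerivAt_survival (hk : 3 ≤ k) (t : ℝ) :
    HasDerivAt (survival k)
      (-((k : ℝ) * ((k : ℝ) - 1) / 2 ^ k * (t ^ (k - 2) - t ^ (k - 1)))) t := by
  obtain ⟨l, rfl⟩ : ∃ l, k = l + 3 := ⟨k - 3, by omega⟩
  have h1 := (hasDerivAt_pow (l + 2) t).const_mul (((l + 3 : ℕ) : ℝ) / 2 ^ (l + 3))
  have h2 := (hasDerivAt_pow (l + 3) t).const_mul ((((l + 3 : ℕ) : ℝ) - 1) / 2 ^ (l + 3))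
  have h3 := (h1.const_sub 1).add h2
  refine h3.congr_deriv ?_
  simp only [show l + 3 - 2 = l + 1 by omega, show l + 3 - 1 = l + 2 by omega,
    show l + 2 - 1 = l + 1 by omega]
  push_cast
  ring

theorem continuous_survival (hk : 3 ≤ k) : Continuous (survival k) :=
  continuous_iff_continuousAt.2 fun t => (hasDerivAt_survival hk t).continuousAt

theorem pow_sub_pow_nonneg (hk : 3 ≤ k) {t : ℝ} (ht : t ∈ Set.Icc (0 : ℝ) 1) :
    0 ≤ t ^ (k - 2) - t ^ (k - 1) :=
  sub_nonneg.2 (pow_le_pow_of_le_one ht.1 ht.2 (by omega))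

theorem antitoneOn_survival (hk : 3 ≤ k) : AntitoneOn (survival k) (Set.Icc 0 1) := by
  refine antitoneOn_of_deriv_nonpos (convex_Icc 0 1) (continuous_survival hk).continuousOn
    (fun t _ => (hasDerivAt_survival hk t).differentiableAt.differentiableWithinAt) fun t ht => ?_
  rw [interior_Icc] at ht
  rw [(hasDerivAt_survival hk t).deriv, neg_nonpos]
  have h1 := pow_sub_pow_nonneg hk (Set.Ioo_subset_Icc_self ht)
  have h2 : (0 : ℝ) ≤ (k : ℝ) - 1 := by
    have : (3 : ℝ) ≤ k := by exact_mod_cast hk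
    linarith
  positivity

theorem survival_one (k : ℕ) : survival k 1 = 1 - 1 / 2 ^ k := by
  simp only [survival, one_pow]
  ring

theorem survival_zero (hk : 3 ≤ k) : survival k 0 = 1 := by
  simp only [survival]
  rw [zero_pow (by omega), zero_pow (by omega)]
  ring

theorem le_survival (hk : 3 ≤ k) {t : ℝ} (ht : t ∈ Set.Icc (0 : ℝ) 1) : 7 / 8 ≤ survival k t := by
  refine le_trans ?_ (antitoneOn_survival hk ht (Set.right_mem_Icc.2 zero_le_one) ht.2)
  rw [survival_one]
  have : (2 : ℝ) ^ 3 ≤ 2 ^ k := pow_le_pow_right₀ one_le_two hk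
  have : (1 : ℝ) / 2 ^ k ≤ 1 / 2 ^ 3 := one_div_le_one_div_of_le (by norm_num) this
  linarith

theorem survival_le_one (hk : 3 ≤ k) {t : ℝ} (ht : t ∈ Set.Icc (0 : ℝ) 1) :
    survival k t ≤ 1 := by
  rw [← survival_zero hk]
  exact antitoneOn_survival hk (Set.left_mem_Icc.2 zero_le_one) ht ht.1

theorem log_two_lt : Real.log 2 < 7 / 10 := by
  have := Real.log_two_lt_d9
  linarith

/-- The function that has the sign of the derivative of `Omega`. -/
noncomputable def slope (α : ℝ) (k : ℕ) (t : ℝ) : ℝ :=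
  Real.log 2 * survival k t -
    α * ((k : ℝ) * ((k : ℝ) - 1) / 2 ^ k * (t ^ (k - 2) - t ^ (k - 1)))

theorem hasDerivAt_Omega (hk : 3 ≤ k) (α : ℝ) {t : ℝ} (ht : t ∈ Set.Icc (0 : ℝ) 1) :
    HasDerivAt (fun t => Omega t α k) (slope α k t / (Real.log 2 * survival k t)) t := by
  have hs : 0 < survival k t := by linarith [le_survival hk ht]
  have hl : 0 < Real.log 2 := Real.log_pos one_lt_two
  have h := (hasDerivAt_id t).add
    ((((hasDerivAt_survival hk t).log hs.ne').div_const (Real.log 2)).const_mul α)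
  refine h.congr_deriv ?_
  rw [slope]
  field_simp
  ring

theorem monotoneOn_Omega (hk : 3 ≤ k) (α : ℝ) {a b : ℝ} (ha : 0 ≤ a) (hb : b ≤ 1)
    (h : ∀ t ∈ Set.Icc a b, 0 ≤ slope α k t) :
    MonotoneOn (fun t => Omega t α k) (Set.Icc a b) := by
  have hsub : ∀ t ∈ Set.Icc a b, t ∈ Set.Icc (0 : ℝ) 1 := fun t ht =>
    ⟨ha.trans ht.1, ht.2.trans hb⟩
  refine monotoneOn_of_deriv_nonneg (convex_Icc a b)
    (fun t ht => (hasDerivAt_Omega hk α (hsub t ht)).continuousAt.continuousWithinAt)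
    (fun t ht => (hasDerivAt_Omega hk α
      (hsub t (interior_subset ht))).differentiableAt.differentiableWithinAt) fun t ht => ?_
  have ht' := interior_subset ht
  rw [(hasDerivAt_Omega hk α (hsub t ht')).deriv]
  have hs : 0 < survival k t := by linarith [le_survival hk (hsub t ht')]
  have hl : 0 < Real.log 2 := Real.log_pos one_lt_two
  exact div_nonneg (h t ht') (by positivity)

theorem antitoneOn_Omega (hk : 3 ≤ k) (α : ℝ) {a b : ℝ} (ha : 0 ≤ a) (hb : b ≤ 1)
    (h : ∀ t ∈ Set.Icc a b, slope α k t ≤ 0) :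
    AntitoneOn (fun t => Omega t α k) (Set.Icc a b) := by
  have hsub : ∀ t ∈ Set.Icc a b, t ∈ Set.Icc (0 : ℝ) 1 := fun t ht =>
    ⟨ha.trans ht.1, ht.2.trans hb⟩
  refine antitoneOn_of_deriv_nonpos (convex_Icc a b)
    (fun t ht => (hasDerivAt_Omega hk α (hsub t ht)).continuousAt.continuousWithinAt)
    (fun t ht => (hasDerivAt_Omega hk α
      (hsub t (interior_subset ht))).differentiableAt.differentiableWithinAt) fun t ht => ?_
  have ht' := interior_subset ht
  rw [(hasDerivAt_Omega hk α (hsub t ht')).deriv]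
  have hs : 0 < survival k t := by linarith [le_survival hk (hsub t ht')]
  have hl : 0 < Real.log 2 := Real.log_pos one_lt_two
  exact div_nonpos_of_nonpos_of_nonneg (h t ht') (by positivity)

theorem hasDerivAt_slope (hk : 3 ≤ k) {α : ℝ} (hα : 0 < α) (t : ℝ) :
    HasDerivAt (slope α k)
      (-(α * ((k : ℝ) * ((k : ℝ) - 1) / 2 ^ k) * t ^ (k - 3) *
        (((k : ℝ) - 2) + (Real.log 2 / α - ((k : ℝ) - 1)) * t - Real.log 2 / α * t ^ 2))) t := by
  obtain ⟨l, rfl⟩ : ∃ l, k = l + 3 := ⟨k - 3, by omega⟩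
  have h1 := (hasDerivAt_survival hk t).const_mul (Real.log 2)
  have h2 := (((hasDerivAt_pow (l + 1) t).sub (hasDerivAt_pow (l + 2) t)).const_mul
    (((l + 3 : ℕ) : ℝ) * (((l + 3 : ℕ) : ℝ) - 1) / 2 ^ (l + 3))).const_mul α
  refine (h1.sub h2).congr_deriv ?_
  simp only [show l + 3 - 2 = l + 1 by omega, show l + 3 - 1 = l + 2 by omega,
    show l + 2 - 1 = l + 1 by omega, show l + 1 - 1 = l by omega, show l + 3 - 3 = l by omega]
  push_cast
  field_simp
  ring

/-- The slope first decreases and then increases: its derivative is a negative multiple of a power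
times a concave quadratic polynomial, positive at `0` and negative at `1`. -/
theorem exists_antitoneOn_monotoneOn_slope (hk : 3 ≤ k) {α : ℝ} (hα : 0 < α) :
    ∃ m ∈ Set.Ioo (0 : ℝ) 1, AntitoneOn (slope α k) (Set.Icc 0 m) ∧
      MonotoneOn (slope α k) (Set.Icc m 1) := by
  set β := Real.log 2 / α with hβ
  have hβ0 : 0 < β := div_pos (Real.log_pos one_lt_two) hα
  have hk3 : (3 : ℝ) ≤ k := by exact_mod_cast hk
  set Q : ℝ → ℝ := fun t => ((k : ℝ) - 2) + (β - ((k : ℝ) - 1)) * t - β * t ^ 2 with hQ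
  obtain ⟨m, hm, hQm⟩ : (0 : ℝ) ∈ Q '' Set.Icc 0 1 := by
    refine intermediate_value_Icc' zero_le_one (by fun_prop) ⟨?_, ?_⟩
    · simp only [hQ]
      linarith
    · simp only [hQ]
      linarith
  have hm0 : m ≠ 0 := by
    rintro rfl
    simp only [hQ] at hQm
    linarith
  have hm1 : m ≠ 1 := by
    rintro rfl
    simp only [hQ] at hQm
    linarith
  have hm' : 0 < m := lt_of_le_of_ne hm.1 hm0.symm
  have hfac : ∀ t, m * Q t = (m - t) * (((k : ℝ) - 2) + β * m * t) := by
    intro t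
    have : m * Q t = m * Q t - t * Q m := by rw [hQm]; ring
    rw [this]
    simp only [hQ]
    ring
  have hc : 0 ≤ α * ((k : ℝ) * ((k : ℝ) - 1) / 2 ^ k) := by
    have : (0 : ℝ) ≤ (k : ℝ) - 1 := by linarith
    positivity
  have hcont : Continuous (slope α k) :=
    continuous_iff_continuousAt.2 fun t => (hasDerivAt_slope hk hα t).continuousAt
  have hpos : ∀ t, 0 ≤ t → 0 ≤ ((k : ℝ) - 2) + β * m * t := fun t ht => by
    have : 0 ≤ β * m * t := by positivity
    linarith
  refine ⟨m, ⟨hm', lt_of_le_of_ne hm.2 hm1⟩, ?_, ?_⟩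
  · refine antitoneOn_of_deriv_nonpos (convex_Icc 0 m) hcont.continuousOn
      (fun t _ => (hasDerivAt_slope hk hα t).differentiableAt.differentiableWithinAt)
      fun t ht => ?_
    rw [interior_Icc] at ht
    rw [(hasDerivAt_slope hk hα t).deriv, neg_nonpos]
    have hQt : 0 ≤ Q t := by
      refine nonneg_of_mul_nonneg_right (a := m) ?_ hm'
      rw [hfac]
      exact mul_nonneg (by linarith [ht.2]) (hpos t ht.1.le)
    have := ht.1.le
    positivity
  · refine monotoneOn_of_deriv_nonneg (convex_Icc m 1) hcont.continuousOn
      (fun t _ => (hasDerivAt_slope hk hα t).differentiableAt.differentiableWithinAt)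
      fun t ht => ?_
    rw [interior_Icc] at ht
    rw [(hasDerivAt_slope hk hα t).deriv, neg_nonneg]
    have ht0 : 0 ≤ t := hm'.le.trans ht.1.le
    have hQt : Q t ≤ 0 := by
      by_contra! h
      have h1 := mul_pos hm' h
      rw [hfac] at h1
      have h2 := mul_nonneg (by linarith [ht.1] : (0 : ℝ) ≤ t - m) (hpos t ht0)
      linarith
    exact mul_nonpos_of_nonneg_of_nonpos (by positivity) hQt

/-- The maximum of `Omega` is attained either at `1`, or at a point up to which the slope is
nonnegative. In the second case unit propagation is subcritical up to that point: a newly set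
variable forces less than one other variable on average. -/
theorem exists_maximizer (hk : 3 ≤ k) {α : ℝ} (hα : 0 < α) :
    ∃ t ∈ Set.Ioc (0 : ℝ) 1, (∀ s ∈ Set.Icc (0 : ℝ) 1, Omega s α k ≤ Omega t α k) ∧
      (t = 1 ∨ ∀ s ∈ Set.Icc 0 t,
        α * ((k : ℝ) * ((k : ℝ) - 1) / 2 ^ k * (s ^ (k - 2) - s ^ (k - 1))) ≤ Real.log 2) := by
  obtain ⟨m, hm, hanti, hmono⟩ := exists_antitoneOn_monotoneOn_slope hk hα
  have hl : 0 < Real.log 2 := Real.log_pos one_lt_two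
  have hcont : Continuous (slope α k) :=
    continuous_iff_continuousAt.2 fun t => (hasDerivAt_slope hk hα t).continuousAt
  have hm0 : (0 : ℝ) ∈ Set.Icc 0 m := ⟨le_rfl, hm.1.le⟩
  have hmm : m ∈ Set.Icc 0 m := ⟨hm.1.le, le_rfl⟩
  have hmm' : m ∈ Set.Icc m 1 := ⟨le_rfl, hm.2.le⟩
  by_cases hsm : 0 ≤ slope α k m
  · refine ⟨1, ⟨one_pos, le_rfl⟩, fun s hs => ?_, Or.inl rfl⟩
    refine monotoneOn_Omega hk α le_rfl le_rfl (fun t ht => ?_) hs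
      (Set.right_mem_Icc.2 zero_le_one) hs.2
    rcases le_total t m with h | h
    · exact hsm.trans (hanti ⟨ht.1, h⟩ hmm h)
    · exact hsm.trans (hmono hmm' ⟨h, ht.2⟩ h)
  · push Not at hsm
    have hs0 : 0 < slope α k 0 := by
      rw [slope, survival_zero hk, zero_pow (by omega), zero_pow (by omega)]
      simpa using hl
    have hs1 : 0 < slope α k 1 := by
      have := le_survival hk (Set.right_mem_Icc.2 (zero_le_one (α := ℝ)))
      rw [slope, one_pow, one_pow]
      simp only [sub_self, mul_zero, sub_zero]
      positivity
    obtain ⟨a, ha, hsa⟩ := intermediate_value_Icc' hm.1.le hcont.continuousOn ⟨hsm.le, hs0.le⟩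
    obtain ⟨b, hb, hsb⟩ := intermediate_value_Icc hm.2.le hcont.continuousOn ⟨hsm.le, hs1.le⟩
    have ha0 : 0 < a := lt_of_le_of_ne ha.1 fun h => by
      rw [← h] at hsa
      exact hs0.ne' hsa
    have hinc : MonotoneOn (fun t => Omega t α k) (Set.Icc 0 a) :=
      monotoneOn_Omega hk α le_rfl (ha.2.trans hm.2.le) fun t ht =>
        hsa ▸ hanti ⟨ht.1, ht.2.trans ha.2⟩ ha ht.2
    have hdec : AntitoneOn (fun t => Omega t α k) (Set.Icc a b) :=
      antitoneOn_Omega hk α ha.1 hb.2 fun t ht => by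
        rcases le_total t m with h | h
        · exact hsa ▸ hanti ha ⟨ha.1.trans ht.1, h⟩ ht.1
        · exact hsb ▸ hmono ⟨h, ht.2.trans hb.2⟩ hb ht.2
    have hinc' : MonotoneOn (fun t => Omega t α k) (Set.Icc b 1) :=
      monotoneOn_Omega hk α (hm.1.le.trans hb.1) le_rfl fun t ht =>
        hsb ▸ hmono hb ⟨hb.1.trans ht.1, ht.2⟩ ht.1
    have hmax : ∀ s ∈ Set.Icc (0 : ℝ) 1, Omega s α k ≤ max (Omega a α k) (Omega 1 α k) := by
      intro s hs
      rcases le_total s a with h | h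
      · exact le_max_of_le_left (hinc ⟨hs.1, h⟩ ⟨ha0.le, le_rfl⟩ h)
      rcases le_total s b with h' | h'
      · exact le_max_of_le_left (hdec ⟨le_rfl, h.trans h'⟩ ⟨h, h'⟩ h)
      · exact le_max_of_le_right (hinc' ⟨h', hs.2⟩ ⟨hb.2, le_rfl⟩ hs.2)
    rcases le_total (Omega a α k) (Omega 1 α k) with h | h
    · refine ⟨1, ⟨one_pos, le_rfl⟩, fun s hs => ?_, Or.inl rfl⟩
      have := hmax s hs
      rwa [max_eq_right h] at this
    · refine ⟨a, ⟨ha0, ha.2.trans hm.2.le⟩, fun s hs => ?_, Or.inr fun s hs => ?_⟩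
      · have := hmax s hs
        rwa [max_eq_left h] at this
      · have h1 : 0 ≤ slope α k s := hsa ▸ hanti ⟨hs.1, hs.2.trans ha.2⟩ ha hs.2
        have h2 := survival_le_one hk ⟨hs.1, hs.2.trans (ha.2.trans hm.2.le)⟩
        rw [slope] at h1
        have h3 := mul_le_mul_of_nonneg_left h2 hl.le
        linarith

theorem omegaC_eq {α t : ℝ} (ht : t ∈ Set.Icc (0 : ℝ) 1)
    (h : ∀ s ∈ Set.Icc (0 : ℝ) 1, Omega s α k ≤ Omega t α k) : omegaC α k = Omega t α k := by
  refine IsGreatest.csSup_eq ⟨⟨t, ht, rfl⟩, ?_⟩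
  rintro _ ⟨s, hs, rfl⟩
  exact h s hs

end calculus

/-! ### Exponential growth rates -/

/-- Exponential bounds from both sides, with arbitrarily small error in the exponent. -/
theorem hasExponent_of_bounds {L : ℕ → ℝ≥0∞} {ω : ℝ}
    (hlow : ∀ δ > 0, ∀ᶠ N : ℕ in atTop, ENNReal.ofReal (2 ^ ((N : ℝ) * (ω - δ))) ≤ L N)
    (hup : ∀ δ > 0, ∀ᶠ N : ℕ in atTop, L N ≤ ENNReal.ofReal (2 ^ ((N : ℝ) * (ω + δ)))) :
    HasExponent L ω := by
  have hreal : ∀ δ > 0, ∀ᶠ N : ℕ in atTop, L N ≠ ⊤ ∧ 0 < (L N).toReal ∧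
      |Real.logb 2 (L N).toReal - N * ω| ≤ δ * N := by
    intro δ hδ
    filter_upwards [hlow δ hδ, hup δ hδ] with N h1 h2
    have htop : L N ≠ ⊤ := ne_top_of_le_ne_top ENNReal.ofReal_ne_top h2
    have h1' := (ENNReal.ofReal_le_iff_le_toReal htop).1 h1
    have hpos : 0 < (L N).toReal := lt_of_lt_of_le (by positivity) h1'
    have h2' : (L N).toReal ≤ 2 ^ ((N : ℝ) * (ω + δ)) :=
      ENNReal.toReal_le_of_le_ofReal (by positivity) h2
    refine ⟨htop, hpos, ?_⟩
    have h3 := (Real.le_logb_iff_rpow_le one_lt_two hpos).2 h1'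
    have h4 := (Real.logb_le_iff_le_rpow one_lt_two hpos).2 h2'
    rw [abs_le]
    constructor <;> linarith
  refine ⟨fun N => Real.logb 2 (L N).toReal - N * ω, ?_, ?_⟩
  · rw [isLittleO_iff]
    intro c hc
    filter_upwards [hreal c hc] with N hN
    rw [Real.norm_eq_abs, Real.norm_of_nonneg (Nat.cast_nonneg N)]
    exact hN.2.2
  · filter_upwards [hreal 1 one_pos] with N hN
    rw [add_sub_cancel, Real.rpow_logb two_pos one_lt_two.ne' hN.2.1, ENNReal.ofReal_toReal hN.1]

/-! ### Asymptotics of the binomial coefficients -/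

theorem choose_mul_pow_le {x y : ℕ} (h : y ≤ x) (m : ℕ) :
    y.choose m * x ^ m ≤ x.choose m * y ^ m := by
  induction m with
  | zero => simp
  | succ m ih =>
    refine Nat.le_of_mul_le_mul_right (c := m + 1) ?_ (Nat.succ_pos m)
    have h1 : (y - m) * x ≤ (x - m) * y := by
      rw [Nat.sub_mul, Nat.sub_mul, mul_comm y x]
      exact Nat.sub_le_sub_left (Nat.mul_le_mul_left m h) _
    calc y.choose (m + 1) * x ^ (m + 1) * (m + 1)
        = (y.choose (m + 1) * (m + 1)) * x ^ (m + 1) := by ring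
      _ = (y.choose m * x ^ m) * ((y - m) * x) := by rw [Nat.choose_succ_right_eq]; ring
      _ ≤ (x.choose m * y ^ m) * ((x - m) * y) := Nat.mul_le_mul ih h1
      _ = (x.choose (m + 1) * (m + 1)) * y ^ (m + 1) := by rw [Nat.choose_succ_right_eq]; ring
      _ = _ := by ring

theorem choose_div_choose_le {x y : ℕ} (h : y ≤ x) {m : ℕ} (hm : m ≤ x) :
    (y.choose m : ℝ) / x.choose m ≤ ((y : ℝ) / x) ^ m := by
  rcases Nat.eq_zero_or_pos x with rfl | hx
  · obtain rfl : m = 0 := by omega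
    simp
  have h1 : (0 : ℝ) < x.choose m := by exact_mod_cast Nat.choose_pos hm
  have h2 : (0 : ℝ) < (x : ℝ) ^ m := by positivity
  rw [div_pow, div_le_div_iff₀ h1 h2]
  exact_mod_cast (choose_mul_pow_le h m).trans (le_of_eq (mul_comm _ _))

theorem pow_le_choose_div_choose {x y : ℕ} (m : ℕ) (hm : m ≤ x) :
    (((y + 1 - m : ℕ) : ℝ) / x) ^ m ≤ (y.choose m : ℝ) / x.choose m := by
  rcases Nat.eq_zero_or_pos x with rfl | hx
  · obtain rfl : m = 0 := by omega
    simp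
  have h1 : (0 : ℝ) < x.choose m := by exact_mod_cast Nat.choose_pos hm
  have h2 : (0 : ℝ) < (x : ℝ) ^ m := by positivity
  have h3 : (0 : ℝ) < m.factorial := by exact_mod_cast Nat.factorial_pos m
  rw [div_pow, div_le_div_iff₀ h2 h1]
  have h4 : (((y + 1 - m : ℕ) : ℝ)) ^ m ≤ m.factorial * y.choose m := by
    have := Nat.pow_sub_le_descFactorial y m
    rw [Nat.descFactorial_eq_factorial_mul_choose] at this
    exact_mod_cast this
  have h5 : (m.factorial : ℝ) * x.choose m ≤ (x : ℝ) ^ m := by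
    have := Nat.descFactorial_le_pow x m
    rw [Nat.descFactorial_eq_factorial_mul_choose] at this
    exact_mod_cast this
  calc (((y + 1 - m : ℕ) : ℝ)) ^ m * x.choose m
      ≤ (m.factorial * y.choose m) * x.choose m := by gcongr
    _ = y.choose m * (m.factorial * x.choose m) := by ring
    _ ≤ _ := by gcongr

theorem pow_sub_pow_le {a b : ℝ} (hb : 0 ≤ b) (hab : b ≤ a) (ha : a ≤ 1) (j : ℕ) :
    a ^ j - b ^ j ≤ j * (a - b) := by
  induction j with
  | zero => simp
  | succ j ih =>
    have h1 : b ^ j ≤ 1 := pow_le_one₀ hb (hab.trans ha)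
    have h2 : 0 ≤ a ^ j - b ^ j := sub_nonneg.2 (pow_le_pow_left₀ hb hab j)
    calc a ^ (j + 1) - b ^ (j + 1) = a * (a ^ j - b ^ j) + b ^ j * (a - b) := by ring
      _ ≤ 1 * (a ^ j - b ^ j) + 1 * (a - b) := by
          gcongr
      _ ≤ _ := by
          push_cast
          linarith

theorem le_choose_div_choose {N T j : ℕ} (hT : T ≤ N) (hj : j ≤ N) :
    ((T : ℝ) / N) ^ j - (j : ℝ) ^ 2 / N ≤ (T.choose j : ℝ) / N.choose j := by
  rcases Nat.eq_zero_or_pos N with rfl | hN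
  · obtain rfl : j = 0 := by omega
    simp
  have hN' : (0 : ℝ) < N := by exact_mod_cast hN
  refine le_trans ?_ (pow_le_choose_div_choose j hj)
  have h1 : ((T + 1 - j : ℕ) : ℝ) / N ≤ T / N ∨ j = 0 := by
    rcases Nat.eq_zero_or_pos j with h | h
    · exact Or.inr h
    · left
      gcongr
      omega
  rcases h1 with h1 | rfl
  · have h2 : (T : ℝ) / N - ((T + 1 - j : ℕ) : ℝ) / N ≤ j / N := by
      rw [← sub_div]
      gcongr
      have : (T : ℝ) ≤ ((T + 1 - j : ℕ) : ℝ) + j := by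
        have : T ≤ (T + 1 - j) + j := by omega
        exact_mod_cast this
      linarith
    have h3 := pow_sub_pow_le (by positivity) h1
      ((div_le_one hN').2 (by exact_mod_cast hT)) j
    have h4 : (j : ℝ) * (T / N - ((T + 1 - j : ℕ) : ℝ) / N) ≤ j * (j / N) := by gcongr
    have h5 : (j : ℝ) * (j / N) = (j : ℝ) ^ 2 / N := by ring
    linarith
  · simp

theorem numBlocking_le {k N T : ℕ} (hk : 1 ≤ k) (hT : T ≤ N) :
    numBlocking k N T ≤ N.choose k := by
  obtain ⟨C, -, hC⟩ := Finset.exists_subset_card_eq (s := (Finset.univ : Finset (Fin N)))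
    (n := T) (by simpa using hT)
  rw [← hC, ← card_blockingClauses (σ := fun _ => true) hk,
    ← card_zeroClauses (σ := fun _ => true)]
  exact Finset.card_le_card (blockingClauses_subset C)

/-- The proportion of the clauses that block a set of `T` variables converges uniformly. -/
theorem abs_numBlocking_sub_le {k : ℕ} (hk : 3 ≤ k) {ε : ℝ} (hε : 0 < ε) :
    ∀ᶠ N : ℕ in atTop, ∀ T ≤ N,
      |(numBlocking k N T : ℝ) / (N.choose k * 2 ^ k : ℕ) - (1 - survival k ((T : ℝ) / N))| ≤ ε := by
  have hlim : Tendsto (fun N : ℕ => (2 * (k : ℝ) ^ 3) / (N : ℝ)) atTop (nhds 0) :=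
    tendsto_const_div_atTop_nhds_zero_nat _
  filter_upwards [hlim.eventually (gt_mem_nhds hε), eventually_ge_atTop (2 * k)] with N hN hNk T hT
  have hN0 : (0 : ℝ) < N := by exact_mod_cast (by omega : 0 < N)
  have hk1 : (3 : ℝ) ≤ k := by exact_mod_cast hk
  have hNk' : 2 * (k : ℝ) ≤ N := by exact_mod_cast hNk
  set t : ℝ := (T : ℝ) / N with ht
  have ht0 : 0 ≤ t := by positivity
  have ht1 : t ≤ 1 := (div_le_one hN0).2 (by exact_mod_cast hT)
  set u : ℝ := (T.choose k : ℝ) / N.choose k with hu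
  set v : ℝ := (T.choose (k - 1) : ℝ) / N.choose (k - 1) with hv
  have hu1 : u ≤ t ^ k := choose_div_choose_le hT (by omega)
  have hu2 : t ^ k - (k : ℝ) ^ 2 / N ≤ u := le_choose_div_choose hT (by omega)
  have hv1 : v ≤ t ^ (k - 1) := choose_div_choose_le hT (by omega)
  have hv2 : t ^ (k - 1) - (k : ℝ) ^ 2 / N ≤ v := by
    refine le_trans ?_ (le_choose_div_choose hT (by omega))
    gcongr
    omega
  have hv0 : 0 ≤ v := by positivity
  set w : ℝ := ((N : ℝ) - T) / ((N : ℝ) - k + 1) with hw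
  have hden : 0 < (N : ℝ) - k + 1 := by linarith
  have hTN : (T : ℝ) ≤ N := by exact_mod_cast hT
  have hw1 : 1 - t ≤ w := by
    rw [hw, le_div_iff₀ hden]
    have h1 : (1 - t) * ((N : ℝ) - k + 1) ≤ (1 - t) * N :=
      mul_le_mul_of_nonneg_left (by linarith) (by linarith)
    have h2 : (1 - t) * (N : ℝ) = N - T := by rw [ht]; field_simp
    linarith
  have hw2 : w ≤ (1 - t) + 2 * k / N := by
    rw [hw, div_le_iff₀ hden]
    have h2 : t * (N : ℝ) = T := by rw [ht]; field_simp
    have h3 : (k : ℝ) - 1 ≤ 2 * k / N * ((N : ℝ) - k + 1) := by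
      rw [div_mul_eq_mul_div, le_div_iff₀ hN0]
      nlinarith
    have h4 : (1 - t) * ((N : ℝ) - k + 1) = N - T - (1 - t) * (k - 1) := by
      rw [← h2]; ring
    have h5 : (1 - t) * ((k : ℝ) - 1) ≤ 1 * (k - 1) := by
      gcongr <;> linarith
    rw [add_mul, h4]
    linarith
  have hb : (numBlocking k N T : ℝ) / (N.choose k * 2 ^ k : ℕ) = (u + k * w * v) / 2 ^ k := by
    have h1 : (0 : ℝ) < N.choose k := by exact_mod_cast Nat.choose_pos (by omega)
    have h2 : (0 : ℝ) < N.choose (k - 1) := by exact_mod_cast Nat.choose_pos (by omega)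
    have h3 : (N.choose k : ℝ) * k = N.choose (k - 1) * ((N : ℝ) - k + 1) := by
      have := Nat.choose_succ_right_eq N (k - 1)
      rw [Nat.sub_add_cancel (by omega)] at this
      have h := congrArg (Nat.cast (R := ℝ)) this
      rw [Nat.cast_mul, Nat.cast_mul, Nat.cast_sub (by omega), Nat.cast_sub (by omega)] at h
      rw [h]
      push_cast
      ring
    have h4 : (k : ℝ) / ((N : ℝ) - k + 1) / N.choose (k - 1) = 1 / N.choose k := by
      field_simp
      linarith
    have h5 : (k : ℝ) * w * v = ((N : ℝ) - T) * T.choose (k - 1) *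
        ((k : ℝ) / ((N : ℝ) - k + 1) / N.choose (k - 1)) := by
      rw [hw, hv]
      ring
    rw [h5, h4, hu, numBlocking]
    push_cast [Nat.cast_sub hT]
    field_simp
  have hs : 1 - survival k t = (t ^ k + k * (1 - t) * t ^ (k - 1)) / 2 ^ k := by
    obtain ⟨l, rfl⟩ : ∃ l, k = l + 1 := ⟨k - 1, by omega⟩
    rw [survival]
    simp only [Nat.add_sub_cancel]
    push_cast
    ring
  have ht2 : t ^ (k - 1) ≤ 1 := pow_le_one₀ ht0 ht1
  have ht3 : 0 ≤ t ^ (k - 1) := by positivity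
  have e1 : (k : ℝ) ^ 2 / N + k * ((k : ℝ) ^ 2 / N) ≤ 2 * (k : ℝ) ^ 3 / N := by
    rw [← mul_div_assoc, ← add_div]
    gcongr
    nlinarith [sq_nonneg (k : ℝ)]
  have e2 : (k : ℝ) * (2 * k / N) ≤ 2 * (k : ℝ) ^ 3 / N := by
    have h1 : (k : ℝ) * (2 * k) ≤ 2 * k ^ 3 := by
      have : (0 : ℝ) ≤ (k : ℝ) * k * (k - 1) := mul_nonneg (by positivity) (by linarith)
      linarith
    rw [← mul_div_assoc]
    exact div_le_div_of_nonneg_right h1 hN0.le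
  have hlow : k * (1 - t) * t ^ (k - 1) - k * ((k : ℝ) ^ 2 / N) ≤ k * w * v := by
    have h1 : (k : ℝ) * (1 - t) * v ≤ k * w * v := by gcongr
    have h2 : (k : ℝ) * (1 - t) * (t ^ (k - 1) - (k : ℝ) ^ 2 / N) ≤ k * (1 - t) * v := by
      have : 0 ≤ (k : ℝ) * (1 - t) := mul_nonneg (by linarith) (by linarith)
      gcongr
    have h3 : (k : ℝ) * (1 - t) * ((k : ℝ) ^ 2 / N) ≤ k * 1 * ((k : ℝ) ^ 2 / N) := by
      gcongr
      linarith
    linarith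
  have hupp : k * w * v ≤ k * (1 - t) * t ^ (k - 1) + k * (2 * k / N) := by
    have h0 : 0 ≤ (k : ℝ) * w := mul_nonneg (by linarith) (by linarith)
    have h1 : k * w * v ≤ k * w * t ^ (k - 1) := by gcongr
    have h2 : k * w * t ^ (k - 1) ≤ k * ((1 - t) + 2 * k / N) * t ^ (k - 1) := by gcongr
    have h3 : (k : ℝ) * (2 * k / N) * t ^ (k - 1) ≤ k * (2 * k / N) * 1 := by gcongr
    linarith
  rw [hb, hs, ← sub_div, abs_div, abs_of_pos (by positivity : (0 : ℝ) < 2 ^ k)]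
  have habs : |u + k * w * v - (t ^ k + k * (1 - t) * t ^ (k - 1))| ≤ ε := by
    rw [abs_le]
    constructor <;> linarith
  exact (div_le_self (abs_nonneg _) (one_le_pow₀ one_le_two)).trans habs

theorem eventually_mul_le_choose {k : ℕ} (hk : 2 ≤ k) (C : ℝ) :
    ∀ᶠ N : ℕ in atTop, C * N ≤ N.choose k := by
  have hlim : Tendsto (fun N : ℕ => (N : ℝ)) atTop atTop := tendsto_natCast_atTop_atTop
  filter_upwards [hlim.eventually_ge_atTop (4 * (k.factorial : ℝ) * |C|),
    eventually_ge_atTop (2 * k)] with N h1 h2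
  have h3 : ((N + 1 - k : ℕ) : ℝ) ^ k ≤ k.factorial * N.choose k := by
    have := Nat.pow_sub_le_descFactorial N k
    rw [Nat.descFactorial_eq_factorial_mul_choose] at this
    exact_mod_cast this
  have h4 : ((N + 1 - k : ℕ) : ℝ) ^ 2 ≤ ((N + 1 - k : ℕ) : ℝ) ^ k :=
    pow_le_pow_right₀ (by exact_mod_cast (by omega : 1 ≤ N + 1 - k)) hk
  have h5 : (N : ℝ) ≤ 2 * ((N + 1 - k : ℕ) : ℝ) := by
    exact_mod_cast (by omega : N ≤ 2 * (N + 1 - k))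
  have h6 : (0 : ℝ) < k.factorial := by exact_mod_cast Nat.factorial_pos k
  have h7 : (0 : ℝ) ≤ N := Nat.cast_nonneg N
  have h8 : (k.factorial : ℝ) * (|C| * N) ≤ k.factorial * N.choose k := by
    nlinarith
  exact (mul_le_mul_of_nonneg_right (le_abs_self C) h7).trans (le_of_mul_le_mul_left h8 h6)

theorem eventually_mul_pow_le_rpow (C : ℝ) (p : ℕ) {δ : ℝ} (hδ : 0 < δ) :
    ∀ᶠ N : ℕ in atTop, C * (N : ℝ) ^ p ≤ 2 ^ (δ * N) := by
  have h := isLittleO_pow_const_const_pow_of_one_lt (R := ℝ) p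
    (Real.one_lt_rpow one_lt_two hδ)
  have hC : 0 < 1 / (|C| + 1) := by positivity
  filter_upwards [h.bound hC] with N hN
  rw [Real.norm_of_nonneg (by positivity), Real.norm_of_nonneg (by positivity),
    ← Real.rpow_natCast (2 ^ δ), ← Real.rpow_mul two_pos.le, div_mul_eq_mul_div, one_mul,
    le_div_iff₀ (by positivity)] at hN
  have h1 : C * (N : ℝ) ^ p ≤ |C| * (N : ℝ) ^ p := by
    gcongr
    exact le_abs_self C
  have h2 : (0 : ℝ) ≤ (N : ℝ) ^ p := by positivity
  linarith

theorem eventually_numClauses_pow_le (k e : ℕ) {δ : ℝ} (hδ : 0 < δ) :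
    ∀ᶠ N : ℕ in atTop, ((N.choose k * 2 ^ k : ℕ) : ℝ) ^ e ≤ 2 ^ (δ * N) := by
  filter_upwards [eventually_mul_pow_le_rpow ((2 ^ k) ^ e) (k * e) hδ] with N hN
  refine le_trans ?_ hN
  rw [pow_mul, ← mul_pow, mul_comm ((2 : ℝ) ^ k)]
  push_cast
  gcongr
  exact_mod_cast Nat.choose_le_pow N k

section rates

variable {k : ℕ} {α : ℝ}

/-- There are far fewer clauses in the instance than available ones. -/
theorem eventually_floor_le (hk : 3 ≤ k) (hα : 0 < α) {ε : ℝ} (hε : 0 < ε) (C : ℝ) :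
    ∀ᶠ N : ℕ in atTop, (⌊α * N⌋₊ : ℝ) + C ≤ ε * (N.choose k * 2 ^ k : ℕ) := by
  filter_upwards [eventually_mul_le_choose (by omega : 2 ≤ k) ((α + |C|) / ε),
    eventually_ge_atTop 1] with N hN h1
  have h2 : (⌊α * N⌋₊ : ℝ) ≤ α * N := Nat.floor_le (by positivity)
  have h3 : C ≤ |C| * N := by
    refine (le_abs_self C).trans (le_mul_of_one_le_right (abs_nonneg C) ?_)
    exact_mod_cast h1
  rw [div_mul_eq_mul_div, div_le_iff₀ hε] at hN
  have h4 : (N.choose k : ℝ) ≤ (N.choose k * 2 ^ k : ℕ) := by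
    exact_mod_cast Nat.le_mul_of_pos_right _ (by positivity)
  nlinarith

/-- An upper bound for the expected number of splits at depth `T`. -/
theorem eventually_choose_ratio_le (hk : 3 ≤ k) (hα : 0 < α) {δ : ℝ} (hδ : 0 < δ) :
    ∀ᶠ N : ℕ in atTop, ∀ T ≤ N,
      (2 : ℝ) ^ T * ((N.choose k * 2 ^ k - numBlocking k N T).choose ⌊α * N⌋₊ : ℝ) /
        ((N.choose k * 2 ^ k).choose ⌊α * N⌋₊ : ℝ) ≤ 2 ^ ((N : ℝ) * (Omega (T / N) α k + δ)) := by
  set δ' : ℝ := δ / (2 * α) with hδ'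
  have hδ'0 : 0 < δ' := by positivity
  have hpow : 1 < (2 : ℝ) ^ δ' := Real.one_lt_rpow one_lt_two hδ'0
  have hlim : Tendsto (fun N : ℕ => δ * (N : ℝ)) atTop atTop :=
    tendsto_natCast_atTop_atTop.const_mul_atTop hδ
  filter_upwards [abs_numBlocking_sub_le hk
    (ε := 7 / 8 * ((2 : ℝ) ^ δ' - 1)) (by linarith), eventually_floor_le hk hα one_pos 0,
    eventually_ge_atTop (k + 1), hlim.eventually_ge_atTop 2] with N hb hM hN hδN T hT
  set M := ⌊α * N⌋₊ with hMdef
  set x := N.choose k * 2 ^ k with hx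
  have hN0 : (0 : ℝ) < N := by exact_mod_cast (by omega : 0 < N)
  have hMx : M ≤ x := by
    have : (M : ℝ) ≤ x := by linarith
    exact_mod_cast this
  have hx0 : (0 : ℝ) < x := by
    have : 0 < N.choose k := Nat.choose_pos (by omega)
    exact_mod_cast (by positivity : 0 < N.choose k * 2 ^ k)
  have hbx : numBlocking k N T ≤ x :=
    (numBlocking_le (by omega) hT).trans (Nat.le_mul_of_pos_right _ (by positivity))
  set t : ℝ := (T : ℝ) / N with ht
  have htI : t ∈ Set.Icc (0 : ℝ) 1 := ⟨by positivity, (div_le_one hN0).2 (by exact_mod_cast hT)⟩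
  set D := survival k t with hD
  have hD1 := le_survival hk htI
  have hD2 := survival_le_one hk htI
  have hD0 : 0 < D := by linarith
  have hratio : ((x - numBlocking k N T : ℕ) : ℝ) / x ≤ D * 2 ^ δ' := by
    rw [Nat.cast_sub hbx, sub_div, div_self hx0.ne']
    have h1 := (abs_le.1 (hb T hT)).1
    have h2 : 7 / 8 * ((2 : ℝ) ^ δ' - 1) ≤ D * ((2 : ℝ) ^ δ' - 1) := by
      gcongr
    linarith
  have hlog : D * 2 ^ δ' = 2 ^ (Real.logb 2 D + δ') := by
    rw [Real.rpow_add two_pos, Real.rpow_logb two_pos one_lt_two.ne' hD0]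
  have hlogD0 : Real.logb 2 D ≤ 0 := Real.logb_nonpos one_lt_two hD0.le hD2
  have hlogD1 : -1 ≤ Real.logb 2 D := by
    rw [Real.le_logb_iff_rpow_le one_lt_two hD0, Real.rpow_neg_one]
    linarith
  have hM1 : (M : ℝ) ≤ α * N := Nat.floor_le (by positivity)
  have hM2 : α * N - 1 ≤ M := by
    have := Nat.lt_floor_add_one (α * N)
    rw [← hMdef] at this
    linarith
  have hexp : (T : ℝ) + (Real.logb 2 D + δ') * M ≤ (N : ℝ) * (Omega t α k + δ) := by
    rw [Omega_eq, ← hD]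
    have h1 : (N : ℝ) * t = T := by rw [ht]; field_simp
    have h2 : Real.logb 2 D * M ≤ Real.logb 2 D * (α * N - 1) :=
      mul_le_mul_of_nonpos_left hM2 hlogD0
    have h3 : δ' * M ≤ δ' * (α * N) := by gcongr
    have h4 : δ' * (α * N) = δ * N / 2 := by rw [hδ']; field_simp
    have h5 : (N : ℝ) * (t + α * Real.logb 2 D + δ) =
      N * t + Real.logb 2 D * (α * N) + δ * N := by ring
    rw [h5, h1]
    linarith
  calc (2 : ℝ) ^ T * ((x - numBlocking k N T).choose M : ℝ) / (x.choose M : ℝ)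
      = (2 : ℝ) ^ T * (((x - numBlocking k N T).choose M : ℝ) / (x.choose M : ℝ)) := by
        rw [mul_div_assoc]
    _ ≤ (2 : ℝ) ^ T * (D * 2 ^ δ') ^ M := by
        gcongr
        refine (choose_div_choose_le (Nat.sub_le _ _) hMx).trans ?_
        gcongr
    _ = 2 ^ ((T : ℝ) + (Real.logb 2 D + δ') * M) := by
        rw [hlog, ← Real.rpow_natCast (2 ^ _), ← Real.rpow_mul two_pos.le,
          ← Real.rpow_natCast 2 T, ← Real.rpow_add two_pos]
    _ ≤ _ := Real.rpow_le_rpow_of_exponent_le one_le_two hexp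

/-- The probability that an instance contains `e` given clauses and avoids all but the proportion
`D` of the others. -/
theorem eventually_le_choose_ratio (hk : 3 ≤ k) (hα : 0 < α) (e : ℕ) {D δ : ℝ} (hD : 0 < D)
    (hD1 : D ≤ 1) (hδ : 0 < δ) :
    ∀ᶠ N : ℕ in atTop, ∀ y : ℕ, D * (N.choose k * 2 ^ k : ℕ) ≤ y →
      (2 : ℝ) ^ ((N : ℝ) * (α * Real.logb 2 D - δ)) ≤
        (y.choose (⌊α * N⌋₊ - e) : ℝ) / ((N.choose k * 2 ^ k).choose ⌊α * N⌋₊ : ℝ) := by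
  set δ' : ℝ := δ / (2 * α) with hδ'
  have hδ'0 : 0 < δ' := by positivity
  have hpow : (2 : ℝ) ^ (-δ') < 1 := Real.rpow_lt_one_of_one_lt_of_neg one_lt_two (by linarith)
  have hpow0 : 0 < (2 : ℝ) ^ (-δ') := by positivity
  have hlim : Tendsto (fun N : ℕ => α * (N : ℝ)) atTop atTop :=
    tendsto_natCast_atTop_atTop.const_mul_atTop hα
  filter_upwards [eventually_floor_le hk hα (ε := D * (1 - 2 ^ (-δ')))
    (mul_pos hD (by linarith)) 0, eventually_floor_le hk hα one_pos 0,
    eventually_numClauses_pow_le k e (half_pos hδ), eventually_ge_atTop (k + 1),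
    hlim.eventually_ge_atTop ((e : ℝ) + 1)]
    with N hM1 hM2 hpoly hN hαN y hy
  set M := ⌊α * N⌋₊ with hMdef
  set x := N.choose k * 2 ^ k with hx
  have hMx : M ≤ x := by
    have : (M : ℝ) ≤ x := by linarith
    exact_mod_cast this
  have hx0 : (0 : ℝ) < x := by
    have : 0 < N.choose k := Nat.choose_pos (by omega)
    exact_mod_cast (by positivity : 0 < N.choose k * 2 ^ k)
  have heM : e ≤ M := Nat.le_floor (by linarith)
  have hMα : (M : ℝ) ≤ α * N := Nat.floor_le (by positivity)
  set B : ℝ := D * 2 ^ (-δ') with hB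
  have hB0 : 0 < B := by positivity
  have hB1 : B ≤ 1 := mul_le_one₀ hD1 hpow0.le hpow.le
  have hlogB : Real.logb 2 B = Real.logb 2 D - δ' := by
    rw [hB, Real.logb_mul hD.ne' hpow0.ne', Real.logb_rpow two_pos one_lt_two.ne']
    ring
  have hbase : B ≤ ((y + 1 - (M - e) : ℕ) : ℝ) / x := by
    rw [le_div_iff₀ hx0]
    have h1 : (y : ℝ) ≤ ((y + 1 - (M - e) : ℕ) : ℝ) + M := by
      exact_mod_cast (by omega : y ≤ (y + 1 - (M - e)) + M)
    have h2 : B * x = D * x - D * (1 - 2 ^ (-δ')) * x := by rw [hB]; ring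
    linarith
  have hchoose : ∀ m, (x.choose (m + 1) : ℝ) ≤ x.choose m * x := by
    intro m
    have h := Nat.choose_succ_right_eq x m
    have h1 : x.choose (m + 1) ≤ x.choose m * x :=
      (Nat.le_mul_of_pos_right _ (Nat.succ_pos m)).trans
        (h.le.trans (Nat.mul_le_mul_left _ (Nat.sub_le _ _)))
    exact_mod_cast h1
  have hchoose' : ∀ e m, (x.choose (m + e) : ℝ) ≤ x.choose m * (x : ℝ) ^ e := by
    intro e m
    induction e with
    | zero => simp
    | succ e ih =>
      calc (x.choose (m + (e + 1)) : ℝ) ≤ x.choose (m + e) * x := hchoose _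
        _ ≤ x.choose m * (x : ℝ) ^ e * x := by gcongr
        _ = _ := by ring
  have hpos1 : (0 : ℝ) < x.choose M := by exact_mod_cast Nat.choose_pos hMx
  have hpos2 : (0 : ℝ) < x.choose (M - e) := by
    exact_mod_cast Nat.choose_pos ((Nat.sub_le _ _).trans hMx)
  have h1 := hchoose' e (M - e)
  rw [Nat.sub_add_cancel heM] at h1
  calc (2 : ℝ) ^ ((N : ℝ) * (α * Real.logb 2 D - δ))
      = 2 ^ (Real.logb 2 B * (α * N)) / 2 ^ (δ / 2 * N) := by
        rw [← Real.rpow_sub two_pos, hlogB]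
        congr 1
        rw [hδ']
        field_simp
        ring
    _ ≤ 2 ^ (Real.logb 2 B * M) / (x : ℝ) ^ e := by
        gcongr ?_ / ?_
        refine Real.rpow_le_rpow_of_exponent_le one_le_two ?_
        exact mul_le_mul_of_nonpos_left hMα (Real.logb_nonpos one_lt_two hB0.le hB1)
    _ = B ^ M / (x : ℝ) ^ e := by
        rw [Real.rpow_mul two_pos.le, Real.rpow_logb two_pos one_lt_two.ne' hB0, Real.rpow_natCast]
    _ ≤ B ^ (M - e) / (x : ℝ) ^ e := by
        gcongr ?_ / _
        exact pow_le_pow_of_le_one hB0.le hB1 (Nat.sub_le _ _)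
    _ ≤ (y.choose (M - e) : ℝ) / x.choose (M - e) / (x : ℝ) ^ e := by
        gcongr ?_ / _
        refine le_trans ?_ (pow_le_choose_div_choose (M - e) ((Nat.sub_le _ _).trans hMx))
        gcongr
    _ = (y.choose (M - e) : ℝ) / (x.choose (M - e) * (x : ℝ) ^ e) := by rw [div_div]
    _ ≤ _ := by gcongr

end rates

/-! ### The exponents of the numbers of leaves -/

section exponents

variable {k : ℕ} {α : ℝ}

theorem ofReal_two_pow_mul_div (T a b : ℕ) (hb : 0 < b) :
    ENNReal.ofReal ((2 : ℝ) ^ T * a / b) = (2 : ℝ≥0∞) ^ T * (a : ℕ) / (b : ℕ) := by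
  rw [ENNReal.ofReal_div_of_pos (by exact_mod_cast hb), ENNReal.ofReal_mul (by positivity),
    ENNReal.ofReal_pow two_pos.le, ENNReal.ofReal_natCast, ENNReal.ofReal_natCast,
    ENNReal.ofReal_ofNat]

/-- The bound on the number of splits, in extended nonnegative reals. -/
theorem eventually_expected_splits_le (hk : 3 ≤ k) (hα : 0 < α) {δ : ℝ} (hδ : 0 < δ) :
    ∀ᶠ N : ℕ in atTop, ∀ T ≤ N,
      (2 : ℝ≥0∞) ^ T * ((N.choose k * 2 ^ k - numBlocking k N T).choose ⌊α * N⌋₊ : ℕ) /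
        ((N.choose k * 2 ^ k).choose ⌊α * N⌋₊ : ℕ) ≤
          ENNReal.ofReal (2 ^ ((N : ℝ) * (Omega (T / N) α k + δ))) := by
  filter_upwards [eventually_choose_ratio_le hk hα hδ, eventually_floor_le hk hα one_pos 0]
    with N hN hM T hT
  have hMx : ⌊α * N⌋₊ ≤ N.choose k * 2 ^ k := by
    have : (⌊α * N⌋₊ : ℝ) ≤ (N.choose k * 2 ^ k : ℕ) := by linarith
    exact_mod_cast this
  rw [← ofReal_two_pow_mul_div _ _ _ (Nat.choose_pos hMx)]
  exact ENNReal.ofReal_le_ofReal (hN T hT)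

theorem eventually_expectation_solutionLeaves_le (rule : (N : ℕ) → UnitRule N) (hk : 3 ≤ k)
    (hα : 0 < α) {δ : ℝ} (hδ : 0 < δ) :
    ∀ᶠ N : ℕ in atTop, expectation k N ⌊α * (N : ℝ)⌋₊ (rule N) SearchTree.solutionLeaves ≤
      ENNReal.ofReal (2 ^ ((N : ℝ) * (omegaS α k + δ))) := by
  filter_upwards [eventually_expected_splits_le hk hα hδ, eventually_ge_atTop 1] with N hN h1
  have h2 := hN N le_rfl
  have h3 : numBlocking k N N = N.choose k := by simp [numBlocking]
  rw [h3, div_self (by exact_mod_cast (by omega : N ≠ 0))] at h2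
  exact expectation_solutionLeaves_le.trans h2

theorem eventually_expectation_leaves_le (rule : (N : ℕ) → UnitRule N) (hk : 3 ≤ k)
    (hα : 0 < α) {ω : ℝ} (hω : ∀ s ∈ Set.Icc (0 : ℝ) 1, Omega s α k ≤ ω) {δ : ℝ} (hδ : 0 < δ) :
    ∀ᶠ N : ℕ in atTop, expectation k N ⌊α * (N : ℝ)⌋₊ (rule N) SearchTree.leaves ≤
      ENNReal.ofReal (2 ^ ((N : ℝ) * (ω + δ))) := by
  have hω0 : 0 ≤ ω := by
    have h := hω 0 (Set.left_mem_Icc.2 zero_le_one)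
    rwa [Omega_eq, survival_zero hk, Real.logb_one, mul_zero, add_zero] at h
  filter_upwards [eventually_expected_splits_le hk hα (half_pos hδ), eventually_ge_atTop 1,
    eventually_floor_le hk hα one_pos 0, eventually_mul_pow_le_rpow 3 1 (half_pos hδ)]
    with N hN h1 hM hpoly
  have hMx : ⌊α * N⌋₊ ≤ N.choose k * 2 ^ k := by
    have : (⌊α * N⌋₊ : ℝ) ≤ (N.choose k * 2 ^ k : ℕ) := by linarith
    exact_mod_cast this
  have hN0 : (1 : ℝ) ≤ N := by exact_mod_cast h1
  set B : ℝ := 2 ^ ((N : ℝ) * (ω + δ / 2)) with hB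
  have hB1 : 1 ≤ B := Real.one_le_rpow one_le_two (by positivity)
  have hterm : ∀ T ∈ Finset.range (N + 1),
      (2 : ℝ≥0∞) ^ T * ((N.choose k * 2 ^ k - numBlocking k N T).choose ⌊α * N⌋₊ : ℕ) /
        ((N.choose k * 2 ^ k).choose ⌊α * N⌋₊ : ℕ) ≤ ENNReal.ofReal B := by
    intro T hT
    have hTN : T ≤ N := Nat.lt_succ_iff.1 (Finset.mem_range.1 hT)
    refine (hN T hTN).trans (ENNReal.ofReal_le_ofReal ?_)
    refine Real.rpow_le_rpow_of_exponent_le one_le_two ?_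
    have := hω (T / N) ⟨by positivity, (div_le_one (by linarith)).2 (by exact_mod_cast hTN)⟩
    gcongr
  calc expectation k N ⌊α * (N : ℝ)⌋₊ (rule N) SearchTree.leaves
      ≤ 1 + ∑ T ∈ Finset.range (N + 1), ENNReal.ofReal B :=
        (expectation_leaves_le (by omega) hMx).trans (by gcongr with T hT; exact hterm T hT)
    _ = ENNReal.ofReal (1 + (N + 1) * B) := by
        rw [Finset.sum_const, Finset.card_range, nsmul_eq_mul,
          ENNReal.ofReal_add zero_le_one (by positivity), ENNReal.ofReal_one,
          ENNReal.ofReal_mul (by positivity)]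
        congr 2
        rw [← ENNReal.ofReal_natCast]
        push_cast
        rfl
    _ ≤ ENNReal.ofReal (2 ^ (δ / 2 * N) * B) := by
        refine ENNReal.ofReal_le_ofReal ?_
        calc 1 + ((N : ℝ) + 1) * B ≤ 1 * B + (N + 1) * B := by linarith
          _ = (N + 2) * B := by ring
          _ ≤ _ := by
            gcongr
            linarith [pow_one (N : ℝ)]
    _ = _ := by
        rw [hB, ← Real.rpow_add two_pos]
        congr 2
        ring

/-- A lower bound of the kind provided by the exploration of the first `T N` variables, up to
polynomial factors `P N` and `Q N`. -/
theorem eventually_ofReal_le_of_ratio (hk : 3 ≤ k) (hα : 0 < α) (e : ℕ) {D τ δ C : ℝ} {p : ℕ}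
    (hD : 0 < D) (hD1 : D ≤ 1) (hδ : 0 < δ) {T y P Q : ℕ → ℕ}
    (hT : ∀ᶠ N in atTop, (τ - δ) * N ≤ T N)
    (hy : ∀ᶠ N in atTop, D * (N.choose k * 2 ^ k : ℕ) ≤ y N)
    (hP : ∀ᶠ N in atTop, 0 < P N) (hQ : ∀ᶠ N in atTop, 0 < Q N)
    (hPQ : ∀ᶠ N : ℕ in atTop, (P N : ℝ) * Q N ≤ C * (N : ℝ) ^ p) :
    ∀ᶠ N : ℕ in atTop,
      ENNReal.ofReal (2 ^ ((N : ℝ) * (τ + α * Real.logb 2 D - 3 * δ))) ≤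
        (2 : ℝ≥0∞) ^ T N * ((P N : ℕ) : ℝ≥0∞)⁻¹ *
          (((y N).choose (⌊α * N⌋₊ - e) : ℕ) * ((Q N : ℕ) : ℝ≥0∞)⁻¹) /
            ((N.choose k * 2 ^ k).choose ⌊α * N⌋₊ : ℕ) := by
  filter_upwards [hT, hy, hP, hQ, hPQ, eventually_le_choose_ratio hk hα e hD hD1 hδ,
    eventually_mul_pow_le_rpow C p hδ, eventually_floor_le hk hα one_pos 0]
    with N hT hy hP hQ hPQ hratio hpoly hM
  have hMx : ⌊α * N⌋₊ ≤ N.choose k * 2 ^ k := by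
    have : (⌊α * N⌋₊ : ℝ) ≤ (N.choose k * 2 ^ k : ℕ) := by linarith
    exact_mod_cast this
  have hc : (0 : ℝ) < ((N.choose k * 2 ^ k).choose ⌊α * N⌋₊ : ℕ) := by
    exact_mod_cast Nat.choose_pos hMx
  have hP' : (0 : ℝ) < P N := by exact_mod_cast hP
  have hQ' : (0 : ℝ) < Q N := by exact_mod_cast hQ
  have hconv : ENNReal.ofReal ((2 : ℝ) ^ T N * (P N : ℝ)⁻¹ *
      (((y N).choose (⌊α * N⌋₊ - e) : ℕ) * (Q N : ℝ)⁻¹) /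
        ((N.choose k * 2 ^ k).choose ⌊α * N⌋₊ : ℕ)) =
      (2 : ℝ≥0∞) ^ T N * ((P N : ℕ) : ℝ≥0∞)⁻¹ *
          (((y N).choose (⌊α * N⌋₊ - e) : ℕ) * ((Q N : ℕ) : ℝ≥0∞)⁻¹) /
            ((N.choose k * 2 ^ k).choose ⌊α * N⌋₊ : ℕ) := by
    rw [ENNReal.ofReal_div_of_pos hc, ENNReal.ofReal_mul (by positivity),
      ENNReal.ofReal_mul (by positivity), ENNReal.ofReal_mul (by positivity),
      ENNReal.ofReal_pow two_pos.le, ENNReal.ofReal_inv_of_pos hP', ENNReal.ofReal_inv_of_pos hQ']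
    simp only [ENNReal.ofReal_natCast, ENNReal.ofReal_ofNat]
  rw [← hconv]
  refine ENNReal.ofReal_le_ofReal ?_
  have h1 := hratio (y N) hy
  have h2 : (2 : ℝ) ^ ((τ - δ) * N) ≤ 2 ^ T N := by
    rw [← Real.rpow_natCast 2 (T N)]
    exact Real.rpow_le_rpow_of_exponent_le one_le_two hT
  calc (2 : ℝ) ^ ((N : ℝ) * (τ + α * Real.logb 2 D - 3 * δ))
      = 2 ^ ((τ - δ) * N) * 2 ^ ((N : ℝ) * (α * Real.logb 2 D - δ)) / 2 ^ (δ * N) := by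
        rw [← Real.rpow_add two_pos, ← Real.rpow_sub two_pos]
        congr 1
        ring
    _ ≤ 2 ^ T N * (((y N).choose (⌊α * N⌋₊ - e) : ℝ) /
          ((N.choose k * 2 ^ k).choose ⌊α * N⌋₊ : ℝ)) / ((P N : ℝ) * Q N) := by
        gcongr
        exact hPQ.trans hpoly
    _ = _ := by
        field_simp

theorem exists_lt_mul_logb_eq (hα : 0 < α) {D δ : ℝ} (hD : 0 < D) (hδ : 0 < δ) :
    ∃ D₁, 0 < D₁ ∧ D₁ < D ∧ α * Real.logb 2 D₁ = α * Real.logb 2 D - δ := by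
  have h : (2 : ℝ) ^ (-(δ / α)) < 1 :=
    Real.rpow_lt_one_of_one_lt_of_neg one_lt_two (by linarith [div_pos hδ hα])
  have h0 : (0 : ℝ) < 2 ^ (-(δ / α)) := by positivity
  refine ⟨D * 2 ^ (-(δ / α)), by positivity, mul_lt_of_lt_one_right hD h, ?_⟩
  rw [Real.logb_mul hD.ne' h0.ne', Real.logb_rpow two_pos one_lt_two.ne']
  field_simp
  ring

theorem eventually_choose_pred_le (hk : 1 ≤ k) {ε : ℝ} (hε : 0 < ε) :
    ∀ᶠ N : ℕ in atTop, (N.choose (k - 1) : ℝ) ≤ ε * N.choose k := by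
  have hlim : Tendsto (fun N : ℕ => ε * (N : ℝ)) atTop atTop :=
    tendsto_natCast_atTop_atTop.const_mul_atTop hε
  filter_upwards [hlim.eventually_ge_atTop (k + ε * k), eventually_ge_atTop k] with N h1 h2
  have h := Nat.choose_succ_right_eq N (k - 1)
  rw [Nat.sub_add_cancel hk] at h
  have h' := congrArg (Nat.cast (R := ℝ)) h
  rw [Nat.cast_mul, Nat.cast_mul, Nat.cast_sub (by omega), Nat.cast_sub hk] at h'
  push_cast at h'
  have hkε : (k : ℝ) ≤ ε * (N - k) := by linarith
  have hk0 : (0 : ℝ) < k := by exact_mod_cast hk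
  have hNk : (N : ℝ) - k ≤ N - (k - 1) := by linarith
  refine le_of_mul_le_mul_right ?_ hk0
  calc (N.choose (k - 1) : ℝ) * k ≤ N.choose (k - 1) * (ε * (N - (k - 1))) := by gcongr; nlinarith
    _ = ε * (N.choose (k - 1) * (N - (k - 1))) := by ring
    _ = _ := by rw [← h']; ring

/-- At full depth, the clauses that would interfere with a run are asymptotically those that are
violated by the target assignment. -/
theorem eventually_le_sub_of_le_choose (hk : 3 ≤ k) (hα : 0 < α) (e : ℕ) {D : ℝ}
    (hD : D < survival k 1) {b : ℕ → ℕ} (hb : ∀ᶠ N in atTop, b N ≤ N.choose k) :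
    ∀ᶠ N : ℕ in atTop, D * (N.choose k * 2 ^ k : ℕ) ≤
      (N.choose k * 2 ^ k - e - (b N + 2 * (N - 2).choose (k - 1)) : ℕ) := by
  have hη : 0 < (survival k 1 - D) / 4 := by linarith
  filter_upwards [hb, eventually_choose_pred_le (by omega : 1 ≤ k) hη,
    eventually_floor_le hk hα (by linarith : 0 < (survival k 1 - D) / 2) e] with N hb h1 h2
  set x := N.choose k * 2 ^ k with hx
  have h3 : (x : ℝ) ≤ ((x - e - (b N + 2 * (N - 2).choose (k - 1)) : ℕ) : ℝ) + e + b N +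
      2 * (N - 2).choose (k - 1) := by
    exact_mod_cast (by omega)
  have h4 : ((N - 2).choose (k - 1) : ℝ) ≤ N.choose (k - 1) := by
    exact_mod_cast Nat.choose_le_choose _ (Nat.sub_le _ _)
  have h5 : (b N : ℝ) ≤ N.choose k := by exact_mod_cast hb
  have h6 : (N.choose k : ℝ) = (1 - survival k 1) * x := by
    rw [survival_one, hx]
    push_cast
    field_simp
    ring
  have h7 : (N.choose k : ℝ) ≤ x := by
    exact_mod_cast Nat.le_mul_of_pos_right _ (by positivity)
  have h8 : (survival k 1 - D) / 4 * N.choose k ≤ (survival k 1 - D) / 4 * x := by gcongr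
  have h9 : (0 : ℝ) ≤ (⌊α * N⌋₊ : ℝ) := by positivity
  linarith

theorem choose_two_le (N : ℕ) : (N.choose 2 : ℝ) ≤ (N : ℝ) ^ 2 := by
  exact_mod_cast Nat.choose_le_pow N 2

theorem eventually_le_floor {c : ℝ} (hc : 0 < c) (C : ℕ) :
    ∀ᶠ N : ℕ in atTop, C ≤ ⌊c * (N : ℝ)⌋₊ := by
  have hlim : Tendsto (fun N : ℕ => c * (N : ℝ)) atTop atTop :=
    tendsto_natCast_atTop_atTop.const_mul_atTop hc
  filter_upwards [hlim.eventually_ge_atTop (C : ℝ)] with N hN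
  exact Nat.le_floor hN

theorem eventually_sub_mul_le_sub_two {δ : ℝ} (hδ : 0 < δ) :
    ∀ᶠ N : ℕ in atTop, (1 - δ) * (N : ℝ) ≤ (N - 2 : ℕ) := by
  have hlim : Tendsto (fun N : ℕ => δ * (N : ℝ)) atTop atTop :=
    tendsto_natCast_atTop_atTop.const_mul_atTop hδ
  filter_upwards [hlim.eventually_ge_atTop 2, eventually_ge_atTop 2] with N h1 h2
  rw [Nat.cast_sub h2]
  push_cast
  linarith

theorem eventually_le_expectation_solutionLeaves (rule : (N : ℕ) → UnitRule N) (hk : 3 ≤ k)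
    (hα : 0 < α) {δ : ℝ} (hδ : 0 < δ) :
    ∀ᶠ N : ℕ in atTop, ENNReal.ofReal (2 ^ ((N : ℝ) * (omegaS α k - δ))) ≤
      expectation k N ⌊α * (N : ℝ)⌋₊ (rule N) SearchTree.solutionLeaves := by
  have h01 : (1 : ℝ) ∈ Set.Icc (0 : ℝ) 1 := Set.right_mem_Icc.2 zero_le_one
  have hs0 : 0 < survival k 1 := by linarith [le_survival hk h01]
  have hδ4 : 0 < δ / 4 := by linarith
  obtain ⟨D, hD0, hD, hlog⟩ := exists_lt_mul_logb_eq hα hs0 hδ4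
  have h := eventually_ofReal_le_of_ratio hk hα 1 (D := D) (τ := 1) (δ := δ / 4) (C := 1) (p := 2)
    (T := fun N => N - 2) (P := fun _ => 1) (Q := fun N => N.choose 2) hD0
    (hD.le.trans (survival_le_one hk h01)) hδ4 (eventually_sub_mul_le_sub_two hδ4)
    (eventually_le_sub_of_le_choose hk hα 1 hD (Eventually.of_forall fun N => le_rfl))
    (Eventually.of_forall fun _ => one_pos)
    ((eventually_ge_atTop 2).mono fun N hN => Nat.choose_pos hN)
    (Eventually.of_forall fun N => by simpa using choose_two_le N)
  filter_upwards [h, eventually_ge_atTop k, eventually_le_floor hα 1] with N h1 h2 h3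
  refine le_trans (le_of_eq ?_) (h1.trans (le_trans (le_of_eq ?_)
    (le_expectation_solutionLeaves hk h2 h3)))
  · rw [hlog, omegaS, Omega_eq]
    congr 3
    ring
  · simp only [Nat.cast_one, inv_one]

theorem eventually_le_expectation_contradictionLeaves_one (rule : (N : ℕ) → UnitRule N)
    (hk : 3 ≤ k) (hα : 0 < α) {δ : ℝ} (hδ : 0 < δ) :
    ∀ᶠ N : ℕ in atTop, ENNReal.ofReal (2 ^ ((N : ℝ) * (Omega 1 α k - δ))) ≤
      expectation k N ⌊α * (N : ℝ)⌋₊ (rule N) SearchTree.contradictionLeaves := by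
  have h01 : (1 : ℝ) ∈ Set.Icc (0 : ℝ) 1 := Set.right_mem_Icc.2 zero_le_one
  have hs0 : 0 < survival k 1 := by linarith [le_survival hk h01]
  have hδ4 : 0 < δ / 4 := by linarith
  obtain ⟨D, hD0, hD, hlog⟩ := exists_lt_mul_logb_eq hα hs0 hδ4
  have h := eventually_ofReal_le_of_ratio hk hα 2 (D := D) (τ := 1) (δ := δ / 4) (C := 1) (p := 3)
    (T := fun N => N - 2) (P := fun N => N) (Q := fun N => N.choose 2) hD0
    (hD.le.trans (survival_le_one hk h01)) hδ4 (eventually_sub_mul_le_sub_two hδ4)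
    (eventually_le_sub_of_le_choose hk hα 2 hD (b := fun N => numBlocking k N (N - 2))
      (Eventually.of_forall fun N => numBlocking_le (by omega) (Nat.sub_le _ _)))
    (eventually_gt_atTop 0)
    ((eventually_ge_atTop 2).mono fun N hN => Nat.choose_pos hN)
    (Eventually.of_forall fun N => by
      calc (N : ℝ) * N.choose 2 ≤ N * (N : ℝ) ^ 2 := by gcongr; exact choose_two_le N
        _ = _ := by ring)
  filter_upwards [h, eventually_ge_atTop k, eventually_le_floor hα 2] with N h1 h2 h3
  refine le_trans (le_of_eq ?_) (h1.trans (le_expectation_contradictionLeaves hk h2 h3))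
  rw [hlog, Omega_eq]
  congr 3
  ring

/-- Unit propagation is subcritical under the hypothesis that `exists_maximizer` provides: as
`Real.log 2 < 1`, each step of the exploration examines so few clauses that less than one of them
is expected to belong to the instance, by a fixed factor. -/
theorem eventually_stepCount_mul_le (hk : 3 ≤ k) (hα : 0 < α) {t : ℝ} (ht1 : t ≤ 1)
    (h : ∀ s ∈ Set.Icc 0 t,
      α * ((k : ℝ) * ((k : ℝ) - 1) / 2 ^ k * (s ^ (k - 2) - s ^ (k - 1))) ≤ Real.log 2) :
    ∀ᶠ N : ℕ in atTop, ∀ j : ℕ, (j : ℝ) ≤ t * N →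
      (stepCount k N j : ℝ) * ⌊α * N⌋₊ ≤ 71 / 100 * (N.choose k * 2 ^ k : ℕ) := by
  filter_upwards [eventually_ge_atTop (1000 * k)] with N hN j hj
  have hk0 : 0 < k := by omega
  have hkN : k ≤ N := by omega
  have hN0 : (0 : ℝ) < N := by exact_mod_cast (by omega : 0 < N)
  have hjN : j ≤ N := by
    have : (j : ℝ) ≤ N := hj.trans (mul_le_of_le_one_left hN0.le ht1)
    exact_mod_cast this
  set s : ℝ := (j : ℝ) / N with hs
  have hsI : s ∈ Set.Icc 0 t := ⟨by positivity, (div_le_iff₀ hN0).2 hj⟩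
  have hs1 : s ≤ 1 := hsI.2.trans ht1
  have hM : (⌊α * N⌋₊ : ℝ) ≤ α * N := Nat.floor_le (by positivity)
  have hc0 : (0 : ℝ) < N.choose (k - 2) := by exact_mod_cast Nat.choose_pos (by omega)
  have h1 : (j.choose (k - 2) : ℝ) ≤ s ^ (k - 2) * N.choose (k - 2) :=
    (div_le_iff₀ hc0).1 (choose_div_choose_le hjN (by omega))
  have h2 : ((N - (j + 1) : ℕ) : ℝ) ≤ N * (1 - s) := by
    have h3 : (N : ℝ) * (1 - s) = ((N - j : ℕ) : ℝ) := by
      rw [Nat.cast_sub hjN, hs]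
      field_simp
    rw [h3]
    exact_mod_cast (by omega)
  have hrec : (N.choose k : ℝ) * (k * (k - 1)) =
      N.choose (k - 2) * ((N - (k - 2)) * (N - (k - 1))) := by
    have e1 := Nat.choose_succ_right_eq N (k - 1)
    have e2 := Nat.choose_succ_right_eq N (k - 2)
    rw [show k - 1 + 1 = k by omega] at e1
    rw [show k - 2 + 1 = k - 1 by omega] at e2
    have e1' := congrArg (Nat.cast (R := ℝ)) e1
    have e2' := congrArg (Nat.cast (R := ℝ)) e2
    rw [Nat.cast_mul, Nat.cast_mul, Nat.cast_sub (by omega), Nat.cast_sub (by omega)] at e1'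
    rw [Nat.cast_mul, Nat.cast_mul, Nat.cast_sub (by omega), Nat.cast_sub (by omega),
      Nat.cast_sub (by omega)] at e2'
    push_cast at e1' e2'
    calc (N.choose k : ℝ) * (k * (k - 1)) = (N.choose k * k) * (k - 1) := by ring
      _ = (N.choose (k - 1) * (k - 1)) * (N - (k - 1)) := by rw [e1']; ring
      _ = _ := by rw [e2']; ring
  have hN2 : (N : ℝ) * N ≤ 101 / 100 * ((N - (k - 2)) * (N - (k - 1))) := by
    have h3 : (1000 : ℝ) * k ≤ N := by exact_mod_cast hN
    have h4 : 999 / 1000 * (N : ℝ) ≤ N - (k - 2) := by linarith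
    have h5 : 999 / 1000 * (N : ℝ) ≤ N - (k - 1) := by linarith
    have h6 := mul_le_mul h4 h5 (by positivity) (by linarith)
    have h7 : 0 ≤ (N : ℝ) * N := by positivity
    linarith
  have hq : 0 ≤ s ^ (k - 2) * (1 - s) := mul_nonneg (pow_nonneg hsI.1 _) (by linarith)
  have hpow : s ^ (k - 2) - s ^ (k - 1) = s ^ (k - 2) * (1 - s) := by
    rw [show k - 1 = k - 2 + 1 by omega, pow_succ]
    ring
  have hh := h s hsI
  rw [hpow] at hh
  have hstep : (stepCount k N j : ℝ) ≤ N * (1 - s) * (s ^ (k - 2) * N.choose (k - 2)) := by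
    rw [stepCount, Nat.cast_mul]
    have : 0 ≤ N * (1 - s) := mul_nonneg hN0.le (by linarith)
    gcongr
  calc (stepCount k N j : ℝ) * ⌊α * N⌋₊
      ≤ N * (1 - s) * (s ^ (k - 2) * N.choose (k - 2)) * (α * N) := by gcongr
    _ = α * (s ^ (k - 2) * (1 - s)) * N.choose (k - 2) * (N * N) := by ring
    _ ≤ α * (s ^ (k - 2) * (1 - s)) * N.choose (k - 2) *
        (101 / 100 * ((N - (k - 2)) * (N - (k - 1)))) := by gcongr
    _ = α * (s ^ (k - 2) * (1 - s)) * (101 / 100) * (N.choose k * (k * (k - 1))) := by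
        rw [hrec]
        ring
    _ = (α * (k * (k - 1) / 2 ^ k * (s ^ (k - 2) * (1 - s)))) *
        (101 / 100 * (N.choose k * 2 ^ k : ℕ)) := by
        push_cast
        field_simp
    _ ≤ 7 / 10 * (101 / 100 * (N.choose k * 2 ^ k : ℕ)) := by
        gcongr
        exact hh.trans log_two_lt.le
    _ ≤ _ := by
        have : (0 : ℝ) ≤ (N.choose k * 2 ^ k : ℕ) := by positivity
        linarith

/-- The lower bound at an interior maximizer `t` of `Omega`. The exploration of the first
`T = (K + 1) r ≈ t N` variables proceeds in `K + 1` rounds of `r` variables; the clauses revealed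
by the last round are too few to matter if `r / N` is small, while `K` stays bounded. -/
theorem eventually_le_expectation_contradictionLeaves_of_lt_one (rule : (N : ℕ) → UnitRule N)
    (hk : 3 ≤ k) (hα : 0 < α) {t : ℝ} (ht0 : 0 < t) (ht1 : t < 1)
    (hsub : ∀ s ∈ Set.Icc 0 t,
      α * ((k : ℝ) * ((k : ℝ) - 1) / 2 ^ k * (s ^ (k - 2) - s ^ (k - 1))) ≤ Real.log 2)
    {δ : ℝ} (hδ : 0 < δ) :
    ∀ᶠ N : ℕ in atTop, ENNReal.ofReal (2 ^ ((N : ℝ) * (Omega t α k - δ))) ≤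
      expectation k N ⌊α * (N : ℝ)⌋₊ (rule N) SearchTree.contradictionLeaves := by
  have htI : t ∈ Set.Icc (0 : ℝ) 1 := ⟨ht0.le, ht1.le⟩
  have hs0 : 0 < survival k t := by linarith [le_survival hk htI]
  have hδ4 : 0 < δ / 4 := by linarith
  obtain ⟨D, hD0, hD, hlog⟩ := exists_lt_mul_logb_eq hα hs0 hδ4
  set η : ℝ := survival k t - D with hη
  have hη0 : 0 < η := by linarith
  obtain ⟨ρ, hρ0, hρη, hρt, hρδ⟩ : ∃ ρ : ℝ, 0 < ρ ∧ ρ ≤ α * η / 8 ∧ ρ ≤ t / 4 ∧ ρ ≤ δ / 8 :=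
    ⟨min (α * η / 8) (min (t / 4) (δ / 8)), by positivity, min_le_left _ _,
      (min_le_right _ _).trans (min_le_left _ _), (min_le_right _ _).trans (min_le_right _ _)⟩
  -- the number of rounds, and their length
  obtain ⟨K, hK⟩ : ∃ K, K + 1 = ⌊t / ρ⌋₊ := by
    have : 1 ≤ ⌊t / ρ⌋₊ := Nat.le_floor (by
      rw [Nat.cast_one, le_div_iff₀ hρ0]
      linarith)
    exact ⟨⌊t / ρ⌋₊ - 1, by omega⟩
  have hK1 : ((K : ℝ) + 1) * ρ ≤ t := by
    have h := Nat.floor_le (div_pos ht0 hρ0).le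
    rw [← hK, le_div_iff₀ hρ0] at h
    exact_mod_cast h
  have hK2 : t < ((K : ℝ) + 1 + 1) * ρ := by
    have h := Nat.lt_floor_add_one (t / ρ)
    rw [← hK, div_lt_iff₀ hρ0] at h
    exact_mod_cast h
  set r : ℕ → ℕ := fun N => ⌊ρ * (N : ℝ)⌋₊ with hr
  have hlim : ∀ c : ℝ, 0 < c → Tendsto (fun N : ℕ => c * (N : ℝ)) atTop atTop := fun c hc =>
    tendsto_natCast_atTop_atTop.const_mul_atTop hc
  have hTle : ∀ N : ℕ, (((K + 1) * r N : ℕ) : ℝ) ≤ t * N := fun N => by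
    have h : (r N : ℝ) ≤ ρ * N := Nat.floor_le (by positivity)
    calc (((K + 1) * r N : ℕ) : ℝ) = ((K : ℝ) + 1) * r N := by push_cast; ring
      _ ≤ ((K : ℝ) + 1) * (ρ * N) := by gcongr
      _ = ((K : ℝ) + 1) * ρ * N := by ring
      _ ≤ _ := by gcongr
  have hTge : ∀ᶠ N : ℕ in atTop, (t - 2 * ρ) * (N : ℝ) ≤ (((K + 1) * r N : ℕ) : ℝ) := by
    filter_upwards [(hlim ρ hρ0).eventually_ge_atTop ((K : ℝ) + 1)] with N hN
    have h : ρ * N - 1 ≤ r N := by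
      have := Nat.lt_floor_add_one (ρ * (N : ℝ))
      linarith
    have h1 : t * N ≤ ((K : ℝ) + 1 + 1) * ρ * N := by gcongr
    calc (t - 2 * ρ) * (N : ℝ) ≤ ((K : ℝ) + 1) * (ρ * N - 1) := by linarith
      _ ≤ ((K : ℝ) + 1) * r N := by gcongr
      _ = _ := by push_cast; ring
  have hTN : ∀ᶠ N : ℕ in atTop, (K + 1) * r N + 2 ≤ N := by
    filter_upwards [(hlim (1 - t) (by linarith)).eventually_ge_atTop 2] with N hN
    have h := hTle N
    have : (((K + 1) * r N + 2 : ℕ) : ℝ) ≤ N := by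
      rw [Nat.cast_add]
      push_cast at h ⊢
      linarith
    exact_mod_cast this
  have hkT : ∀ᶠ N : ℕ in atTop, k ≤ (K + 1) * r N + 2 := by
    filter_upwards [(hlim (t - 2 * ρ) (by linarith)).eventually_ge_atTop k, hTge] with N h1 h2
    have h3 : (k : ℝ) ≤ ((K + 1) * r N : ℕ) := h1.trans h2
    have h4 : k ≤ (K + 1) * r N := by exact_mod_cast h3
    omega
  have hstep := eventually_stepCount_mul_le hk hα ht1.le hsub
  have hfit : ∀ᶠ N : ℕ in atTop, D * (N.choose k * 2 ^ k : ℕ) ≤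
      (N.choose k * 2 ^ k - 2 - (numBlocking k N ((K + 1) * r N) +
        ∑ i ∈ Finset.range (r N), stepCount k N (K * r N + i)) : ℕ) := by
    filter_upwards [hstep, hTN, abs_numBlocking_sub_le hk (ε := η / 4) (by linarith),
      eventually_floor_le hk hα (by linarith : 0 < η / 2) 2, eventually_ge_atTop k,
      eventually_ge_atTop 1, (hlim (α / 2) (by linarith)).eventually_ge_atTop 1]
      with N hstep hTN hb h2 hkN hN hαN
    set x := N.choose k * 2 ^ k with hx
    set b := numBlocking k N ((K + 1) * r N) with hbdef
    set S := ∑ i ∈ Finset.range (r N), stepCount k N (K * r N + i) with hS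
    have hN0 : (0 : ℝ) < N := by exact_mod_cast hN
    have hx0 : (0 : ℝ) < x := by
      have : 0 < N.choose k := Nat.choose_pos hkN
      exact_mod_cast (by positivity : 0 < N.choose k * 2 ^ k)
    have h3 : (x : ℝ) ≤ ((x - 2 - (b + S) : ℕ) : ℝ) + 2 + b + S := by
      exact_mod_cast (by omega : x ≤ (x - 2 - (b + S)) + 2 + b + S)
    have hbx : (b : ℝ) ≤ (1 - survival k t + η / 4) * x := by
      rw [← div_le_iff₀ hx0]
      have h4 := (abs_le.1 (hb ((K + 1) * r N) (by omega))).2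
      have hle : (((K + 1) * r N : ℕ) : ℝ) / N ≤ t := (div_le_iff₀ hN0).2 (hTle N)
      have h5 := antitoneOn_survival hk ⟨by positivity, hle.trans ht1.le⟩ htI hle
      linarith
    have hM0 : α / 2 * N ≤ ⌊α * (N : ℝ)⌋₊ := by
      have := Nat.lt_floor_add_one (α * (N : ℝ))
      linarith
    have hSM : (S : ℝ) * ⌊α * (N : ℝ)⌋₊ ≤ ρ * N * x := by
      rw [hS, Nat.cast_sum, Finset.sum_mul]
      calc ∑ i ∈ Finset.range (r N), (stepCount k N (K * r N + i) : ℝ) * ⌊α * (N : ℝ)⌋₊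
          ≤ ∑ i ∈ Finset.range (r N), (x : ℝ) := by
            refine Finset.sum_le_sum fun i hi => ?_
            have hi' := Finset.mem_range.1 hi
            have hle : K * r N + i ≤ (K + 1) * r N := by
              rw [Nat.succ_mul]
              omega
            have h4 := hstep (K * r N + i) (le_trans (by exact_mod_cast hle) (hTle N))
            linarith
        _ = r N * x := by rw [Finset.sum_const, Finset.card_range, nsmul_eq_mul]
        _ ≤ _ := by
            gcongr
            exact Nat.floor_le (by positivity)
    have hSx : (S : ℝ) ≤ η / 4 * x := by
      have h4 : (S : ℝ) * (α / 2 * N) ≤ α * η / 8 * N * x :=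
        (mul_le_mul_of_nonneg_left hM0 (by positivity)).trans (hSM.trans (by gcongr))
      refine le_of_mul_le_mul_right (a := α / 2 * N) (h4.trans (le_of_eq ?_)) (by positivity)
      ring
    have h9 : (0 : ℝ) ≤ (⌊α * N⌋₊ : ℝ) := by positivity
    have h10 : D = survival k t - η := by rw [hη]; ring
    rw [h10]
    linarith
  have h := eventually_ofReal_le_of_ratio hk hα 2 (D := D) (τ := t) (δ := δ / 4)
    (C := (α + 1) ^ K) (p := K + 1)
    (T := fun N => (K + 1) * r N) (P := fun N => N) (Q := fun N => (⌊α * (N : ℝ)⌋₊ + 1) ^ K) hD0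
    (hD.le.trans (survival_le_one hk htI)) hδ4
    (hTge.mono fun N hN => le_trans (by gcongr; linarith) hN) hfit
    (eventually_gt_atTop 0) (Eventually.of_forall fun N => by positivity)
    ((eventually_ge_atTop 1).mono fun N hN => by
      have hN1 : (1 : ℝ) ≤ N := by exact_mod_cast hN
      have h1 : (⌊α * (N : ℝ)⌋₊ : ℝ) ≤ α * N := Nat.floor_le (by positivity)
      calc (N : ℝ) * ((⌊α * (N : ℝ)⌋₊ + 1) ^ K : ℕ) = N * ((⌊α * (N : ℝ)⌋₊ : ℝ) + 1) ^ K := by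
            push_cast
            ring
        _ ≤ N * ((α + 1) * N) ^ K := by
            gcongr
            linarith
        _ = _ := by
            rw [mul_pow]
            ring)
  filter_upwards [h, hTN, hkT, eventually_le_floor hα 2, hstep,
    eventually_floor_le hk hα (by norm_num : (0 : ℝ) < 1 / 25) 2]
    with N h1 hTN hkT hM hstep hMx
  set x := N.choose k * 2 ^ k with hx
  have hx8 : 8 * (N.choose k : ℝ) ≤ x := by
    have h8 : (2 : ℝ) ^ 3 ≤ 2 ^ k := pow_le_pow_right₀ one_le_two hk
    rw [hx]
    push_cast
    nlinarith [(Nat.cast_nonneg (N.choose k) : (0 : ℝ) ≤ N.choose k)]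
  have hsum : ((∑ j ∈ Finset.range ((K + 1) * r N), stepCount k N j : ℕ) : ℝ) ≤ N.choose k := by
    exact_mod_cast sum_stepCount_le (by omega) (by omega)
  have hb : (numBlocking k N ((K + 1) * r N) : ℝ) ≤ N.choose k := by
    exact_mod_cast numBlocking_le (by omega) (by omega)
  have hM0 : (0 : ℝ) ≤ (⌊α * (N : ℝ)⌋₊ : ℝ) := by positivity
  have hxge : ∑ j ∈ Finset.range ((K + 1) * r N), stepCount k N j + 2 +
      numBlocking k N ((K + 1) * r N) ≤ x := by
    have : ((∑ j ∈ Finset.range ((K + 1) * r N), stepCount k N j + 2 +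
      numBlocking k N ((K + 1) * r N) : ℕ) : ℝ) ≤ x := by
      rw [Nat.cast_add, Nat.cast_add]
      push_cast at hsum ⊢
      linarith
    exact_mod_cast this
  obtain ⟨W, hW⟩ : ∃ W, W + ∑ j ∈ Finset.range ((K + 1) * r N), stepCount k N j + 2 +
      numBlocking k N ((K + 1) * r N) = x :=
    ⟨x - (∑ j ∈ Finset.range ((K + 1) * r N), stepCount k N j + 2 +
      numBlocking k N ((K + 1) * r N)), by omega⟩
  have hW' : (W : ℝ) + (∑ j ∈ Finset.range ((K + 1) * r N), stepCount k N j : ℕ) + 2 +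
      numBlocking k N ((K + 1) * r N) = x := by
    exact_mod_cast hW
  refine le_trans (le_of_eq ?_) (h1.trans
    (le_expectation_contradictionLeaves_of_step hk hTN hkT hM hW fun j hj => ?_))
  · rw [hlog, Omega_eq]
    congr 3
    ring
  · have h2 := hstep j (le_trans (by exact_mod_cast hj.le) (hTle N))
    have h3 : ((stepCount k N j * ⌊α * (N : ℝ)⌋₊ + ⌊α * (N : ℝ)⌋₊ : ℕ) : ℝ) ≤ W := by
      rw [Nat.cast_add, Nat.cast_mul]
      linarith
    exact_mod_cast h3

theorem expectation_leaves (N M : ℕ) (rule : UnitRule N) :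
    expectation k N M rule SearchTree.leaves =
      expectation k N M rule SearchTree.solutionLeaves +
        expectation k N M rule SearchTree.contradictionLeaves := by
  rw [expectation_eq fun _ => true, expectation_eq fun _ => true, expectation_eq fun _ => true,
    ← ENNReal.add_div, ← Finset.sum_add_distrib]
  simp only [value_leaves]

end exponents

end RandomSAT


theorem theorem1 (k : ℕ) (hk : 3 ≤ k) (α : ℝ) (hα : 0 < α)
    (rule : (N : ℕ) → RandomSAT.UnitRule N) :
    RandomSAT.HasExponent
      (fun N => RandomSAT.expectation k N ⌊α * (N : ℝ)⌋₊ (rule N)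
        RandomSAT.SearchTree.solutionLeaves)
      (RandomSAT.omegaS α k) ∧
    IsGreatest ((fun t : ℝ => RandomSAT.Omega t α k) '' Set.Icc 0 1) (RandomSAT.omegaC α k) ∧
    RandomSAT.HasExponent
      (fun N => RandomSAT.expectation k N ⌊α * (N : ℝ)⌋₊ (rule N)
        RandomSAT.SearchTree.contradictionLeaves)
      (RandomSAT.omegaC α k) ∧
    RandomSAT.HasExponent
      (fun N => RandomSAT.expectation k N ⌊α * (N : ℝ)⌋₊ (rule N)
        RandomSAT.SearchTree.leaves)
      (RandomSAT.omegaC α k) := by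
  obtain ⟨t, ht, hmax, hcase⟩ := RandomSAT.exists_maximizer hk hα
  have htI : t ∈ Set.Icc (0 : ℝ) 1 := ⟨ht.1.le, ht.2⟩
  have hω : RandomSAT.omegaC α k = RandomSAT.Omega t α k := RandomSAT.omegaC_eq htI hmax
  have hlow : ∀ δ > 0, ∀ᶠ N : ℕ in atTop,
      ENNReal.ofReal (2 ^ ((N : ℝ) * (RandomSAT.omegaC α k - δ))) ≤
        RandomSAT.expectation k N ⌊α * (N : ℝ)⌋₊ (rule N)
          RandomSAT.SearchTree.contradictionLeaves := by
    intro δ hδ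
    rw [hω]
    rcases eq_or_lt_of_le ht.2 with rfl | hlt
    · exact RandomSAT.eventually_le_expectation_contradictionLeaves_one rule hk hα hδ
    · exact RandomSAT.eventually_le_expectation_contradictionLeaves_of_lt_one rule hk hα ht.1 hlt
        (hcase.resolve_left hlt.ne) hδ
  have hup : ∀ δ > 0, ∀ᶠ N : ℕ in atTop,
      RandomSAT.expectation k N ⌊α * (N : ℝ)⌋₊ (rule N) RandomSAT.SearchTree.leaves ≤
        ENNReal.ofReal (2 ^ ((N : ℝ) * (RandomSAT.omegaC α k + δ))) := fun δ hδ => by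
    rw [hω]
    exact RandomSAT.eventually_expectation_leaves_le rule hk hα hmax hδ
  have hle : ∀ N : ℕ, RandomSAT.expectation k N ⌊α * (N : ℝ)⌋₊ (rule N)
      RandomSAT.SearchTree.contradictionLeaves ≤
        RandomSAT.expectation k N ⌊α * (N : ℝ)⌋₊ (rule N) RandomSAT.SearchTree.leaves := fun N => by
    rw [RandomSAT.expectation_leaves]
    exact le_add_self
  refine ⟨RandomSAT.hasExponent_of_bounds
    (fun δ hδ => RandomSAT.eventually_le_expectation_solutionLeaves rule hk hα hδ)
    (fun δ hδ => RandomSAT.eventually_expectation_solutionLeaves_le rule hk hα hδ), ?_,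
    RandomSAT.hasExponent_of_bounds hlow
      fun δ hδ => (hup δ hδ).mono fun N hN => (hle N).trans hN,
    RandomSAT.hasExponent_of_bounds
      (fun δ hδ => (hlow δ hδ).mono fun N hN => hN.trans (hle N)) hup⟩
  rw [hω]
  refine ⟨⟨t, htI, rfl⟩, ?_⟩
  rintro _ ⟨s, hs, rfl⟩
  exact hmax s hs
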